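/- **Model.** Let $\theta=(K,\beta,A,\Sigma_Z,\Sigma_W,\sigma^2)$ with $\beta\in\mathbb R^K$, $A\in\mathbb R^{p\times K}$. The pair $(X,Y)\in\mathbb R^p\times\mathbb R$ follows the sub-Gaussian factor regression model sG-FRM$(\theta)$ with constants $\gamma_\varepsilon,\gamma_z,\gamma_w>0$ if $X=AZ+W$ and $Y=Z^\top\beta+\varepsilon$, where $Z\in\mathbb R^K$, $W\in\mathbb R^p$, $\varepsilon\in\mathbb R$ are mutually independent with mean zero, $\mathbb E[ZZ^\top]=\Sigma_Z$, $\mathbb E[WW^\top]=\Sigma_W$, $\mathbb E[\varepsilon^2]=\sigma^2$; $A$ and $\Sigma_Z$ have rank $K$; $\varepsilon$ is $\sigma\gamma_\varepsilon$ sub-Gaussian; $Z=\Sigma_Z^{1/2}\widetilde Z$ and $W=\Sigma_W^{1/2}\widetilde W$, where $\widetilde Z$ is $\gamma_z$ sub-Gaussian with $\mathbb E[\widetilde Z\widetilde Z^\top]=I_K$ and $\widetilde W$ is $\gamma_w$ sub-Gaussian with $\mathbb E[\widetilde W\widetilde W^\top]=I_p$. (A mean-zero random vector $x$ is $\gamma$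 sub-Gaussian if $\mathbb E\,e^{t\langle x,v\rangle}\le e^{t^2\gamma^2/2}$ for all $t\in\mathbb R$ and all unit vectors $v$.) **Predictor.** Let $\bm X=(X_1,\dots,X_n)^\top\in\mathbb R^{n\times p}$ and $\bm Y=(Y_1,\dots,Y_n)^\top$ consist of $n\ge1$ independent copies of $(X,Y)$, $p\ge 1$. Let $\bm X=\sum_j\sigma_ju_jv_j^\top$ be a singular value decomposition with non-increasing $\sigma_j$, chosen as a measurable function of $\bm X$; put $\bm X_{(k)}=\sum_{j\le k}\sigma_ju_jv_j^\top$ and $\bm U_k=(v_1,\dots,v_k)\in\mathbb R^{p\times k}$. With $M^+$ the Moore--Penrose inverse, the risk of PCR-$k$ is $$\mathcal R(\bm U_k)=\mathbb E_{(X_*,Y_*)}\big[(Y_*-X_*^\top\bm U_k[\bm X\bm U_k]^+\bm Y)^2\big],$$ the expectation being only over a new copy $(X_*,Y_*)$ of $(X,Y)$, independent of the data. For $c_0>0$ and $\kappa>1$ let $\mu_n=c_0(n+p)$, $$\bar K=\Big\lfloor\frac{\kappa}{1+\kappa}\frac{np}{\mu_n}\Big\rfloor\wedge n\wedge p,\qquad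 \widetilde s\in\operatorname*{arg\,min}_{0\le k\le\bar K}\frac{\|\bm X-\bm X_{(k)}\|_F^2}{np-\mu_nk},$$ where ties are broken by any measurable function of $\bm X$. Finally let $r_e(\Sigma_W)=\operatorname{tr}(\Sigma_W)/\|\Sigma_W\|_{\rm op}$ (for $\Sigma_W\neq0$) and $\delta_W=c_\delta\big(\|\Sigma_W\|_{\rm op}+\operatorname{tr}(\Sigma_W)/n\big)$ with a constant $c_\delta>0$. **Corollary 4.** For all $\gamma_w>0$ and $c'>0$ there is $\bar c_0=\bar c_0(\gamma_w,c')>0$ such that for every $c_0\ge\bar c_0$ and all $\gamma_\varepsilon,\gamma_z>0$, $\kappa>1$ and $C,c,c_\delta>0$ there are constants $M,L>0$, depending only on $\gamma_w,\gamma_\varepsilon,\gamma_z,c',c_0,\kappa,C,c,c_\delta$, with the following property. For all $n,p\ge1$, all $K\ge 0$ and every $\theta$ such that $(X,Y)$ follows sG-FRM$(\theta)$ with constants $\gamma_\varepsilon,\gamma_z,\gamma_w$, $\Sigma_W\ne0$, $$K\log n\le Cn,\qquad \log p\le cn,\qquad K\le\bar K,\qquad r_e(\Sigma_W)\ge c'(n\wedge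 p),$$ one has $$\mathbb P\Big\{\mathcal R(\bm U_{\widetilde s})-\sigma^2\le M\Big[(K+\log n)\frac{\sigma^2}{n}+\delta_W\,\beta^\top(A^\top A)^{-1}\beta\Big]\Big\}\ge1-\frac Ln .$$ -/

import Mathlib

open MeasureTheory ProbabilityTheory
open scoped Matrix

noncomputable section

namespace PCR

/-! ### Matrices -/

/-- `M⁺ = (MᵀM)⁺ Mᵀ`, where the pseudo-inverse of the symmetric matrix `MᵀM` inverts its non-zero
eigenvalues and keeps the zero ones. `isMoorePenrose_pinv` confirms that this is the
Moore-Penrose inverse. -/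
def pinv {m k : Type*} [Fintype m] [Fintype k] [DecidableEq k] (M : Matrix m k ℝ) :
    Matrix k m ℝ :=
  cfc (fun t : ℝ => t⁻¹) (Mᵀ * M) * Mᵀ

/-- The four Penrose equations, which determine `N` uniquely. -/
structure IsMoorePenrose {m k : Type*} [Fintype m] [Fintype k]
    (M : Matrix m k ℝ) (N : Matrix k m ℝ) : Prop where
  mul_mul_left : M * N * M = M
  mul_mul_right : N * M * N = N
  symm_left : (M * N)ᵀ = M * N
  symm_right : (N * M)ᵀ = N * M

theorem isMoorePenrose_pinv {m k : Type*} [Fintype m] [Fintype k] [DecidableEq k]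
    (M : Matrix m k ℝ) : IsMoorePenrose M (pinv M) := by
  set G : Matrix k k ℝ := Mᵀ * M with hG
  have hGsa : IsSelfAdjoint G := by
    show star G = G
    rw [Matrix.star_eq_conjTranspose, Matrix.conjTranspose_eq_transpose_of_trivial, hG]
    simp
  have hfin : (spectrum ℝ G).Finite := Matrix.finite_real_spectrum
  have hc : ∀ f : ℝ → ℝ, ContinuousOn f (spectrum ℝ G) := fun f => hfin.continuousOn f
  set g : Matrix k k ℝ := cfc (fun t : ℝ => t⁻¹) G with hg
  have hid : cfc (fun t : ℝ => t) G = G := cfc_id' ℝ G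
  have hsa : ∀ f : ℝ → ℝ, (cfc f G)ᵀ = cfc f G := by
    intro f
    have h : IsSelfAdjoint (cfc f G) := cfc_predicate f G
    have h2 : star (cfc f G) = cfc f G := h
    rwa [Matrix.star_eq_conjTranspose, Matrix.conjTranspose_eq_transpose_of_trivial] at h2
  have hgG : g * G = cfc (fun t : ℝ => t⁻¹ * t) G := by
    rw [cfc_mul _ _ _ (hc _) (hc _), hid]
  have hGgG : G * (g * G) = G := by
    rw [hgG]
    calc G * cfc (fun t : ℝ => t⁻¹ * t) G
        = cfc (fun t : ℝ => t) G * cfc (fun t : ℝ => t⁻¹ * t) G := by rw [hid]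
      _ = cfc (fun t : ℝ => t) G := by
        rw [← cfc_mul _ _ _ (hc _) (hc _)]
        congr 1
        funext t
        by_cases h : t = 0 <;> simp [h]
      _ = G := hid
  have hgGg : g * G * g = g := by
    rw [hgG, hg, ← cfc_mul _ _ _ (hc _) (hc _)]
    congr 1
    funext t
    by_cases h : t = 0 <;> simp [h]
  have hMgG : M * (g * G) = M := by
    have h0 : (M * (g * G) - M)ᴴ * (M * (g * G) - M) = 0 := by
      rw [Matrix.conjTranspose_eq_transpose_of_trivial, Matrix.transpose_sub,
        Matrix.transpose_mul, Matrix.sub_mul, Matrix.mul_sub, Matrix.mul_sub]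
      have e1 : Mᵀ * (M * (g * G)) = G := by rw [← Matrix.mul_assoc, ← hG, hGgG]
      have e2 : (g * G)ᵀ * Mᵀ * (M * (g * G)) = (g * G)ᵀ * G := by
        rw [Matrix.mul_assoc, e1]
      have e3 : (g * G)ᵀ * Mᵀ * M = (g * G)ᵀ * G := by rw [Matrix.mul_assoc, ← hG]
      rw [e1, e2, e3, ← hG]
      simp
    exact sub_eq_zero.mp (Matrix.conjTranspose_mul_self_eq_zero.mp h0)
  have hp : pinv M = g * Mᵀ := rfl
  refine ⟨?_, ?_, ?_, ?_⟩
  · rw [hp, Matrix.mul_assoc, Matrix.mul_assoc, ← hG, hMgG]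
  · rw [hp, Matrix.mul_assoc g, ← hG, ← Matrix.mul_assoc, hgGg]
  · rw [hp, Matrix.transpose_mul, Matrix.transpose_mul, Matrix.transpose_transpose, hg, hsa,
      Matrix.mul_assoc]
  · rw [hp, Matrix.mul_assoc, ← hG, hgG, hsa]

/-- The operator norm `σ₁(M)` of a square matrix, with respect to the Euclidean norm. -/
def opNorm {d : ℕ} (M : Matrix (Fin d) (Fin d) ℝ) : ℝ :=
  ‖Matrix.toEuclideanCLM (n := Fin d) (𝕜 := ℝ) M‖

/-- The squared Frobenius norm. -/
def frobSq {n p : ℕ} (M : Matrix (Fin n) (Fin p) ℝ) : ℝ := ∑ i, ∑ j, M i j ^ 2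

/-- The effective rank `r_e(M) = tr M / ‖M‖_op`. -/
def effRank {d : ℕ} (M : Matrix (Fin d) (Fin d) ℝ) : ℝ := M.trace / opNorm M

/-- The square root of a symmetric positive semi-definite matrix. -/
def psdSqrt {d : ℕ} (M : Matrix (Fin d) (Fin d) ℝ) : Matrix (Fin d) (Fin d) ℝ :=
  cfc Real.sqrt M

/-- `x = ∑ j, σ j • u_j v_jᵀ` is a singular value decomposition with non-increasing singular values;
`u_j` and `v_j` are the columns of `u` and `v`. -/
structure IsSVD {n p : ℕ} (x : Matrix (Fin n) (Fin p) ℝ) (σ : Fin (min n p) → ℝ)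
    (u : Matrix (Fin n) (Fin (min n p)) ℝ) (v : Matrix (Fin p) (Fin (min n p)) ℝ) : Prop where
  nonneg : ∀ j, 0 ≤ σ j
  antitone : Antitone σ
  left_orthonormal : uᵀ * u = 1
  right_orthonormal : vᵀ * v = 1
  eq : x = u * Matrix.diagonal σ * vᵀ

/-- The truncated decomposition `∑_{j ≤ k} σ_j u_j v_jᵀ`, the best approximation of rank `k`. -/
def truncSVD {n p : ℕ} (σ : Fin (min n p) → ℝ) (u : Matrix (Fin n) (Fin (min n p)) ℝ)
    (v : Matrix (Fin p) (Fin (min n p)) ℝ) (k : ℕ) : Matrix (Fin n) (Fin p) ℝ :=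
  u * Matrix.diagonal (fun j : Fin (min n p) => if (j : ℕ) < k then σ j else 0) * vᵀ

/-- The matrix `U_k` whose columns are the first `k` right singular vectors. -/
def topVectors {n p : ℕ} (v : Matrix (Fin p) (Fin (min n p)) ℝ) (k : ℕ) :
    Matrix (Fin p) {j : Fin (min n p) // (j : ℕ) < k} ℝ :=
  v.submatrix id Subtype.val

/-! ### The sub-Gaussian factor regression model -/

/-- The parameter `θ = (K, β, A, Σ_Z, Σ_W, σ²)`. -/
structure Param (p K : ℕ) where
  β : Fin K → ℝ
  A : Matrix (Fin p) (Fin K) ℝ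
  SigmaZ : Matrix (Fin K) (Fin K) ℝ
  SigmaW : Matrix (Fin p) (Fin p) ℝ
  sigmaSq : ℝ

/-- The law `π` is centred, square integrable, with second moment matrix `S`. -/
structure HasMoments {d : ℕ} (π : Measure (Fin d → ℝ)) (S : Matrix (Fin d) (Fin d) ℝ) :
    Prop where
  memLp : ∀ i, MemLp (fun x : Fin d → ℝ => x i) 2 π
  mean : ∀ i, ∫ x, x i ∂π = 0
  secondMoment : ∀ i j, ∫ x, x i * x j ∂π = S i j

/-- `x ∼ π` is a `γ` sub-Gaussian vector: `𝔼 exp(t⟨x, v⟩) ≤ exp(t²γ²/2)` for all unit `v`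
and all real `t`. -/
def IsSubGaussianVec {d : ℕ} (γ : ℝ) (π : Measure (Fin d → ℝ)) : Prop :=
  ∀ v : Fin d → ℝ, v ⬝ᵥ v = 1 →
    HasSubgaussianMGF (fun x : Fin d → ℝ => x ⬝ᵥ v) (Real.toNNReal (γ ^ 2)) π

/-- `ν` is the law of `(X, Y) = (AZ + W, Zᵀβ + ε)` where `Z ∼ πZ`, `W ∼ πW`, `ε ∼ πε` are
mutually independent with the moments prescribed by `θ`. -/
structure IsFRM {p K : ℕ} (θ : Param p K) (πZ : Measure (Fin K → ℝ)) (πW : Measure (Fin p → ℝ))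
    (πε : Measure ℝ) (ν : Measure ((Fin p → ℝ) × ℝ)) : Prop where
  probZ : IsProbabilityMeasure πZ
  probW : IsProbabilityMeasure πW
  probε : IsProbabilityMeasure πε
  law : ν = (πZ.prod (πW.prod πε)).map
    (fun q : (Fin K → ℝ) × (Fin p → ℝ) × ℝ => (θ.A *ᵥ q.1 + q.2.1, q.1 ⬝ᵥ θ.β + q.2.2))
  momentsZ : HasMoments πZ θ.SigmaZ
  momentsW : HasMoments πW θ.SigmaW
  memLpε : MemLp (fun e : ℝ => e) 2 πε
  meanε : ∫ e, e ∂πε = 0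
  varε : ∫ e, e ^ 2 ∂πε = θ.sigmaSq
  rankA : θ.A.rank = K
  rankSigmaZ : θ.SigmaZ.rank = K

/-- `π` is the law of `S^{1/2} ξ` for a `γ` sub-Gaussian vector `ξ` with `𝔼[ξξᵀ] = I`. -/
def IsWhitenedSubGaussian {d : ℕ} (γ : ℝ) (S : Matrix (Fin d) (Fin d) ℝ)
    (π : Measure (Fin d → ℝ)) : Prop :=
  ∃ ρ : Measure (Fin d → ℝ), IsProbabilityMeasure ρ ∧ HasMoments ρ 1 ∧ IsSubGaussianVec γ ρ ∧
    π = ρ.map (fun x => psdSqrt S *ᵥ x)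

/-- The pair `(X, Y)` with law `ν` follows the sub-Gaussian factor regression model with
parameter `θ` and sub-Gaussian constants `γε`, `γz`, `γw`. -/
def FollowsSGFRM {p K : ℕ} (γε γz γw : ℝ) (θ : Param p K) (ν : Measure ((Fin p → ℝ) × ℝ)) :
    Prop :=
  ∃ (πZ : Measure (Fin K → ℝ)) (πW : Measure (Fin p → ℝ)) (πε : Measure ℝ),
    IsFRM θ πZ πW πε ν ∧
    HasSubgaussianMGF (fun e : ℝ => e) (Real.toNNReal (θ.sigmaSq * γε ^ 2)) πε ∧
    IsWhitenedSubGaussian γz θ.SigmaZ πZ ∧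
    IsWhitenedSubGaussian γw θ.SigmaW πW

/-- The noise level `δ_W = c (‖Σ_W‖_op + tr(Σ_W) / n)`. -/
def deltaW {p K : ℕ} (c : ℝ) (n : ℕ) (θ : Param p K) : ℝ :=
  c * (opNorm θ.SigmaW + θ.SigmaW.trace / n)

/-! ### Principal component regression -/

/-- `X_*ᵀ B (𝐗 B)⁺ 𝐘` is linear in the new observation `X_*`; this is its coefficient vector. -/
def coeff {n p : ℕ} {q : Type*} [Fintype q] [DecidableEq q] (B : Matrix (Fin p) q ℝ)
    (x : Matrix (Fin n) (Fin p) ℝ) (y : Fin n → ℝ) : Fin p → ℝ :=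
  B *ᵥ (pinv (x * B) *ᵥ y)

/-- The prediction risk `𝔼 (Y_* - X_*ᵀ α)²`, the expectation being over a new observation
`(X_*, Y_*) ∼ ν` only. -/
def risk {p : ℕ} (ν : Measure ((Fin p → ℝ) × ℝ)) (α : Fin p → ℝ) : ℝ :=
  ∫ q, (q.2 - q.1 ⬝ᵥ α) ^ 2 ∂ν

/-- The tuning sequence `μ_n = c₀ (n + p)`. -/
def muN (c₀ : ℝ) (n p : ℕ) : ℝ := c₀ * ((n : ℝ) + p)

/-- `K̄ = ⌊κ/(1+κ) · np/μ_n⌋ ∧ n ∧ p`. -/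
def Kbar (κ c₀ : ℝ) (n p : ℕ) : ℕ :=
  min ⌊κ / (1 + κ) * ((n : ℝ) * p / muN c₀ n p)⌋₊ (min n p)

/-- The criterion `v̂_k² = ‖𝐗 - 𝐗_(k)‖_F² / (np - μ_n k)`. -/
def vSq {n p : ℕ} (c₀ : ℝ) (x : Matrix (Fin n) (Fin p) ℝ) (σ : Fin (min n p) → ℝ)
    (u : Matrix (Fin n) (Fin (min n p)) ℝ) (v : Matrix (Fin p) (Fin (min n p)) ℝ) (k : ℕ) : ℝ :=
  frobSq (x - truncSVD σ u v k) / ((n : ℝ) * p - muN c₀ n p * k)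

/-- A choice of the number of components as a function of the data matrix: `svals`, `lvecs`, `rvecs`
provide a singular value decomposition of every data matrix, and `s` minimizes the criterion
over `0 ≤ k ≤ K̄`. Ties among the minimizers, and the choice of singular vectors when singular
values coincide, are left free, up to measurability. -/
structure IsSelector {n p : ℕ} (κ c₀ : ℝ)
    (svals : (Fin n → Fin p → ℝ) → Fin (min n p) → ℝ)
    (lvecs : (Fin n → Fin p → ℝ) → Matrix (Fin n) (Fin (min n p)) ℝ)
    (rvecs : (Fin n → Fin p → ℝ) → Matrix (Fin p) (Fin (min n p)) ℝ)
    (s : (Fin n → Fin p → ℝ) → ℕ) : Prop where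
  isSVD : ∀ x, IsSVD (Matrix.of x) (svals x) (lvecs x) (rvecs x)
  le_Kbar : ∀ x, s x ≤ Kbar κ c₀ n p
  isMin : ∀ x, ∀ k ≤ Kbar κ c₀ n p,
    vSq c₀ (Matrix.of x) (svals x) (lvecs x) (rvecs x) (s x) ≤
      vSq c₀ (Matrix.of x) (svals x) (lvecs x) (rvecs x) k
  measurable_rvecs : ∀ i j, Measurable (fun x => rvecs x i j)
  measurable_s : Measurable s

end PCR

end

noncomputable section

namespace PCR

open scoped ENNReal

/-! ### Nets of the unit ball -/

-- Stack the observations as `x = Z R Aᵀ + W` with `R = Σ_Z^{1/2}` and whitened factors `Z`. Let `l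
-- = ‖Σ_W‖`, `t = tr Σ_W` and `B = 48 γw² (n l + t)`, which is `n δ_W` up to constants. Four events
-- carry the proof: `|W y|² ≤ B |y|²` (`measure_pi_opNorm_le`), `‖W‖_F² ≥ n t / 2`
-- (`measure_pi_quadratic_le`), `|Z c|² ≥ (n/32) |c|²` (`measure_pi_smallest_singular_le`), and
-- energy at most a constant times `σ² (K + log n)` of the regression noise along the selected left
-- singular vectors (`measure_pi_noiseEnergy_le`). In the last one the selected directions depend on
-- the design only, hence are independent of the regression noise.
--
-- On these events the selector is understood without any eigengap. The effective rank hypothesis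
-- and a large `c₀` put `B · np` strictly below `μ_n` times the residual energy at `K`. Comparing
-- the criterion at `s` with its values at `K`, `s - 1` and `s + 1` yields `s ≤ K`, squared singular
-- values at least `B` among the retained ones, and at most a constant times `B` among the discarded
-- ones (`selection_bounds`, `selector_bounds`).
--
-- The rest is deterministic. Let `b` be the minimum norm solution of `Aᵀ b = β`, so that `|b|² =
-- βᵀ(AᵀA)⁻¹β` and `Y = x b - W b + ε`. In the singular bases the fitted coefficient `α` is
-- explicit. Large retained values control `|α|`, small discarded ones control `|x (b - α)|`
-- (`IsSVD.coeffVec_bounds`). The excess risk is `|R (β - Aᵀα)|² + αᵀ Σ_W α` (`IsFRM.risk_eq`). Its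
-- first term is at most `32/n` times `|Z R Aᵀ (b - α)|² = |x (b - α) - W (b - α)|²`, by the lower
-- bound on `Z` (`excess_risk_le`).
--
-- The bound on `Z` costs a union over exponentially many points in `K`. The hypothesis `K log n ≤ C
-- n` absorbs them once `n` exceeds a constant; below it `L / n ≥ 1` and nothing is claimed.

theorem exists_half_net (E : Type*) [NormedAddCommGroup E] [NormedSpace ℝ E]
    [FiniteDimensional ℝ E] :
    ∃ s : Finset E, s.card ≤ 5 ^ Module.finrank ℝ E ∧ (∀ y ∈ s, ‖y‖ ≤ 1) ∧
      ∀ x : E, ‖x‖ ≤ 1 → ∃ y ∈ s, ‖x - y‖ ≤ 1 / 2 := by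
  classical
  let Q : Finset E → Prop := fun s =>
    (∀ y ∈ s, ‖y‖ ≤ 1) ∧ ∀ c ∈ s, ∀ d ∈ s, c ≠ d → 1 / 2 ≤ ‖c - d‖
  -- Doubling gives 1-separated points in the ball of radius 2; volume comparison allows at most `5
  -- ^ d` of them.
  have hcard : ∀ s : Finset E, Q s → s.card ≤ 5 ^ Module.finrank ℝ E := by
    intro s hs
    have hinj : Function.Injective (fun x : E => (2 : ℝ) • x) :=
      smul_right_injective E (by norm_num)
    have := Besicovitch.card_le_of_separated (s.image fun x : E => (2 : ℝ) • x) ?_ ?_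
    · rwa [Finset.card_image_of_injective _ hinj] at this
    · intro c hc
      obtain ⟨x, hx, rfl⟩ := Finset.mem_image.1 hc
      rw [norm_smul]
      have := hs.1 x hx
      norm_num
      linarith
    · intro c hc d hd hcd
      obtain ⟨x, hx, rfl⟩ := Finset.mem_image.1 hc
      obtain ⟨y, hy, rfl⟩ := Finset.mem_image.1 hd
      have := hs.2 x hx y hy (fun h => hcd (by rw [h]))
      rw [← smul_sub, norm_smul]
      norm_num
      linarith
  let T : ℕ → Prop := fun N => ∃ s : Finset E, s.card = N ∧ Q s
  have hT0 : T 0 := ⟨∅, rfl, by simp [Q]⟩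
  -- A separated set of largest cardinality is a net, since an uncovered point could be added to it.
  obtain ⟨s, hs, hQ⟩ : T (Nat.findGreatest T (5 ^ Module.finrank ℝ E)) :=
    Nat.findGreatest_spec (Nat.zero_le _) hT0
  refine ⟨s, hcard s hQ, hQ.1, fun x hx => ?_⟩
  by_contra! hcon
  have hxs : x ∉ s := fun h => by
    have := hcon x h
    simp at this
    linarith
  have hQ' : Q (insert x s) := by
    refine ⟨?_, ?_⟩
    · intro y hy
      rcases Finset.mem_insert.1 hy with rfl | h
      · exact hx
      · exact hQ.1 y h
    · intro c hc d hd hcd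
      rcases Finset.mem_insert.1 hc with rfl | hc' <;> rcases Finset.mem_insert.1 hd with rfl | hd'
      · exact absurd rfl hcd
      · exact (hcon d hd').le
      · rw [norm_sub_rev]
        exact (hcon c hc').le
      · exact hQ.2 c hc' d hd' hcd
  have hT' : T (insert x s).card := ⟨_, rfl, hQ'⟩
  have h1 := Nat.le_findGreatest (hcard _ hQ') hT'
  rw [← hs, Finset.card_insert_of_notMem hxs] at h1
  omega

/-- The residual of a `2^{-k}`-approximation, magnified by `2^k`, lies in the unit ball again, so
each further half-net halves the error. The points may leave the unit ball. -/
theorem exists_net (E : Type*) [NormedAddCommGroup E] [NormedSpace ℝ E]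
    [FiniteDimensional ℝ E] (k : ℕ) :
    ∃ s : Finset E, s.card ≤ (5 ^ Module.finrank ℝ E) ^ k ∧
      ∀ x : E, ‖x‖ ≤ 1 → ∃ y ∈ s, ‖x - y‖ ≤ (1 / 2) ^ k := by
  classical
  obtain ⟨t, htc, -, ht⟩ := exists_half_net E
  induction k with
  | zero => exact ⟨{0}, by simp, fun x hx => ⟨0, by simp, by simpa using hx⟩⟩
  | succ k ih =>
    obtain ⟨s, hsc, hs⟩ := ih
    refine ⟨(s ×ˢ t).image (fun q => q.1 + ((1 / 2 : ℝ) ^ k) • q.2), ?_, ?_⟩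
    · refine Finset.card_image_le.trans ?_
      rw [Finset.card_product, pow_succ]
      exact Nat.mul_le_mul hsc htc
    · intro x hx
      obtain ⟨y, hy, hxy⟩ := hs x hx
      obtain ⟨z, hz, hyz⟩ := ht (((2 : ℝ) ^ k) • (x - y)) (by
        rw [norm_smul, norm_pow]
        calc ‖(2 : ℝ)‖ ^ k * ‖x - y‖ ≤ ‖(2 : ℝ)‖ ^ k * (1 / 2) ^ k := by gcongr
          _ = 1 := by rw [← mul_pow]; norm_num)
      refine ⟨y + ((1 / 2 : ℝ) ^ k) • z, Finset.mem_image.2 ⟨(y, z), by simp [hy, hz], rfl⟩, ?_⟩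
      have : x - (y + ((1 / 2 : ℝ) ^ k) • z)
          = ((1 / 2 : ℝ) ^ k) • (((2 : ℝ) ^ k) • (x - y) - z) := by
        rw [smul_sub, smul_smul, ← mul_pow]
        norm_num
        abel
      rw [this, norm_smul, pow_succ]
      have h : ‖((1 / 2 : ℝ) ^ k)‖ = (1 / 2) ^ k := by
        rw [Real.norm_of_nonneg (by positivity)]
      rw [h]
      gcongr

/-! ### Exponential moments -/

theorem lintegral_pi_prod {ι : Type*} [Fintype ι] {E : ι → Type*} [∀ i, MeasurableSpace (E i)]
    (μ : ∀ i, Measure (E i)) [∀ i, IsProbabilityMeasure (μ i)] (f : ∀ i, E i → ℝ≥0∞)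
    (hf : ∀ i, Measurable (f i)) :
    ∫⁻ x, ∏ i, f i (x i) ∂Measure.pi μ = ∏ i, ∫⁻ x, f i x ∂μ i := by
  rw [lintegral_prod_eq_prod_lintegral_of_indepFun Finset.univ
    (fun i (x : ∀ i, E i) => f i (x i))
    (iIndepFun_pi fun i => (hf i).aemeasurable)
    (fun i => (hf i).comp (measurable_pi_apply i))]
  refine Finset.prod_congr rfl fun i _ => ?_
  exact (measurePreserving_eval μ i).lintegral_comp (hf i)

theorem lintegral_exp_mul_gaussianReal (a : ℝ) :
    ∫⁻ t, ENNReal.ofReal (Real.exp (a * t)) ∂gaussianReal 0 1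
      = ENNReal.ofReal (Real.exp (a ^ 2 / 2)) := by
  rw [← ofReal_integral_eq_lintegral_ofReal (integrable_exp_mul_gaussianReal a)
    (ae_of_all _ fun _ => (Real.exp_pos _).le)]
  have := congrFun (mgf_id_gaussianReal (μ := 0) (v := 1)) a
  simp only [mgf, id] at this
  rw [this]
  simp

/-- Serves to replace the chi-square moment `(1 - x)^{-1/2}` by `exp x`. -/
theorem exp_neg_two_mul_le {x : ℝ} (h0 : 0 ≤ x) (h1 : x ≤ 1 / 2) :
    Real.exp (-(2 * x)) ≤ 1 - x := by
  have h2 := Real.quadratic_le_exp_of_nonneg (x := 2 * x) (by linarith)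
  rw [Real.exp_neg, inv_le_comm₀ (Real.exp_pos _) (by linarith)]
  refine le_trans ?_ h2
  rw [inv_le_iff_one_le_mul₀ (by linarith)]
  nlinarith [mul_nonneg h0 (sub_nonneg.2 h1), mul_nonneg h0 h0]

theorem lintegral_exp_sq_gaussianReal_le {x : ℝ} (h0 : 0 ≤ x) (h1 : x ≤ 1 / 2) :
    ∫⁻ t, ENNReal.ofReal (Real.exp (x * t ^ 2 / 2)) ∂gaussianReal 0 1
      ≤ ENNReal.ofReal (Real.exp x) := by
  have hb : 0 < (1 - x) / 2 := by linarith
  rw [gaussianReal_of_var_ne_zero _ one_ne_zero,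
    lintegral_withDensity_eq_lintegral_mul _ (measurable_gaussianPDF 0 1) (by fun_prop)]
  have h : ∀ t : ℝ, (gaussianPDF 0 1 * fun t => ENNReal.ofReal (Real.exp (x * t ^ 2 / 2))) t
      = ENNReal.ofReal ((√(2 * Real.pi))⁻¹ * Real.exp (-((1 - x) / 2) * t ^ 2)) := by
    intro t
    simp only [Pi.mul_apply, gaussianPDF, gaussianPDFReal]
    rw [← ENNReal.ofReal_mul (by positivity), mul_assoc, ← Real.exp_add]
    simp only [NNReal.coe_one, mul_one, sub_zero]
    congr 3
    ring
  simp_rw [h]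
  rw [← ofReal_integral_eq_lintegral_ofReal ((integrable_exp_neg_mul_sq hb).const_mul _)
    (ae_of_all _ fun _ => by positivity), integral_const_mul, integral_gaussian]
  refine ENNReal.ofReal_le_ofReal ?_
  have hpi : 0 < Real.pi := Real.pi_pos
  rw [← Real.sqrt_inv, ← Real.sqrt_mul (by positivity)]
  have e : (2 * Real.pi)⁻¹ * (Real.pi / ((1 - x) / 2)) = (1 - x)⁻¹ := by
    have : 1 - x ≠ 0 := by linarith
    field_simp
  rw [e]
  refine Real.sqrt_le_iff.2 ⟨(Real.exp_pos _).le, ?_⟩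
  rw [inv_le_comm₀ (by linarith) (by positivity), ← Real.exp_nat_mul, ← Real.exp_neg]
  simpa using exp_neg_two_mul_le h0 h1

/-- The random vector `ξ` is sub-Gaussian with variance proxy `g`. -/
def VecSubG {Ω ι : Type*} [MeasurableSpace Ω] [Fintype ι] (g : ℝ) (ξ : Ω → ι → ℝ)
    (μ : Measure Ω) : Prop :=
  ∀ v : ι → ℝ, ∫⁻ ω, ENNReal.ofReal (Real.exp (ξ ω ⬝ᵥ v)) ∂μ
    ≤ ENNReal.ofReal (Real.exp (g * (v ⬝ᵥ v) / 2))

theorem measurable_dotProduct {Ω ι : Type*} [MeasurableSpace Ω] [Fintype ι] {f g : Ω → ι → ℝ}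
    (hf : Measurable f) (hg : Measurable g) : Measurable fun ω => f ω ⬝ᵥ g ω := by
  unfold dotProduct
  fun_prop

theorem measure_le_of_lintegral_exp_le {Ω : Type*} [MeasurableSpace Ω] {μ : Measure Ω} {f : Ω → ℝ}
    (hf : Measurable f) {B : ℝ}
    (h : ∫⁻ ω, ENNReal.ofReal (Real.exp (f ω)) ∂μ ≤ ENNReal.ofReal (Real.exp B)) (τ : ℝ) :
    μ {ω | τ ≤ f ω} ≤ ENNReal.ofReal (Real.exp (B - τ)) := by
  have hmk := mul_meas_ge_le_lintegral (μ := μ)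
    (f := fun ω => ENNReal.ofReal (Real.exp (f ω))) (by fun_prop) (ENNReal.ofReal (Real.exp τ))
  have hsub : {ω | τ ≤ f ω} ⊆
      {ω | ENNReal.ofReal (Real.exp τ) ≤ ENNReal.ofReal (Real.exp (f ω))} :=
    fun ω hω => ENNReal.ofReal_le_ofReal (Real.exp_le_exp.2 hω)
  have h3 := (mul_le_mul' le_rfl (measure_mono hsub)).trans (hmk.trans h)
  rw [Real.exp_sub, ENNReal.ofReal_div_of_pos (Real.exp_pos _), ENNReal.le_div_iff_mul_le
    (Or.inl (by simp [Real.exp_pos])) (Or.inl ENNReal.ofReal_ne_top), mul_comm]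
  exact h3

theorem VecSubG.of_isSubGaussianVec {d : ℕ} {γ : ℝ} {ρ : Measure (Fin d → ℝ)}
    [IsProbabilityMeasure ρ]
    (h : IsSubGaussianVec γ ρ) : VecSubG (γ ^ 2) (fun x => x) ρ := by
  intro v
  rcases eq_or_ne v 0 with rfl | hv
  · simp
  · have hpos : 0 < v ⬝ᵥ v := by
      simpa using Matrix.dotProduct_star_self_pos_iff.2 hv
    set r := √(v ⬝ᵥ v) with hr
    have hr0 : 0 < r := Real.sqrt_pos.2 hpos
    have hrr : r * r = v ⬝ᵥ v := Real.mul_self_sqrt hpos.le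
    have h1 := h (r⁻¹ • v) (by
      rw [smul_dotProduct, dotProduct_smul, ← hrr, smul_eq_mul, smul_eq_mul]
      field_simp)
    have e : ∀ x : Fin d → ℝ, x ⬝ᵥ v = r * (x ⬝ᵥ (r⁻¹ • v)) := by
      intro x
      rw [dotProduct_smul, smul_eq_mul]
      field_simp
    rw [← hrr]
    simp only [e]
    rw [← ofReal_integral_eq_lintegral_ofReal (h1.integrable_exp_mul r)
      (ae_of_all _ fun _ => (Real.exp_pos _).le)]
    refine ENNReal.ofReal_le_ofReal ((h1.mgf_le r).trans ?_)
    rw [Real.coe_toNNReal _ (sq_nonneg γ), pow_two r]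

/-- Gaussian linearization: `exp (q² / 2)` is the mean of `exp (t q)` over a standard Gaussian `t`.
With one Gaussian per `b i`, Tonelli exchanges the integrals, sub-Gaussianity applies to `∑ t i • b
i`, and orthogonality splits the outcome into one-dimensional chi-square moments. -/
theorem VecSubG.lintegral_exp_sum_sq_le {Ω ι κ : Type*} [MeasurableSpace Ω] [Fintype ι] [Fintype κ]
    {g : ℝ} {ξ : Ω → ι → ℝ} {μ : Measure Ω} [IsProbabilityMeasure μ] (hξ : Measurable ξ)
    (h : VecSubG g ξ μ) (hg : 0 ≤ g) (b : κ → ι → ℝ)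
    (hb : ∀ i j, i ≠ j → b i ⬝ᵥ b j = 0) (hgb : ∀ i, g * (b i ⬝ᵥ b i) ≤ 1 / 2) :
    ∫⁻ ω, ENNReal.ofReal (Real.exp ((∑ i, (ξ ω ⬝ᵥ b i) ^ 2) / 2)) ∂μ
      ≤ ENNReal.ofReal (Real.exp (g * ∑ i, b i ⬝ᵥ b i)) := by
  have hbb : ∀ i, 0 ≤ b i ⬝ᵥ b i := fun i => by
    simpa using dotProduct_star_self_nonneg (b i)
  let G : Measure (κ → ℝ) := Measure.pi fun _ => gaussianReal 0 1
  have key : ∀ ω, ENNReal.ofReal (Real.exp ((∑ i, (ξ ω ⬝ᵥ b i) ^ 2) / 2))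
      = ∫⁻ t : κ → ℝ, ENNReal.ofReal (Real.exp (ξ ω ⬝ᵥ ∑ i, t i • b i)) ∂G := by
    intro ω
    have e : ∀ t : κ → ℝ, ENNReal.ofReal (Real.exp (ξ ω ⬝ᵥ ∑ i, t i • b i))
        = ∏ i, ENNReal.ofReal (Real.exp ((ξ ω ⬝ᵥ b i) * t i)) := by
      intro t
      rw [← ENNReal.ofReal_prod_of_nonneg (fun _ _ => (Real.exp_pos _).le), ← Real.exp_sum,
        dotProduct_sum]
      simp only [dotProduct_smul, smul_eq_mul, mul_comm]
    simp_rw [e]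
    rw [lintegral_pi_prod (fun _ => gaussianReal 0 1)
      (fun i t => ENNReal.ofReal (Real.exp ((ξ ω ⬝ᵥ b i) * t))) (fun i => by fun_prop)]
    simp_rw [lintegral_exp_mul_gaussianReal]
    rw [← ENNReal.ofReal_prod_of_nonneg (fun _ _ => (Real.exp_pos _).le), ← Real.exp_sum,
      Finset.sum_div]
  simp_rw [key]
  rw [lintegral_lintegral_swap (by
    refine Measurable.aemeasurable (ENNReal.measurable_ofReal.comp (Real.measurable_exp.comp ?_))
    refine measurable_dotProduct (hξ.comp measurable_fst) ?_
    fun_prop)]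
  calc ∫⁻ t, ∫⁻ ω, ENNReal.ofReal (Real.exp (ξ ω ⬝ᵥ ∑ i, t i • b i)) ∂μ ∂G
      ≤ ∫⁻ t, ∏ i, ENNReal.ofReal (Real.exp ((g * (b i ⬝ᵥ b i)) * t i ^ 2 / 2)) ∂G := by
        refine lintegral_mono fun t => (h _).trans (le_of_eq ?_)
        rw [← ENNReal.ofReal_prod_of_nonneg (fun _ _ => (Real.exp_pos _).le), ← Real.exp_sum]
        congr 2
        rw [dotProduct_sum, ← Finset.sum_div, Finset.mul_sum]
        congr 1
        refine Finset.sum_congr rfl fun i _ => ?_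
        rw [sum_dotProduct, Finset.sum_eq_single i]
        · simp only [dotProduct_smul, smul_dotProduct, smul_eq_mul]
          ring
        · intro j _ hji
          simp [dotProduct_smul, smul_dotProduct, hb j i hji]
        · simp
    _ = ∏ i, ∫⁻ t, ENNReal.ofReal (Real.exp ((g * (b i ⬝ᵥ b i)) * t ^ 2 / 2))
          ∂gaussianReal 0 1 :=
        lintegral_pi_prod (fun _ => gaussianReal 0 1)
          (fun i t => ENNReal.ofReal (Real.exp ((g * (b i ⬝ᵥ b i)) * t ^ 2 / 2)))
          (fun i => by fun_prop)
    _ ≤ ∏ i, ENNReal.ofReal (Real.exp (g * (b i ⬝ᵥ b i))) :=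
        Finset.prod_le_prod' fun i _ =>
          lintegral_exp_sq_gaussianReal_le (mul_nonneg hg (hbb i)) (hgb i)
    _ = _ := by
        rw [← ENNReal.ofReal_prod_of_nonneg (fun _ _ => (Real.exp_pos _).le), ← Real.exp_sum,
          Finset.mul_sum]

/-- Tail bound for a quadratic form in a sub-Gaussian vector. -/
theorem VecSubG.measure_sum_sq_ge_le {Ω ι κ : Type*} [MeasurableSpace Ω] [Fintype ι] [Fintype κ]
    {g : ℝ} {ξ : Ω → ι → ℝ} {μ : Measure Ω} [IsProbabilityMeasure μ] (hξ : Measurable ξ)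
    (h : VecSubG g ξ μ) (hg : 0 < g) (b : κ → ι → ℝ)
    (hb : ∀ i j, i ≠ j → b i ⬝ᵥ b j = 0) {l : ℝ} (hl : 0 < l) (hbl : ∀ i, b i ⬝ᵥ b i ≤ l) (τ : ℝ) :
    μ {ω | 2 * g * ∑ i, b i ⬝ᵥ b i + 4 * g * l * τ ≤ ∑ i, (ξ ω ⬝ᵥ b i) ^ 2}
      ≤ ENNReal.ofReal (Real.exp (-τ)) := by
  -- The scale at which the longest `b i` just meets the condition `g |b i|² ≤ 1/2`.
  set r := √(2 * g * l) with hr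
  have hr0 : 0 < r := Real.sqrt_pos.2 (by positivity)
  have hrr : r ^ 2 = 2 * g * l := Real.sq_sqrt (by positivity)
  have hmain := h.lintegral_exp_sum_sq_le hξ hg.le (fun i => r⁻¹ • b i)
    (fun i j hij => by simp [dotProduct_smul, smul_dotProduct, hb i j hij])
    (fun i => by
      simp only [dotProduct_smul, smul_dotProduct, smul_eq_mul]
      have e : g * (r⁻¹ * (r⁻¹ * (b i ⬝ᵥ b i))) = (b i ⬝ᵥ b i) / (2 * l) := by
        have : r⁻¹ * r⁻¹ = (2 * g * l)⁻¹ := by rw [← hrr]; ring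
        rw [← mul_assoc r⁻¹, this]
        field_simp
      rw [e, div_le_div_iff₀ (by positivity) (by norm_num)]
      linarith [hbl i])
  have e1 : ∀ ω, ∑ i, (ξ ω ⬝ᵥ r⁻¹ • b i) ^ 2 = (∑ i, (ξ ω ⬝ᵥ b i) ^ 2) / (2 * g * l) := by
    intro ω
    simp only [dotProduct_smul, smul_eq_mul, mul_pow, ← Finset.mul_sum, inv_pow, hrr]
    ring
  have e2 : g * ∑ i, (r⁻¹ • b i) ⬝ᵥ (r⁻¹ • b i) = (∑ i, b i ⬝ᵥ b i) / (2 * l) := by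
    have : r⁻¹ * r⁻¹ = (2 * g * l)⁻¹ := by rw [← hrr]; ring
    simp only [dotProduct_smul, smul_dotProduct, smul_eq_mul, ← mul_assoc, this,
      ← Finset.mul_sum]
    field_simp
  simp_rw [e1, e2] at hmain
  set S := ∑ i, b i ⬝ᵥ b i with hS
  set q : Ω → ℝ := fun ω => ∑ i, (ξ ω ⬝ᵥ b i) ^ 2 with hq
  have hqm : Measurable q :=
    Finset.measurable_sum _ fun i _ => (measurable_dotProduct hξ measurable_const).pow_const 2
  have hT := measure_le_of_lintegral_exp_le (by fun_prop) hmain (S / (2 * l) + τ)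
  rw [sub_add_cancel_left] at hT
  refine (measure_mono fun ω hω => ?_).trans hT
  change 2 * g * S + 4 * g * l * τ ≤ q ω at hω
  change S / (2 * l) + τ ≤ q ω / (2 * g * l) / 2
  rw [div_div, le_div_iff₀ (by positivity)]
  have : (S / (2 * l) + τ) * (2 * g * l * 2) = 2 * g * S + 4 * g * l * τ := by
    field_simp
    ring
  linarith

/-- Lower tail of a sum of independent copies of a non-negative variable. -/
theorem measure_pi_sum_le {E : Type*} [MeasurableSpace E] (ρ : Measure E) [IsProbabilityMeasure ρ]
    {q : E → ℝ} (hq : Measurable q) (hq0 : ∀ x, 0 ≤ q x) {m a : ℝ} (hm : 0 < m) (ha : 0 < a)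
    (hi1 : Integrable q ρ) (hi2 : Integrable (fun x => q x ^ 2) ρ) (h1 : ∫ x, q x ∂ρ = m)
    (h2 : ∫ x, q x ^ 2 ∂ρ ≤ a * m ^ 2) (n : ℕ) :
    (Measure.pi fun _ : Fin n => ρ) {x | ∑ i, q (x i) ≤ n * m / 2}
      ≤ ENNReal.ofReal (Real.exp (-(n / (8 * a)))) := by
  -- This optimizes the Chernoff exponent `s m / 2 - s² a m² / 2` for the threshold `m / 2`, with
  -- value `1 / (8 a)`.
  set s : ℝ := (2 * a * m)⁻¹ with hs
  have hs0 : 0 < s := by positivity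
  have hone : ∫⁻ x, ENNReal.ofReal (Real.exp (-(s * q x))) ∂ρ
      ≤ ENNReal.ofReal (Real.exp (-(3 / (8 * a)))) := by
    -- Uses `(1 + y + y²/2)(1 - y + y²/2) = 1 + y⁴/4 ≥ 1`.
    have hpt : ∀ y : ℝ, 0 ≤ y → Real.exp (-y) ≤ 1 - y + y ^ 2 / 2 := by
      intro y hy
      have h := Real.quadratic_le_exp_of_nonneg hy
      rw [Real.exp_neg, inv_le_iff_one_le_mul₀ (Real.exp_pos _)]
      have hpos : 0 ≤ 1 - y + y ^ 2 / 2 := by nlinarith [sq_nonneg (y - 1)]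
      nlinarith [mul_le_mul_of_nonneg_left h hpos, sq_nonneg (y ^ 2)]
    have hi : Integrable (fun x => 1 - s * q x + (s * q x) ^ 2 / 2) ρ := by
      simp_rw [mul_pow]
      exact ((integrable_const _).sub (hi1.const_mul s)).add
        ((hi2.const_mul (s ^ 2)).div_const 2)
    calc ∫⁻ x, ENNReal.ofReal (Real.exp (-(s * q x))) ∂ρ
        ≤ ∫⁻ x, ENNReal.ofReal (1 - s * q x + (s * q x) ^ 2 / 2) ∂ρ :=
          lintegral_mono fun x =>
            ENNReal.ofReal_le_ofReal (hpt _ (mul_nonneg hs0.le (hq0 x)))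
      _ = ENNReal.ofReal (∫ x, 1 - s * q x + (s * q x) ^ 2 / 2 ∂ρ) := by
          rw [ofReal_integral_eq_lintegral_ofReal hi]
          exact ae_of_all _ fun x => (Real.exp_pos _).le.trans
            (hpt _ (mul_nonneg hs0.le (hq0 x)))
      _ ≤ _ := by
          refine ENNReal.ofReal_le_ofReal ?_
          have e : ∫ x, 1 - s * q x + (s * q x) ^ 2 / 2 ∂ρ
              = 1 - s * m + s ^ 2 * (∫ x, q x ^ 2 ∂ρ) / 2 := by
            simp_rw [mul_pow]
            have hi3 : Integrable (fun x => 1 - s * q x) ρ :=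
              (integrable_const _).sub (hi1.const_mul s)
            rw [integral_add hi3 ((hi2.const_mul (s ^ 2)).div_const 2),
              integral_sub (integrable_const _) (hi1.const_mul s), integral_div,
              integral_const_mul, integral_const_mul, h1]
            simp
          rw [e]
          have h3 : s ^ 2 * (∫ x, q x ^ 2 ∂ρ) ≤ s ^ 2 * (a * m ^ 2) := by gcongr
          have h4 : s * m = 1 / (2 * a) := by rw [hs]; field_simp
          have h5 : s ^ 2 * (a * m ^ 2) = 1 / (4 * a) := by rw [hs]; field_simp; norm_num
          have h6 := Real.add_one_le_exp (-(3 / (8 * a)))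
          have h7 : (1 : ℝ) / (2 * a) - 1 / (4 * a) / 2 = 3 / (8 * a) := by field_simp; norm_num
          linarith
  have hall : ∫⁻ x : Fin n → E, ENNReal.ofReal (Real.exp (-(s * ∑ i, q (x i))))
      ∂(Measure.pi fun _ : Fin n => ρ) ≤ ENNReal.ofReal (Real.exp (-(n * (3 / (8 * a))))) := by
    have e : ∀ x : Fin n → E, ENNReal.ofReal (Real.exp (-(s * ∑ i, q (x i))))
        = ∏ i, ENNReal.ofReal (Real.exp (-(s * q (x i)))) := by
      intro x
      rw [← ENNReal.ofReal_prod_of_nonneg (fun _ _ => (Real.exp_pos _).le), ← Real.exp_sum,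
        Finset.mul_sum, Finset.sum_neg_distrib]
    simp_rw [e]
    rw [lintegral_pi_prod (fun _ => ρ) (fun _ x => ENNReal.ofReal (Real.exp (-(s * q x))))
      (fun _ => by fun_prop)]
    refine (Finset.prod_le_prod' fun i _ => hone).trans (le_of_eq ?_)
    rw [← ENNReal.ofReal_prod_of_nonneg (fun _ _ => (Real.exp_pos _).le), ← Real.exp_sum]
    simp
  have hT := measure_le_of_lintegral_exp_le (by fun_prop) hall (-(n / (4 * a)))
  have e : -(n * (3 / (8 * a))) - -(n / (4 * a)) = -(n / (8 * a)) := by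
    field_simp
    ring
  rw [e] at hT
  refine (measure_mono fun x hx => ?_).trans hT
  change -((n : ℝ) / (4 * a)) ≤ -(s * ∑ i, q (x i))
  refine neg_le_neg ?_
  have : s * (n * m / 2) = n / (4 * a) := by
    rw [hs]
    field_simp
    ring
  rw [← this]
  exact mul_le_mul_of_nonneg_left hx hs0.le

/-! ### Samples of sub-Gaussian vectors -/

theorem dotProduct_self_nonneg' {ι : Type*} [Fintype ι] (x : ι → ℝ) : 0 ≤ x ⬝ᵥ x := by
  simpa using dotProduct_star_self_nonneg x

theorem norm_toLp_sq {ι : Type*} [Fintype ι] (x : ι → ℝ) :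
    ‖(WithLp.toLp 2 x : EuclideanSpace ℝ ι)‖ ^ 2 = x ⬝ᵥ x := by
  rw [EuclideanSpace.norm_sq_eq]
  simp [dotProduct, pow_two]

theorem norm_sq_eq_ofLp {ι : Type*} [Fintype ι] (x : EuclideanSpace ℝ ι) :
    ‖x‖ ^ 2 = x.ofLp ⬝ᵥ x.ofLp := norm_toLp_sq x.ofLp

theorem dotProduct_sq_le {ι : Type*} [Fintype ι] (x y : ι → ℝ) :
    (x ⬝ᵥ y) ^ 2 ≤ (x ⬝ᵥ x) * (y ⬝ᵥ y) := by
  have := Finset.sum_mul_sq_le_sq_mul_sq Finset.univ x y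
  simpa [dotProduct, pow_two] using this

theorem add_dotProduct_self_le {ι : Type*} [Fintype ι] (x y : ι → ℝ) :
    (x + y) ⬝ᵥ (x + y) ≤ 2 * (x ⬝ᵥ x) + 2 * (y ⬝ᵥ y) := by
  have := dotProduct_self_nonneg' (x - y)
  simp only [sub_dotProduct, dotProduct_sub, add_dotProduct, dotProduct_add] at this ⊢
  linarith

theorem sub_dotProduct_self_le {ι : Type*} [Fintype ι] (x y : ι → ℝ) :
    (x - y) ⬝ᵥ (x - y) ≤ 2 * (x ⬝ᵥ x) + 2 * (y ⬝ᵥ y) := by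
  have := dotProduct_self_nonneg' (x + y)
  simp only [sub_dotProduct, dotProduct_sub, add_dotProduct, dotProduct_add] at this ⊢
  linarith

/-- The operator norm satisfies `‖T‖ ≤ √t + ‖T‖ / 2`, hence `‖T‖² ≤ 4 t`. The net lives in `ℝⁿ`, so
its size does not involve the dimension of the observations. -/
theorem vecMul_bound_of_net {n d : ℕ} (N : Matrix (Fin n) (Fin d) ℝ)
    (s : Finset (EuclideanSpace ℝ (Fin n)))
    (hs : ∀ x : EuclideanSpace ℝ (Fin n), ‖x‖ ≤ 1 → ∃ y ∈ s, ‖x - y‖ ≤ 1 / 2) {t : ℝ}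
    (ht : ∀ y ∈ s, (y.ofLp ᵥ* N) ⬝ᵥ (y.ofLp ᵥ* N) ≤ t) (x : Fin n → ℝ) :
    (x ᵥ* N) ⬝ᵥ (x ᵥ* N) ≤ 4 * t * (x ⬝ᵥ x) := by
  let T : EuclideanSpace ℝ (Fin n) →L[ℝ] EuclideanSpace ℝ (Fin d) :=
    (Matrix.toEuclideanLin Nᵀ).toContinuousLinearMap
  have hT : ∀ y, ‖T y‖ ^ 2 = (y.ofLp ᵥ* N) ⬝ᵥ (y.ofLp ᵥ* N) := by
    intro y
    have : T y = WithLp.toLp 2 (y.ofLp ᵥ* N) := by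
      rw [← Matrix.mulVec_transpose]
      rfl
    rw [this, norm_toLp_sq]
  have ht0 : 0 ≤ t := by
    obtain ⟨y, hy, -⟩ := hs 0 (by simp)
    exact (dotProduct_self_nonneg' _).trans (ht y hy)
  have h1 : ‖T‖ ≤ √t + ‖T‖ / 2 := by
    refine ContinuousLinearMap.opNorm_le_of_unit_norm (by positivity) fun x hx => ?_
    obtain ⟨y, hy, hxy⟩ := hs x hx.le
    have e : T x = T y + T (x - y) := by rw [← map_add]; simp
    rw [e]
    refine (norm_add_le _ _).trans (add_le_add ?_ ?_)
    · refine Real.le_sqrt_of_sq_le ?_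
      rw [hT]
      exact ht y hy
    · refine (T.le_opNorm _).trans ?_
      have := mul_le_mul_of_nonneg_left hxy (norm_nonneg T)
      linarith
  have h2 : ‖T‖ ≤ 2 * √t := by linarith
  have h3 := T.le_opNorm (WithLp.toLp 2 x)
  have h4 : ‖T (WithLp.toLp 2 x)‖ ^ 2 ≤ (2 * √t * ‖(WithLp.toLp 2 x : EuclideanSpace ℝ (Fin n))‖) ^ 2 := by
    gcongr
    exact h3.trans (by gcongr)
  rw [hT, mul_pow, mul_pow, Real.sq_sqrt ht0, norm_toLp_sq] at h4
  norm_num at h4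
  exact h4

/-- A matrix and its transpose have the same norm: with `y = N x`, Cauchy–Schwarz in `|y|² = ⟨y N,
x⟩` and cancellation of `|y|²`. -/
theorem mulVec_bound_of_vecMul_bound {n d : ℕ} (N : Matrix (Fin n) (Fin d) ℝ) {t : ℝ} (ht : 0 ≤ t)
    (h : ∀ x : Fin n → ℝ, (x ᵥ* N) ⬝ᵥ (x ᵥ* N) ≤ t * (x ⬝ᵥ x)) (x : Fin d → ℝ) :
    (N *ᵥ x) ⬝ᵥ (N *ᵥ x) ≤ t * (x ⬝ᵥ x) := by
  set y := N *ᵥ x with hy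
  have h1 : y ⬝ᵥ y = (y ᵥ* N) ⬝ᵥ x := by
    conv_lhs => rw [hy]
    rw [← hy, Matrix.dotProduct_mulVec]
  have h2 := dotProduct_sq_le (y ᵥ* N) x
  rw [← h1] at h2
  have h3 := mul_le_mul_of_nonneg_right (h y) (dotProduct_self_nonneg' x)
  rcases (dotProduct_self_nonneg' y).eq_or_lt with h0 | h0
  · rw [← h0]
    exact mul_nonneg ht (dotProduct_self_nonneg' x)
  · have h4 := h2.trans h3
    refine le_of_mul_le_mul_left ?_ h0
    linarith [pow_two (y ⬝ᵥ y)]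

/-- Exponential moments of independent rows multiply and the squared weights add up to at most one,
so the variance proxy does not grow. -/
theorem VecSubG.vecMul {n d : ℕ} {g : ℝ} (hg : 0 ≤ g) {ρ : Measure (Fin d → ℝ)}
    [IsProbabilityMeasure ρ] (h : VecSubG g (fun x => x) ρ) (u : Fin n → ℝ) (hu : u ⬝ᵥ u ≤ 1) :
    VecSubG g (fun w : Fin n → Fin d → ℝ => u ᵥ* Matrix.of w) (Measure.pi fun _ => ρ) := by
  intro v
  have e : ∀ w : Fin n → Fin d → ℝ, ENNReal.ofReal (Real.exp ((u ᵥ* Matrix.of w) ⬝ᵥ v))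
      = ∏ i, ENNReal.ofReal (Real.exp (w i ⬝ᵥ (u i • v))) := by
    intro w
    rw [← ENNReal.ofReal_prod_of_nonneg (fun _ _ => (Real.exp_pos _).le), ← Real.exp_sum]
    congr 2
    rw [← Matrix.dotProduct_mulVec]
    simp only [dotProduct, Matrix.mulVec, Pi.smul_apply, smul_eq_mul, Finset.mul_sum,
      Matrix.of_apply]
    refine Finset.sum_congr rfl fun i _ => Finset.sum_congr rfl fun j _ => by ring
  simp_rw [e]
  rw [lintegral_pi_prod (fun _ => ρ)
    (fun i x => ENNReal.ofReal (Real.exp (x ⬝ᵥ (u i • v)))) (fun i =>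
      ENNReal.measurable_ofReal.comp (Real.measurable_exp.comp
        (measurable_dotProduct measurable_id measurable_const)))]
  refine (Finset.prod_le_prod' fun i _ => h (u i • v)).trans ?_
  rw [← ENNReal.ofReal_prod_of_nonneg (fun _ _ => (Real.exp_pos _).le), ← Real.exp_sum]
  refine ENNReal.ofReal_le_ofReal (Real.exp_le_exp.2 ?_)
  have e2 : ∑ i, g * (u i • v ⬝ᵥ u i • v) / 2 = (u ⬝ᵥ u) * (g * (v ⬝ᵥ v) / 2) := by
    rw [dotProduct, Finset.sum_mul]
    refine Finset.sum_congr rfl fun i _ => ?_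
    simp only [smul_dotProduct, dotProduct_smul, smul_eq_mul]
    ring
  rw [e2]
  have := mul_nonneg hg (dotProduct_self_nonneg' v)
  nlinarith

theorem measurable_vecMul_of {n d : ℕ} (u : Fin n → ℝ) :
    Measurable fun w : Fin n → Fin d → ℝ => u ᵥ* Matrix.of w := by
  refine measurable_pi_iff.2 fun j => ?_
  simp only [Matrix.vecMul, dotProduct, Matrix.of_apply]
  fun_prop

theorem five_pow_mul_exp_le (n : ℕ) :
    (5 : ℝ≥0∞) ^ n * ENNReal.ofReal (Real.exp (-(3 * n))) ≤ ENNReal.ofReal (Real.exp (-n)) := by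
  have h5 : (5 : ℝ≥0∞) ^ n = ENNReal.ofReal (5 ^ n) := by
    rw [ENNReal.ofReal_pow (by norm_num)]
    norm_num
  rw [h5, ← ENNReal.ofReal_mul (by positivity)]
  refine ENNReal.ofReal_le_ofReal ?_
  have h : (5 : ℝ) ≤ Real.exp 2 := by
    have := Real.quadratic_le_exp_of_nonneg (x := 2) (by norm_num)
    linarith
  calc (5 : ℝ) ^ n * Real.exp (-(3 * n)) ≤ Real.exp 2 ^ n * Real.exp (-(3 * n)) := by gcongr
    _ = Real.exp (-n) := by
      rw [← Real.exp_nat_mul, ← Real.exp_add]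
      congr 1
      ring

/-- Operator norm of a sample of `n` independent vectors `Rᵀ ξ`, where `ξ` is sub-Gaussian and
`|Rᵀ ξ|² = ∑ λ_j ⟨ξ, e_j⟩²`. -/
theorem measure_pi_opNorm_le {n d : ℕ} {κ : Type*} [Fintype κ] [DecidableEq κ] {g : ℝ} (hg : 0 < g)
    {ρ : Measure (Fin d → ℝ)}
    [IsProbabilityMeasure ρ] (h : VecSubG g (fun x => x) ρ) (e : κ → Fin d → ℝ)
    (he : ∀ i j, e i ⬝ᵥ e j = if i = j then 1 else 0) (lam : κ → ℝ) (hlam : ∀ j, 0 ≤ lam j) {l : ℝ}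
    (hl : 0 < l) (hlaml : ∀ j, lam j ≤ l) (R : Matrix (Fin d) (Fin d) ℝ)
    (hR : ∀ ξ : Fin d → ℝ, (ξ ᵥ* R) ⬝ᵥ (ξ ᵥ* R) = ∑ j, lam j * (ξ ⬝ᵥ e j) ^ 2) :
    (Measure.pi fun _ : Fin n => ρ) {w | ¬ ∀ x : Fin d → ℝ,
      ((Matrix.of w * R) *ᵥ x) ⬝ᵥ ((Matrix.of w * R) *ᵥ x)
        ≤ 4 * (2 * g * ∑ j, lam j + 12 * g * l * n) * (x ⬝ᵥ x)}
      ≤ ENNReal.ofReal (Real.exp (-n)) := by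
  obtain ⟨s, hsc, hs1, hs⟩ := exists_half_net (EuclideanSpace ℝ (Fin n))
  rw [finrank_euclideanSpace_fin] at hsc
  -- The second term is `4 g l τ` with `τ = 3 n`: the tail `exp (-3n)` outweighs the `5 ^ n ≤ exp
  -- (2n)` points of the net.
  set t := 2 * g * ∑ j, lam j + 12 * g * l * n with ht
  have ht0 : 0 ≤ t := by
    have := Finset.sum_nonneg fun j (_ : j ∈ Finset.univ) => hlam j
    positivity
  have hsq : ∀ j, √(lam j) * √(lam j) = lam j := fun j => Real.mul_self_sqrt (hlam j)
  have hbad : {w : Fin n → Fin d → ℝ | ¬ ∀ x : Fin d → ℝ,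
      ((Matrix.of w * R) *ᵥ x) ⬝ᵥ ((Matrix.of w * R) *ᵥ x) ≤ 4 * t * (x ⬝ᵥ x)}
      ⊆ ⋃ y ∈ s, {w | t ≤ ∑ j, lam j * ((y.ofLp ᵥ* Matrix.of w) ⬝ᵥ e j) ^ 2} := by
    intro w hw
    by_contra hcon
    refine hw (mulVec_bound_of_vecMul_bound _ (by positivity)
      (vecMul_bound_of_net _ s hs fun y hy => ?_))
    simp only [Set.mem_iUnion, not_exists] at hcon
    rw [← Matrix.vecMul_vecMul, hR]
    exact (not_le.1 (hcon y hy)).le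
  refine (measure_mono hbad).trans ((measure_biUnion_finset_le _ _).trans ?_)
  have hy : ∀ y ∈ s, (Measure.pi fun _ : Fin n => ρ)
      {w | t ≤ ∑ j, lam j * ((y.ofLp ᵥ* Matrix.of w) ⬝ᵥ e j) ^ 2}
      ≤ ENNReal.ofReal (Real.exp (-(3 * n))) := by
    intro y hy
    have hu : y.ofLp ⬝ᵥ y.ofLp ≤ 1 := by
      rw [← norm_sq_eq_ofLp]
      exact pow_le_one₀ (norm_nonneg _) (hs1 y hy)
    have hm := (h.vecMul hg.le y.ofLp hu).measure_sum_sq_ge_le (measurable_vecMul_of y.ofLp) hg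
      (fun j => √(lam j) • e j)
      (fun i j hij => by simp [smul_dotProduct, dotProduct_smul, he, hij]) hl
      (fun j => by simpa [smul_dotProduct, dotProduct_smul, he, hsq] using hlaml j) (3 * n)
    simp only [smul_dotProduct, dotProduct_smul, he, smul_eq_mul, if_true, mul_one, hsq,
      mul_pow, Real.sq_sqrt (hlam _)] at hm
    convert hm using 4
    rw [ht]
    ring_nf
  refine (Finset.sum_le_sum hy).trans ?_
  rw [Finset.sum_const, nsmul_eq_mul]
  refine le_trans ?_ (five_pow_mul_exp_le n)
  gcongr
  exact_mod_cast hsc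

-- Fourth moments and lower tails of isotropic samples

theorem VecSubG.lintegral_pow_four_le {d : ℕ} {g : ℝ} (hg : 0 < g) {ρ : Measure (Fin d → ℝ)}
    (h : VecSubG g (fun x => x) ρ) (v : Fin d → ℝ) (hv : v ⬝ᵥ v = 1) :
    -- The constant is `80 = 24 · 2 · 5/3`: `y⁴ ≤ 4! exp |y|` at `y = ⟨x, v⟩ / √g`, two signs, and
    -- `exp (1/2) ≤ 5/3`.
    ∫⁻ x, ENNReal.ofReal ((x ⬝ᵥ v) ^ 4) ∂ρ ≤ ENNReal.ofReal (80 * g ^ 2) := by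
  set t := (√g)⁻¹ with ht
  have hsg : 0 < √g := Real.sqrt_pos.2 hg
  have ht0 : 0 < t := by positivity
  have htt : t * t = g⁻¹ := by rw [ht, ← mul_inv, Real.mul_self_sqrt hg.le]
  have ht4 : t ^ 4 * g ^ 2 = 1 := by
    have : t ^ 4 = (t * t) ^ 2 := by ring
    rw [this, htt]
    field_simp
  have hpt : ∀ x : Fin d → ℝ, (x ⬝ᵥ v) ^ 4
      ≤ 24 * g ^ 2 * (Real.exp (x ⬝ᵥ (t • v)) + Real.exp (x ⬝ᵥ (-t • v))) := by
    intro x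
    set a := x ⬝ᵥ v
    have h1 := Real.pow_div_factorial_le_exp (x := |t * a|) (abs_nonneg _) 4
    have h2 : Real.exp |t * a| ≤ Real.exp (t * a) + Real.exp (-(t * a)) := by
      rcases abs_cases (t * a) with h | h <;> rw [h.1]
      · linarith [Real.exp_pos (-(t * a))]
      · linarith [Real.exp_pos (t * a)]
    have h3 : |t * a| ^ 4 = t ^ 4 * a ^ 4 := by
      rw [(by decide : Even 4).pow_abs, mul_pow]
    have h4 : ((Nat.factorial 4 : ℕ) : ℝ) = 24 := by norm_num [Nat.factorial]
    rw [h3, h4, div_le_iff₀ (by norm_num)] at h1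
    simp only [dotProduct_smul, smul_eq_mul, neg_mul]
    have h5 : a ^ 4 = g ^ 2 * (t ^ 4 * a ^ 4) := by
      rw [← mul_assoc, mul_comm (g ^ 2), ht4, one_mul]
    rw [h5]
    have := mul_le_mul_of_nonneg_left (h1.trans (mul_le_mul_of_nonneg_right h2 (by norm_num)))
      (sq_nonneg g)
    linarith
  have hexp : ∀ r : ℝ, r * r = g⁻¹ →
      ∫⁻ x, ENNReal.ofReal (Real.exp (x ⬝ᵥ (r • v))) ∂ρ ≤ ENNReal.ofReal (5 / 3) := by
    intro r hr
    refine (h (r • v)).trans (ENNReal.ofReal_le_ofReal ?_)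
    simp only [dotProduct_smul, smul_dotProduct, smul_eq_mul, hv, mul_one, hr]
    rw [mul_inv_cancel₀ hg.ne']
    have h1 : Real.exp (1 / 2) ^ 2 ≤ (5 / 3) ^ 2 := by
      rw [← Real.exp_nat_mul]
      have := Real.exp_one_lt_d9
      norm_num at this ⊢
      linarith
    exact le_of_sq_le_sq h1 (by norm_num)
  have hm : ∀ r : ℝ, Measurable fun x : Fin d → ℝ => ENNReal.ofReal (Real.exp (x ⬝ᵥ (r • v))) :=
    fun r => ENNReal.measurable_ofReal.comp (Real.measurable_exp.comp
        (measurable_dotProduct measurable_id measurable_const))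
  calc ∫⁻ x, ENNReal.ofReal ((x ⬝ᵥ v) ^ 4) ∂ρ
      ≤ ∫⁻ x, ENNReal.ofReal (24 * g ^ 2) * (ENNReal.ofReal (Real.exp (x ⬝ᵥ (t • v)))
          + ENNReal.ofReal (Real.exp (x ⬝ᵥ (-t • v)))) ∂ρ := by
        refine lintegral_mono fun x => ?_
        rw [← ENNReal.ofReal_add (Real.exp_pos _).le (Real.exp_pos _).le,
          ← ENNReal.ofReal_mul (by positivity)]
        exact ENNReal.ofReal_le_ofReal (hpt x)
    _ = ENNReal.ofReal (24 * g ^ 2) * (∫⁻ x, ENNReal.ofReal (Real.exp (x ⬝ᵥ (t • v))) ∂ρ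
          + ∫⁻ x, ENNReal.ofReal (Real.exp (x ⬝ᵥ (-t • v))) ∂ρ) := by
        rw [lintegral_const_mul' _ _ ENNReal.ofReal_ne_top, lintegral_add_left (hm t)]
    _ ≤ ENNReal.ofReal (24 * g ^ 2) * (ENNReal.ofReal (5 / 3) + ENNReal.ofReal (5 / 3)) := by
        gcongr
        · exact hexp t htt
        · exact hexp (-t) (by rw [neg_mul_neg, htt])
    _ = ENNReal.ofReal (80 * g ^ 2) := by
        rw [← ENNReal.ofReal_add (by norm_num) (by norm_num), ← ENNReal.ofReal_mul (by positivity)]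
        congr 1
        ring

theorem HasMoments.integrable_mul {d : ℕ} {π : Measure (Fin d → ℝ)} {S : Matrix (Fin d) (Fin d) ℝ}
    (h : HasMoments π S) (i j : Fin d) : Integrable (fun x : Fin d → ℝ => x i * x j) π :=
  (h.memLp i).integrable_mul (h.memLp j)

theorem dotProduct_sq_eq {d : ℕ} (x v : Fin d → ℝ) :
    (x ⬝ᵥ v) ^ 2 = ∑ i, ∑ j, v i * v j * (x i * x j) := by
  rw [pow_two, dotProduct, Finset.sum_mul_sum]
  exact Finset.sum_congr rfl fun i _ => Finset.sum_congr rfl fun j _ => by ring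

theorem HasMoments.integrable_sq {d : ℕ} {π : Measure (Fin d → ℝ)} {S : Matrix (Fin d) (Fin d) ℝ}
    (h : HasMoments π S) (v : Fin d → ℝ) : Integrable (fun x : Fin d → ℝ => (x ⬝ᵥ v) ^ 2) π := by
  simp_rw [dotProduct_sq_eq]
  exact integrable_finsetSum _ fun i _ => integrable_finsetSum _ fun j _ =>
    (h.integrable_mul i j).const_mul _

theorem HasMoments.integral_sq {d : ℕ} {π : Measure (Fin d → ℝ)} {S : Matrix (Fin d) (Fin d) ℝ}
    (h : HasMoments π S) (v : Fin d → ℝ) : ∫ x, (x ⬝ᵥ v) ^ 2 ∂π = v ⬝ᵥ (S *ᵥ v) := by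
  simp_rw [dotProduct_sq_eq]
  rw [integral_finsetSum _ fun i _ => integrable_finsetSum _ fun j _ =>
    (h.integrable_mul i j).const_mul _]
  simp only [dotProduct, Matrix.mulVec, Finset.mul_sum]
  refine Finset.sum_congr rfl fun i _ => ?_
  rw [integral_finsetSum _ fun j _ => (h.integrable_mul i j).const_mul _]
  refine Finset.sum_congr rfl fun j _ => ?_
  rw [integral_const_mul, h.secondMoment]
  ring

theorem VecSubG.integrable_pow_four {d : ℕ} {g : ℝ} (hg : 0 < g) {ρ : Measure (Fin d → ℝ)}
    (h : VecSubG g (fun x => x) ρ) (v : Fin d → ℝ) (hv : v ⬝ᵥ v = 1) :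
    Integrable (fun x => (x ⬝ᵥ v) ^ 4) ρ := by
  have hm : Measurable fun x : Fin d → ℝ => (x ⬝ᵥ v) ^ 4 :=
    (measurable_dotProduct measurable_id measurable_const).pow_const 4
  refine ⟨hm.aestronglyMeasurable, ?_⟩
  rw [hasFiniteIntegral_iff_ofReal (ae_of_all _ fun x => by positivity)]
  exact (h.lintegral_pow_four_le hg v hv).trans_lt ENNReal.ofReal_lt_top

theorem VecSubG.integral_pow_four_le {d : ℕ} {g : ℝ} (hg : 0 < g) {ρ : Measure (Fin d → ℝ)}
    (h : VecSubG g (fun x => x) ρ) (v : Fin d → ℝ) (hv : v ⬝ᵥ v = 1) :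
    ∫ x, (x ⬝ᵥ v) ^ 4 ∂ρ ≤ 80 * g ^ 2 := by
  have h1 := h.lintegral_pow_four_le hg v hv
  rw [← ofReal_integral_eq_lintegral_ofReal (h.integrable_pow_four hg v hv)
    (ae_of_all _ fun x => by positivity)] at h1
  exact (ENNReal.ofReal_le_ofReal_iff (by positivity)).1 h1

/-- Lower tail of the quadratic form `∑_i ∑_j λ_j ⟨ξ_i, e_j⟩²` of a sample of isotropic
sub-Gaussian vectors. -/
theorem measure_pi_quadratic_le {d : ℕ} {κ : Type*} [Fintype κ] {g : ℝ} (hg : 0 < g)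
    {ρ : Measure (Fin d → ℝ)} [IsProbabilityMeasure ρ] (hmom : HasMoments ρ 1)
    (h : VecSubG g (fun x => x) ρ) (e : κ → Fin d → ℝ) (he : ∀ j, e j ⬝ᵥ e j = 1)
    (lam : κ → ℝ) (hlam : ∀ j, 0 ≤ lam j) (hS : 0 < ∑ j, lam j) (n : ℕ) :
    (Measure.pi fun _ : Fin n => ρ)
        {w | ∑ i, ∑ j, lam j * (w i ⬝ᵥ e j) ^ 2 ≤ n * (∑ j, lam j) / 2}
      ≤ ENNReal.ofReal (Real.exp (-(n / (8 * (80 * g ^ 2))))) := by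
  set S := ∑ j, lam j with hSdef
  have hqm : Measurable fun x : Fin d → ℝ => ∑ j, lam j * (x ⬝ᵥ e j) ^ 2 :=
    Finset.measurable_sum _ fun j _ =>
      ((measurable_dotProduct measurable_id measurable_const).pow_const 2).const_mul _
  -- Weighted Cauchy–Schwarz reduces the second moment of the form to fourth moments of single
  -- directions, which gives `a = 80 g²` in `measure_pi_sum_le` whatever the weights.
  have hle : ∀ x : Fin d → ℝ, (∑ j, lam j * (x ⬝ᵥ e j) ^ 2) ^ 2
      ≤ S * ∑ j, lam j * (x ⬝ᵥ e j) ^ 4 := by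
    intro x
    exact Finset.sum_sq_le_sum_mul_sum_of_sq_le_mul _ (fun j _ => hlam j)
      (fun j _ => mul_nonneg (hlam j) (by positivity)) (fun j _ => le_of_eq (by ring))
  have hi4 : Integrable (fun x : Fin d → ℝ => S * ∑ j, lam j * (x ⬝ᵥ e j) ^ 4) ρ :=
    (integrable_finsetSum _ fun j _ =>
      (h.integrable_pow_four hg _ (he j)).const_mul (lam j)).const_mul S
  have hi2 : Integrable (fun x : Fin d → ℝ => (∑ j, lam j * (x ⬝ᵥ e j) ^ 2) ^ 2) ρ :=
    hi4.mono' (hqm.pow_const 2).aestronglyMeasurable (ae_of_all _ fun x => by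
      rw [Real.norm_of_nonneg (sq_nonneg _)]
      exact hle x)
  refine measure_pi_sum_le ρ hqm
    (fun x => Finset.sum_nonneg fun j _ => mul_nonneg (hlam j) (sq_nonneg _)) hS (by positivity)
    (integrable_finsetSum _ fun j _ => (hmom.integrable_sq (e j)).const_mul (lam j)) hi2 ?_ ?_ n
  · rw [integral_finsetSum _ fun j _ => (hmom.integrable_sq (e j)).const_mul (lam j)]
    refine Finset.sum_congr rfl fun j _ => ?_
    rw [integral_const_mul, hmom.integral_sq, Matrix.one_mulVec, he, mul_one]
  · refine (integral_mono hi2 hi4 hle).trans ?_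
    rw [integral_const_mul, integral_finsetSum _ fun j _ =>
      (h.integrable_pow_four hg _ (he j)).const_mul (lam j)]
    calc S * ∑ j, ∫ x, lam j * (x ⬝ᵥ e j) ^ 4 ∂ρ ≤ S * ∑ j, lam j * (80 * g ^ 2) := by
          gcongr with j
          rw [integral_const_mul]
          exact mul_le_mul_of_nonneg_left (h.integral_pow_four_le hg _ (he j)) (hlam j)
      _ = 80 * g ^ 2 * S ^ 2 := by
          rw [← Finset.sum_mul]
          ring

theorem measure_pi_mulVec_le {d : ℕ} {g : ℝ} (hg : 0 < g)
    {ρ : Measure (Fin d → ℝ)} [IsProbabilityMeasure ρ] (hmom : HasMoments ρ 1)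
    (h : VecSubG g (fun x => x) ρ) (n : ℕ) (x : Fin d → ℝ) (hx : x ≠ 0) :
    (Measure.pi fun _ : Fin n => ρ)
        {w | (Matrix.of w *ᵥ x) ⬝ᵥ (Matrix.of w *ᵥ x) ≤ n / 2 * (x ⬝ᵥ x)}
      ≤ ENNReal.ofReal (Real.exp (-(n / (8 * (80 * g ^ 2))))) := by
  have hpos : 0 < x ⬝ᵥ x := by simpa using Matrix.dotProduct_star_self_pos_iff.2 hx
  set r := √(x ⬝ᵥ x) with hr
  have hr0 : 0 < r := Real.sqrt_pos.2 hpos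
  have hrr : r * r = x ⬝ᵥ x := Real.mul_self_sqrt hpos.le
  have h1 := measure_pi_quadratic_le hg hmom h (fun _ : Unit => r⁻¹ • x) (fun _ => by
    rw [smul_dotProduct, dotProduct_smul, ← hrr, smul_eq_mul, smul_eq_mul]
    field_simp) (fun _ => 1) (fun _ => zero_le_one) (by simp) n
  refine le_trans (measure_mono fun w hw => ?_) h1
  change ∑ i, ∑ _j : Unit, 1 * (w i ⬝ᵥ r⁻¹ • x) ^ 2 ≤ n * (∑ _j : Unit, (1 : ℝ)) / 2
  change (Matrix.of w *ᵥ x) ⬝ᵥ (Matrix.of w *ᵥ x) ≤ n / 2 * (x ⬝ᵥ x) at hw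
  have e : ∑ i, ∑ _j : Unit, 1 * (w i ⬝ᵥ r⁻¹ • x) ^ 2
      = ((Matrix.of w *ᵥ x) ⬝ᵥ (Matrix.of w *ᵥ x)) / (x ⬝ᵥ x) := by
    rw [← hrr]
    conv_rhs => rw [dotProduct]
    rw [Finset.sum_div]
    refine Finset.sum_congr rfl fun i _ => ?_
    simp only [dotProduct_smul, smul_eq_mul, Matrix.mulVec, Finset.univ_unique,
      Finset.sum_singleton, one_mul]
    change (r⁻¹ * (w i ⬝ᵥ x)) ^ 2 = (w i ⬝ᵥ x) * (w i ⬝ᵥ x) / (r * r)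
    field_simp
  rw [e, div_le_iff₀ hpos]
  simpa using hw

/-- Smallest singular value of a sample of isotropic sub-Gaussian vectors. -/
theorem measure_pi_smallest_singular_le {n d : ℕ} (hdn : d ≤ n) (hn : 0 < n) {g : ℝ} (hg : 0 < g)
    {ρ : Measure (Fin d → ℝ)} [IsProbabilityMeasure ρ] (hmom : HasMoments ρ 1)
    (h : VecSubG g (fun x => x) ρ) {k : ℕ} (hk1 : 1 ≤ k) (hk : 56 * g * (1 / 4) ^ k ≤ 1 / 32) :
    (Measure.pi fun _ : Fin n => ρ) {w | ¬ ∀ x : Fin d → ℝ,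
      n / 32 * (x ⬝ᵥ x) ≤ (Matrix.of w *ᵥ x) ⬝ᵥ (Matrix.of w *ᵥ x)}
      ≤ ENNReal.ofReal (Real.exp (-n))
        + (5 ^ d) ^ k * ENNReal.ofReal (Real.exp (-(n / (8 * (80 * g ^ 2))))) := by
  classical
  obtain ⟨s, hsc, hs⟩ := exists_net (EuclideanSpace ℝ (Fin d)) k
  rw [finrank_euclideanSpace_fin] at hsc
  have hn' : (0 : ℝ) < n := by exact_mod_cast hn
  have hdn' : (d : ℝ) ≤ n := by exact_mod_cast hdn
  have hop := measure_pi_opNorm_le (n := n) hg h (fun j => Pi.single j (1 : ℝ))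
    (fun i j => by simp [Pi.single_apply, eq_comm]) (fun _ => 1) (fun _ => zero_le_one) one_pos
    (fun _ => le_rfl) 1 (fun ξ => by simp [dotProduct, pow_two, Pi.single_apply])
  simp only [mul_one, Matrix.mul_one] at hop
  have hsub : {w : Fin n → Fin d → ℝ | ¬ ∀ x : Fin d → ℝ,
      n / 32 * (x ⬝ᵥ x) ≤ (Matrix.of w *ᵥ x) ⬝ᵥ (Matrix.of w *ᵥ x)}
      ⊆ {w | ¬ ∀ x : Fin d → ℝ, (Matrix.of w *ᵥ x) ⬝ᵥ (Matrix.of w *ᵥ x)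
          ≤ 4 * (2 * g * ∑ _j : Fin d, 1 + 12 * g * n) * (x ⬝ᵥ x)}
        -- The origin may belong to the net and has no lower tail bound; it is never the point used
        -- below.
        ∪ ⋃ y ∈ s.filter (fun y => y.ofLp ≠ 0), {w | (Matrix.of w *ᵥ y.ofLp) ⬝ᵥ
          (Matrix.of w *ᵥ y.ofLp) ≤ n / 2 * (y.ofLp ⬝ᵥ y.ofLp)} := by
    intro w hw
    by_contra hcon
    simp only [Set.mem_union, Set.mem_iUnion, not_or, not_exists] at hcon
    obtain ⟨hc1, hc2⟩ := hcon
    have hc1 := not_not.1 hc1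
    refine hw fun x => ?_
    -- A net point `y` near a unit vector has `|y|² ≥ 1/4`, so `|w y|² ≥ n/8`. The norm bound `56 g
    -- n` (here `d ≤ n` enters) and the choice of `k` give `|w (x - y)|² ≤ n/32`. From `|w y|² ≤ 2
    -- |w x|² + 2 |w (x - y)|²` there remains `|w x|² ≥ n/16 - n/32`.
    have hunit : ∀ x : Fin d → ℝ, x ⬝ᵥ x = 1 →
        n / 32 ≤ (Matrix.of w *ᵥ x) ⬝ᵥ (Matrix.of w *ᵥ x) := by
      intro x hx
      obtain ⟨y, hy, hxy⟩ := hs (WithLp.toLp 2 x) (by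
        rw [← sq_le_one_iff₀ (norm_nonneg _), norm_toLp_sq, hx])
      have hd : (x - y.ofLp) ⬝ᵥ (x - y.ofLp) ≤ (1 / 4) ^ k := by
        have h2 : ‖WithLp.toLp 2 x - y‖ ^ 2 ≤ ((1 / 2) ^ k) ^ 2 := by gcongr
        rw [norm_sq_eq_ofLp, ← pow_mul, mul_comm k, pow_mul] at h2
        norm_num at h2 ⊢
        exact h2
      have hd4 : ((1 : ℝ) / 4) ^ k ≤ 1 / 4 := by
        calc ((1 : ℝ) / 4) ^ k ≤ (1 / 4) ^ 1 :=
              pow_le_pow_of_le_one (by norm_num) (by norm_num) hk1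
          _ = 1 / 4 := by norm_num
      have hyy : 1 / 4 ≤ y.ofLp ⬝ᵥ y.ofLp := by
        have := add_dotProduct_self_le (x - y.ofLp) y.ofLp
        rw [sub_add_cancel, hx] at this
        linarith
      have hy0 : y.ofLp ≠ 0 := by
        intro h0
        rw [h0] at hyy
        norm_num at hyy
      have h1 : n / 2 * (y.ofLp ⬝ᵥ y.ofLp)
          < (Matrix.of w *ᵥ y.ofLp) ⬝ᵥ (Matrix.of w *ᵥ y.ofLp) :=
        not_le.1 (hc2 y (Finset.mem_filter.2 ⟨hy, hy0⟩))
      have h2 := hc1 (x - y.ofLp)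
      have h3 := sub_dotProduct_self_le (Matrix.of w *ᵥ x) (Matrix.of w *ᵥ (x - y.ofLp))
      rw [Matrix.mulVec_sub, sub_sub_cancel, ← Matrix.mulVec_sub] at h3
      have h4 : 4 * (2 * g * ∑ _j : Fin d, (1 : ℝ) + 12 * g * n) ≤ 56 * g * n := by
        simp only [Finset.sum_const, Finset.card_univ, Fintype.card_fin, nsmul_eq_mul, mul_one]
        nlinarith
      have h5 : 4 * (2 * g * ∑ _j : Fin d, (1 : ℝ) + 12 * g * n)
          * ((x - y.ofLp) ⬝ᵥ (x - y.ofLp)) ≤ n / 32 := by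
        calc _ ≤ 56 * g * n * (1 / 4) ^ k :=
              mul_le_mul h4 hd (dotProduct_self_nonneg' _) (by positivity)
          _ = n * (56 * g * (1 / 4) ^ k) := by ring
          _ ≤ n * (1 / 32) := by gcongr
          _ = n / 32 := by ring
      have h6 : (n : ℝ) / 8 ≤ n / 2 * (y.ofLp ⬝ᵥ y.ofLp) := by nlinarith
      linarith
    rcases eq_or_ne x 0 with rfl | hx0
    · simp
    · have hpos : 0 < x ⬝ᵥ x := by simpa using Matrix.dotProduct_star_self_pos_iff.2 hx0
      set r := √(x ⬝ᵥ x) with hr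
      have hr0 : 0 < r := Real.sqrt_pos.2 hpos
      have hrr : r * r = x ⬝ᵥ x := Real.mul_self_sqrt hpos.le
      have h1 := hunit (r⁻¹ • x) (by
        rw [smul_dotProduct, dotProduct_smul, ← hrr, smul_eq_mul, smul_eq_mul]
        field_simp)
      rw [Matrix.mulVec_smul, smul_dotProduct, dotProduct_smul, smul_eq_mul, smul_eq_mul,
        ← mul_assoc, ← mul_inv, hrr, ← div_eq_inv_mul, le_div_iff₀ hpos] at h1
      exact h1
  refine (measure_mono hsub).trans ((measure_union_le _ _).trans (add_le_add hop ?_))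
  refine (measure_biUnion_finset_le _ _).trans ?_
  refine (Finset.sum_le_sum fun y hy =>
    measure_pi_mulVec_le hg hmom h n y.ofLp (Finset.mem_filter.1 hy).2).trans ?_
  rw [Finset.sum_const, nsmul_eq_mul]
  gcongr
  exact_mod_cast (Finset.card_filter_le _ _).trans hsc

/-! ### Positive semi-definite matrices -/

theorem HasMoments.posSemidef {d : ℕ} {π : Measure (Fin d → ℝ)} {S : Matrix (Fin d) (Fin d) ℝ}
    (h : HasMoments π S) : S.PosSemidef := by
  refine Matrix.PosSemidef.of_dotProduct_mulVec_nonneg ?_ fun x => ?_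
  · ext i j
    rw [Matrix.conjTranspose_apply, star_trivial, ← h.secondMoment, ← h.secondMoment]
    simp_rw [mul_comm]
  · rw [star_trivial, ← h.integral_sq]
    exact integral_nonneg fun x => sq_nonneg _

theorem psdSqrt_transpose {d : ℕ} (S : Matrix (Fin d) (Fin d) ℝ) : (psdSqrt S)ᵀ = psdSqrt S := by
  have h : IsSelfAdjoint (psdSqrt S) := cfc_predicate _ _
  have h2 : star (psdSqrt S) = psdSqrt S := h
  rwa [Matrix.star_eq_conjTranspose, Matrix.conjTranspose_eq_transpose_of_trivial] at h2

theorem psdSqrt_mul_self {d : ℕ} {S : Matrix (Fin d) (Fin d) ℝ} (hS : S.PosSemidef) :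
    psdSqrt S * psdSqrt S = S := by
  have hsa : IsSelfAdjoint S := hS.isHermitian
  have hc : ∀ f : ℝ → ℝ, ContinuousOn f (spectrum ℝ S) :=
    fun f => Matrix.finite_real_spectrum.continuousOn f
  unfold psdSqrt
  rw [← cfc_mul _ _ _ (hc _) (hc _)]
  conv_rhs => rw [← cfc_id' ℝ S]
  refine cfc_congr fun t ht => ?_
  rw [hS.isHermitian.spectrum_real_eq_range_eigenvalues] at ht
  obtain ⟨i, rfl⟩ := ht
  exact Real.mul_self_sqrt (hS.eigenvalues_nonneg i)

theorem vecMul_psdSqrt_sq {d : ℕ} {S : Matrix (Fin d) (Fin d) ℝ} (hS : S.PosSemidef)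
    (ξ : Fin d → ℝ) : (ξ ᵥ* psdSqrt S) ⬝ᵥ (ξ ᵥ* psdSqrt S) = ξ ⬝ᵥ (S *ᵥ ξ) := by
  conv_rhs => rw [← psdSqrt_mul_self hS]
  rw [← Matrix.mulVec_mulVec, Matrix.dotProduct_mulVec]
  congr 1
  rw [← Matrix.mulVec_transpose, psdSqrt_transpose]

theorem mulVec_psdSqrt_sq {d : ℕ} {S : Matrix (Fin d) (Fin d) ℝ} (hS : S.PosSemidef)
    (ξ : Fin d → ℝ) : (psdSqrt S *ᵥ ξ) ⬝ᵥ (psdSqrt S *ᵥ ξ) = ξ ⬝ᵥ (S *ᵥ ξ) := by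
  rw [← vecMul_psdSqrt_sq hS, ← Matrix.mulVec_transpose, psdSqrt_transpose]

theorem opNorm_nonneg {d : ℕ} (S : Matrix (Fin d) (Fin d) ℝ) : 0 ≤ opNorm S := norm_nonneg _

theorem mulVec_sq_le_opNorm {d : ℕ} (S : Matrix (Fin d) (Fin d) ℝ) (x : Fin d → ℝ) :
    (S *ᵥ x) ⬝ᵥ (S *ᵥ x) ≤ opNorm S ^ 2 * (x ⬝ᵥ x) := by
  have h := (Matrix.toEuclideanCLM (n := Fin d) (𝕜 := ℝ) S).le_opNorm (WithLp.toLp 2 x)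
  have e : Matrix.toEuclideanCLM (n := Fin d) (𝕜 := ℝ) S (WithLp.toLp 2 x)
      = WithLp.toLp 2 (S *ᵥ x) := by
    simp
  rw [e] at h
  have h2 := pow_le_pow_left₀ (norm_nonneg _) h 2
  rwa [mul_pow, norm_toLp_sq, norm_toLp_sq] at h2

theorem quadratic_le_opNorm {d : ℕ} (S : Matrix (Fin d) (Fin d) ℝ) (x : Fin d → ℝ) :
    x ⬝ᵥ (S *ᵥ x) ≤ opNorm S * (x ⬝ᵥ x) := by
  have h1 := dotProduct_sq_le x (S *ᵥ x)
  have h2 := mul_le_mul_of_nonneg_left (mulVec_sq_le_opNorm S x) (dotProduct_self_nonneg' x)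
  refine le_of_sq_le_sq ?_ (mul_nonneg (opNorm_nonneg S) (dotProduct_self_nonneg' x))
  calc _ ≤ _ := h1.trans h2
    _ = _ := by ring

/-- Spectral data in the form that the tail bounds consume: both `‖S^{1/2} ξ‖²` and the trace become
weighted sums over one orthonormal family. -/
theorem exists_spectral {d : ℕ} {S : Matrix (Fin d) (Fin d) ℝ} (hS : S.PosSemidef) :
    ∃ (e : Fin d → Fin d → ℝ) (lam : Fin d → ℝ),
      (∀ i j, e i ⬝ᵥ e j = if i = j then 1 else 0) ∧ (∀ j, 0 ≤ lam j) ∧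
      (∀ j, lam j ≤ opNorm S) ∧ ∑ j, lam j = S.trace ∧
      ∀ ξ : Fin d → ℝ, (ξ ᵥ* psdSqrt S) ⬝ᵥ (ξ ᵥ* psdSqrt S) = ∑ j, lam j * (ξ ⬝ᵥ e j) ^ 2 := by
  have hH := hS.isHermitian
  set b := hH.eigenvectorBasis with hb
  have he : ∀ i j, (b i).ofLp ⬝ᵥ (b j).ofLp = if i = j then 1 else 0 := by
    intro i j
    have := orthonormal_iff_ite.1 b.orthonormal j i
    rw [EuclideanSpace.inner_eq_star_dotProduct] at this
    simpa [eq_comm] using this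
  refine ⟨fun j => (b j).ofLp, hH.eigenvalues, he, hS.eigenvalues_nonneg, fun j => ?_, ?_,
    fun ξ => ?_⟩
  · have h := quadratic_le_opNorm S (b j).ofLp
    rw [hH.mulVec_eigenvectorBasis, dotProduct_smul, he] at h
    simpa using h
  · rw [hH.trace_eq_sum_eigenvalues]
    simp
  · rw [vecMul_psdSqrt_sq hS]
    have hξ : ξ = ∑ j, (ξ ⬝ᵥ (b j).ofLp) • (b j).ofLp := by
      have h := congrArg WithLp.ofLp (b.sum_repr' (WithLp.toLp 2 ξ))
      simp only [EuclideanSpace.inner_eq_star_dotProduct, star_trivial] at h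
      conv_lhs => rw [← show (WithLp.toLp 2 ξ : EuclideanSpace ℝ (Fin d)).ofLp = ξ from rfl, ← h]
      simp
    have hSξ : S *ᵥ ξ = ∑ j, (hH.eigenvalues j * (ξ ⬝ᵥ (b j).ofLp)) • (b j).ofLp := by
      conv_lhs => rw [hξ]
      rw [Matrix.mulVec_sum]
      refine Finset.sum_congr rfl fun j _ => ?_
      rw [Matrix.mulVec_smul, hH.mulVec_eigenvectorBasis, smul_smul, mul_comm]
    rw [hSξ, dotProduct_sum]
    refine Finset.sum_congr rfl fun j _ => ?_
    rw [dotProduct_smul, smul_eq_mul]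
    ring

/-! ### Singular value decompositions -/

section SVD

variable {n p : ℕ} {x : Matrix (Fin n) (Fin p) ℝ} {σ : Fin (min n p) → ℝ}
  {u : Matrix (Fin n) (Fin (min n p)) ℝ} {v : Matrix (Fin p) (Fin (min n p)) ℝ}

theorem col_dotProduct_col {m r : ℕ} {u : Matrix (Fin m) (Fin r) ℝ} (h : uᵀ * u = 1) (i j : Fin r) :
    u.col i ⬝ᵥ u.col j = if i = j then 1 else 0 := by
  have := congrFun (congrFun h i) j
  rw [Matrix.one_apply] at this
  rw [← this]
  rfl

theorem mulVec_eq_sum_col {m r : ℕ} (u : Matrix (Fin m) (Fin r) ℝ) (c : Fin r → ℝ) :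
    u *ᵥ c = ∑ j, c j • u.col j := by
  rw [Matrix.mulVec_eq_sum]
  refine Finset.sum_congr rfl fun j _ => ?_
  rw [op_smul_eq_smul]
  rfl

theorem IsSVD.mulVec (h : IsSVD x σ u v) (y : Fin p → ℝ) :
    x *ᵥ y = ∑ j, (σ j * (v.col j ⬝ᵥ y)) • u.col j := by
  rw [h.eq, ← Matrix.mulVec_mulVec, ← Matrix.mulVec_mulVec, mulVec_eq_sum_col]
  refine Finset.sum_congr rfl fun j _ => ?_
  rw [Matrix.mulVec_diagonal]
  rfl

theorem IsSVD.mulVec_col (h : IsSVD x σ u v) (j : Fin (min n p)) :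
    x *ᵥ v.col j = σ j • u.col j := by
  rw [h.mulVec, Finset.sum_eq_single j]
  · rw [col_dotProduct_col h.right_orthonormal, if_pos rfl, mul_one]
  · intro i _ hij
    rw [col_dotProduct_col h.right_orthonormal, if_neg hij, mul_zero, zero_smul]
  · simp

theorem sum_smul_col_sq {m r : ℕ} {u : Matrix (Fin m) (Fin r) ℝ} (h : uᵀ * u = 1)
    (a : Fin r → ℝ) : (∑ j, a j • u.col j) ⬝ᵥ (∑ j, a j • u.col j) = ∑ j, a j ^ 2 := by
  rw [sum_dotProduct]
  refine Finset.sum_congr rfl fun j _ => ?_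
  rw [dotProduct_sum, Finset.sum_eq_single j]
  · rw [smul_dotProduct, dotProduct_smul, col_dotProduct_col h, if_pos rfl]
    simp [pow_two]
  · intro i _ hij
    rw [smul_dotProduct, dotProduct_smul, col_dotProduct_col h, if_neg hij.symm]
    simp
  · simp

/-- Bessel's inequality for the columns of a matrix with orthonormal columns. -/
theorem sum_col_dotProduct_sq_le {m r : ℕ} {u : Matrix (Fin m) (Fin r) ℝ} (h : uᵀ * u = 1)
    (y : Fin m → ℝ) : ∑ j, (u.col j ⬝ᵥ y) ^ 2 ≤ y ⬝ᵥ y := by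
  have h0 := dotProduct_self_nonneg' (y - ∑ j, (u.col j ⬝ᵥ y) • u.col j)
  have h1 : y ⬝ᵥ (∑ j, (u.col j ⬝ᵥ y) • u.col j) = ∑ j, (u.col j ⬝ᵥ y) ^ 2 := by
    rw [dotProduct_sum]
    refine Finset.sum_congr rfl fun j _ => ?_
    rw [dotProduct_smul, smul_eq_mul, dotProduct_comm y, pow_two]
  rw [sub_dotProduct, dotProduct_sub, dotProduct_sub, sum_smul_col_sq h, h1,
    dotProduct_comm (∑ j, (u.col j ⬝ᵥ y) • u.col j) y, h1] at h0
  linarith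

theorem frobSq_eq_trace (M : Matrix (Fin n) (Fin p) ℝ) : frobSq M = (M * Mᵀ).trace := by
  simp [frobSq, Matrix.trace, Matrix.mul_apply, pow_two]

theorem frobSq_eq_sum_row (M : Matrix (Fin n) (Fin p) ℝ) : frobSq M = ∑ i, M i ⬝ᵥ M i := by
  simp [frobSq, dotProduct, pow_two]

theorem IsSVD.frobSq_sub_truncSVD (h : IsSVD x σ u v) (k : ℕ) :
    frobSq (x - truncSVD σ u v k) = ∑ j : Fin (min n p), if (j : ℕ) < k then 0 else σ j ^ 2 := by
  have e : x - truncSVD σ u v k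
      = u * Matrix.diagonal (fun j : Fin (min n p) => if (j : ℕ) < k then 0 else σ j) * vᵀ := by
    conv_lhs => rw [h.eq]
    rw [truncSVD, ← Matrix.sub_mul, ← Matrix.mul_sub, Matrix.diagonal_sub]
    congr 3
    funext j
    split_ifs <;> simp
  rw [e, frobSq_eq_trace]
  set D := fun j : Fin (min n p) => if (j : ℕ) < k then 0 else σ j with hD
  have e2 : u * Matrix.diagonal D * vᵀ * (u * Matrix.diagonal D * vᵀ)ᵀ
      = u * (Matrix.diagonal D * Matrix.diagonal D * uᵀ) := by
    rw [Matrix.transpose_mul, Matrix.transpose_mul, Matrix.transpose_transpose,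
      Matrix.diagonal_transpose]
    calc _ = u * Matrix.diagonal D * (vᵀ * v) * (Matrix.diagonal D * uᵀ) := by
          simp only [Matrix.mul_assoc]
      _ = _ := by
          rw [h.right_orthonormal, Matrix.mul_one]
          simp only [Matrix.mul_assoc]
  rw [e2, Matrix.trace_mul_comm, Matrix.mul_assoc, h.left_orthonormal, Matrix.mul_one,
    Matrix.diagonal_mul_diagonal, Matrix.trace_diagonal]
  refine Finset.sum_congr rfl fun j _ => ?_
  simp only [hD]
  split_ifs <;> simp [pow_two]

/-- A perturbation of a matrix of rank `K` has small singular values beyond the `K`-th. -/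
theorem IsSVD.sq_le_of_rank_le (h : IsSVD x σ u v) {K : ℕ} {A : Matrix (Fin p) (Fin K) ℝ}
    {Z : Matrix (Fin n) (Fin K) ℝ} {W : Matrix (Fin n) (Fin p) ℝ} (hx : x = Z * Aᵀ + W) {b : ℝ}
    (hW : ∀ y, (W *ᵥ y) ⬝ᵥ (W *ᵥ y) ≤ b * (y ⬝ᵥ y)) (j : Fin (min n p)) (hj : K ≤ j) :
    σ j ^ 2 ≤ b := by
  have hKN : K + 1 ≤ min n p := by omega
  let ι : Fin (K + 1) → Fin (min n p) := Fin.castLE hKN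
  let V : Matrix (Fin p) (Fin (K + 1)) ℝ := v.submatrix id ι
  let U : Matrix (Fin n) (Fin (K + 1)) ℝ := u.submatrix id ι
  have hι : Function.Injective ι := Fin.castLE_injective hKN
  have hV : Vᵀ * V = 1 := by
    ext a c
    have := congrFun (congrFun h.right_orthonormal (ι a)) (ι c)
    simp only [Matrix.one_apply, hι.eq_iff] at this
    rw [Matrix.one_apply, ← this]
    rfl
  have hU : Uᵀ * U = 1 := by
    ext a c
    have := congrFun (congrFun h.left_orthonormal (ι a)) (ι c)
    simp only [Matrix.one_apply, hι.eq_iff] at this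
    rw [Matrix.one_apply, ← this]
    rfl
  -- Dimension count: some nonzero combination of the first `K + 1` right singular vectors is killed
  -- by `Aᵀ`. On it `x` acts as `W`, yet stretches by at least `σ j`, because `j ≥ K` in zero-based
  -- indexing.
  have hker : LinearMap.ker (Matrix.toLin' (Aᵀ * V)) ≠ ⊥ :=
    LinearMap.ker_ne_bot_of_finrank_lt (by simp)
  obtain ⟨c, hc, hc0⟩ := (Submodule.ne_bot_iff _).1 hker
  have hAc : Aᵀ *ᵥ (V *ᵥ c) = 0 := by
    rw [Matrix.mulVec_mulVec]
    simpa using hc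
  have hVc : V *ᵥ c = ∑ i, c i • V.col i := mulVec_eq_sum_col V c
  have hxW : x *ᵥ (V *ᵥ c) = W *ᵥ (V *ᵥ c) := by
    rw [hx, Matrix.add_mulVec, ← Matrix.mulVec_mulVec _ Z, hAc, Matrix.mulVec_zero, zero_add]
  have hxU : x *ᵥ (V *ᵥ c) = ∑ i, (c i * σ (ι i)) • U.col i := by
    rw [hVc, Matrix.mulVec_sum]
    refine Finset.sum_congr rfl fun i _ => ?_
    rw [Matrix.mulVec_smul, mul_smul]
    congr 1
    exact h.mulVec_col (ι i)
  have hle := hW (V *ᵥ c)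
  rw [← hxW, hxU, sum_smul_col_sq hU, hVc, sum_smul_col_sq hV] at hle
  have hpos : 0 < ∑ i, c i ^ 2 := by
    have := Matrix.dotProduct_star_self_pos_iff.2 hc0
    simpa [dotProduct, pow_two] using this
  have hge : σ j ^ 2 * ∑ i, c i ^ 2 ≤ ∑ i, (c i * σ (ι i)) ^ 2 := by
    rw [Finset.mul_sum]
    refine Finset.sum_le_sum fun i _ => ?_
    rw [mul_pow, mul_comm]
    refine mul_le_mul_of_nonneg_left ?_ (sq_nonneg _)
    refine pow_le_pow_left₀ (h.nonneg j) (h.antitone ?_) 2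
    have : (i : ℕ) ≤ K := Nat.lt_succ_iff.1 i.2
    exact Fin.le_def.2 (by simpa [ι] using this.trans hj)
  exact le_of_mul_le_mul_right (hge.trans hle) hpos

/-- Corresponding rows of `M` and `W` have the same component orthogonal to `S`. What `W` carries
inside `S` is at most `b` for each vector of an orthonormal basis of `S`. -/
theorem frobSq_sub_le_of_sub_mem {M W : Matrix (Fin n) (Fin p) ℝ} {b : ℝ}
    (hW : ∀ y, (W *ᵥ y) ⬝ᵥ (W *ᵥ y) ≤ b * (y ⬝ᵥ y))
    (S : Submodule ℝ (EuclideanSpace ℝ (Fin p)))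
    (hS : ∀ i, (WithLp.toLp 2 (M i - W i) : EuclideanSpace ℝ (Fin p)) ∈ S) :
    frobSq W - Module.finrank ℝ S * b ≤ frobSq M := by
  let f := stdOrthonormalBasis ℝ S
  have hproj : ∀ w : EuclideanSpace ℝ (Fin p),
      ‖S.starProjection w‖ ^ 2 = ∑ k, (w.ofLp ⬝ᵥ (f k : EuclideanSpace ℝ (Fin p)).ofLp) ^ 2 := by
    intro w
    rw [Submodule.starProjection_apply, ← Submodule.coe_norm, ← f.sum_sq_norm_inner_right]
    refine Finset.sum_congr rfl fun k _ => ?_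
    rw [Submodule.coe_inner, ← Submodule.starProjection_apply,
      ← Submodule.inner_starProjection_left_eq_right,
      Submodule.starProjection_eq_self_iff.2 (f k).2,
      EuclideanSpace.inner_eq_star_dotProduct, Real.norm_eq_abs, sq_abs]
    simp
  have hrow : ∀ i, W i ⬝ᵥ W i
      - ∑ k, (W i ⬝ᵥ (f k : EuclideanSpace ℝ (Fin p)).ofLp) ^ 2 ≤ M i ⬝ᵥ M i := by
    intro i
    have h1 := Submodule.norm_sq_eq_add_norm_sq_starProjection (WithLp.toLp 2 (W i)) S
    have h2 := Submodule.norm_sq_eq_add_norm_sq_starProjection (WithLp.toLp 2 (M i)) S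
    have h3 : Sᗮ.starProjection (WithLp.toLp 2 (M i)) = Sᗮ.starProjection (WithLp.toLp 2 (W i)) := by
      rw [← sub_eq_zero, ← map_sub]
      exact Submodule.starProjection_orthogonal_apply_eq_zero (hS i)
    rw [norm_toLp_sq, hproj] at h1
    rw [norm_toLp_sq, h3] at h2
    have := sq_nonneg ‖S.starProjection (WithLp.toLp 2 (M i))‖
    linarith
  have hsum : ∑ i, ∑ k, (W i ⬝ᵥ (f k : EuclideanSpace ℝ (Fin p)).ofLp) ^ 2
      ≤ Module.finrank ℝ S * b := by
    rw [Finset.sum_comm]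
    calc _ ≤ ∑ _k : Fin (Module.finrank ℝ S), b := by
          refine Finset.sum_le_sum fun k _ => ?_
          have h1 := hW (f k : EuclideanSpace ℝ (Fin p)).ofLp
          have h2 : ‖(f k : EuclideanSpace ℝ (Fin p))‖ = 1 := f.orthonormal.1 k
          rw [← norm_sq_eq_ofLp (f k : EuclideanSpace ℝ (Fin p)), h2] at h1
          simp only [one_pow, mul_one] at h1
          refine le_trans (le_of_eq ?_) h1
          rw [dotProduct]
          exact Finset.sum_congr rfl fun i _ => pow_two _
      _ = _ := by simp
  have := Finset.sum_le_sum fun i (_ : i ∈ Finset.univ) => hrow i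
  rw [Finset.sum_sub_distrib] at this
  rw [frobSq_eq_sum_row, frobSq_eq_sum_row]
  linarith

end SVD

theorem sum_subtype_lt {N : ℕ} (k : ℕ) (f : Fin N → ℝ) :
    ∑ j : {j : Fin N // (j : ℕ) < k}, f j = ∑ j : Fin N, if (j : ℕ) < k then f j else 0 := by
  rw [← Finset.sum_filter]
  exact (Finset.sum_subtype _ (by simp) f).symm

section SVD

variable {n p : ℕ} {x : Matrix (Fin n) (Fin p) ℝ} {σ : Fin (min n p) → ℝ}
  {u : Matrix (Fin n) (Fin (min n p)) ℝ} {v : Matrix (Fin p) (Fin (min n p)) ℝ}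

/-- The rows of the residual and of `W` differ by elements of the span of the `K` columns of `A` and
at most `K` right singular vectors, a space of dimension at most `2 K`. -/
theorem IsSVD.frobSq_sub_truncSVD_ge (h : IsSVD x σ u v) {K : ℕ} {A : Matrix (Fin p) (Fin K) ℝ}
    {Z : Matrix (Fin n) (Fin K) ℝ} {W : Matrix (Fin n) (Fin p) ℝ} (hx : x = Z * Aᵀ + W) {b : ℝ}
    (hb : 0 ≤ b) (hW : ∀ y, (W *ᵥ y) ⬝ᵥ (W *ᵥ y) ≤ b * (y ⬝ᵥ y)) :
    frobSq W - 2 * K * b ≤ ∑ j : Fin (min n p), if (j : ℕ) < K then 0 else σ j ^ 2 := by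
  rw [← h.frobSq_sub_truncSVD]
  let w : Fin K ⊕ {j : Fin (min n p) // (j : ℕ) < K} → EuclideanSpace ℝ (Fin p) :=
    Sum.elim (fun k => WithLp.toLp 2 (A.col k)) (fun j => WithLp.toLp 2 (v.col j.1))
  let S := Submodule.span ℝ (Set.range w)
  have hcard : Fintype.card {j : Fin (min n p) // (j : ℕ) < K} ≤ K := by
    simpa using Fintype.card_le_of_injective
      (fun j : {j : Fin (min n p) // (j : ℕ) < K} => (⟨j.1.1, j.2⟩ : Fin K))
      (fun i j hij => Subtype.ext (Fin.ext (by simpa using hij)))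
  have hfin : (Module.finrank ℝ S : ℝ) ≤ 2 * K := by
    have h1 := finrank_range_le_card (R := ℝ) w
    rw [Fintype.card_sum, Fintype.card_fin] at h1
    have h2 : Module.finrank ℝ S ≤ 2 * K := by
      refine h1.trans ?_
      omega
    exact_mod_cast h2
  have hmem : ∀ i, (WithLp.toLp 2 ((x - truncSVD σ u v K) i - W i) : EuclideanSpace ℝ (Fin p))
      ∈ S := by
    intro i
    have e : (WithLp.toLp 2 ((x - truncSVD σ u v K) i - W i) : EuclideanSpace ℝ (Fin p))
        = ∑ k, Z i k • w (Sum.inl k) - ∑ j : {j : Fin (min n p) // (j : ℕ) < K},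
          (u i j.1 * σ j.1) • w (Sum.inr j) := by
      ext l
      have e1 : truncSVD σ u v K i l = ∑ j : {j : Fin (min n p) // (j : ℕ) < K},
          (u i j.1 * σ j.1) * v l j.1 := by
        rw [truncSVD, Matrix.mul_apply]
        simp only [Matrix.mul_diagonal, Matrix.transpose_apply]
        rw [sum_subtype_lt K fun j => u i j * σ j * v l j]
        refine Finset.sum_congr rfl fun j _ => ?_
        split_ifs <;> simp
      have e2 : x i l = ∑ k, Z i k * A l k + W i l := by
        rw [hx]
        simp [Matrix.mul_apply]
      simp only [Matrix.sub_apply, Pi.sub_apply, e1, e2, w, Sum.elim_inl, Sum.elim_inr,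
        PiLp.sub_apply, PiLp.smul_apply, WithLp.ofLp_sum, Finset.sum_apply, smul_eq_mul, Matrix.col_apply]
      ring
    rw [e]
    refine Submodule.sub_mem _ (Submodule.sum_mem _ fun k _ => Submodule.smul_mem _ _ ?_)
      (Submodule.sum_mem _ fun k _ => Submodule.smul_mem _ _ ?_) <;>
    exact Submodule.subset_span ⟨_, rfl⟩
  have := frobSq_sub_le_of_sub_mem hW S hmem
  have := mul_le_mul_of_nonneg_right hfin hb
  linarith

end SVD

/-! ### The selected number of components -/

section Selection

variable {N : ℕ} (σ : Fin N → ℝ)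

/-- The sum of the squared singular values beyond the `k`-th. -/
def tailSum (k : ℕ) : ℝ := ∑ j : Fin N, if (j : ℕ) < k then 0 else σ j ^ 2

theorem tailSum_anti {k l : ℕ} (hkl : k ≤ l) : tailSum σ l ≤ tailSum σ k := by
  refine Finset.sum_le_sum fun j _ => ?_
  split_ifs with h1 h2 h2
  · exact le_rfl
  · positivity
  · omega
  · exact le_rfl

theorem tailSum_succ {k : ℕ} (hk : k < N) :
    tailSum σ k = tailSum σ (k + 1) + σ ⟨k, hk⟩ ^ 2 := by
  have : σ ⟨k, hk⟩ ^ 2 = ∑ j : Fin N, if j = ⟨k, hk⟩ then σ j ^ 2 else 0 := by simp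
  rw [this, tailSum, tailSum, ← Finset.sum_add_distrib]
  refine Finset.sum_congr rfl fun j _ => ?_
  have : j = ⟨k, hk⟩ ↔ (j : ℕ) = k := Fin.ext_iff
  simp only [this]
  split_ifs <;> first | omega | simp

theorem tailSum_le_add {b : ℝ} {K : ℕ} (hb : ∀ j : Fin N, K ≤ j → σ j ^ 2 ≤ b) (m : ℕ)
    (hm : K + m ≤ N) : tailSum σ K ≤ tailSum σ (K + m) + m * b := by
  induction m with
  | zero => simp
  | succ m ih =>
    have h1 := ih (by omega)
    have h2 := tailSum_succ σ (k := K + m) (by omega)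
    have h3 := hb ⟨K + m, by omega⟩ (by simp)
    push_cast
    rw [← add_assoc]
    linarith

theorem tailSum_le {b : ℝ} {K : ℕ} (hb0 : 0 ≤ b) (hb : ∀ j : Fin N, K ≤ j → σ j ^ 2 ≤ b) :
    tailSum σ K ≤ N * b := by
  calc tailSum σ K ≤ ∑ _j : Fin N, b := by
        refine Finset.sum_le_sum fun j _ => ?_
        split_ifs with h
        · exact hb0
        · exact hb j (by omega)
    _ = N * b := by simp

variable {σ}

/-- Each conclusion is one comparison of the ratio `tailSum σ k / (T - μ k)`, in which an extra
component pays off only if its squared singular value exceeds `μ` times the current ratio. Here `T`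
stands for `np`, and `hbf` says that the noise level `b` is below `μ` times the ratio `f / T`. -/
theorem selection_bounds (hσ0 : ∀ j, 0 ≤ σ j) (hσ : Antitone σ) {K Kb s : ℕ} (hK : K ≤ Kb)
    (hKb : Kb ≤ N) (hs : s ≤ Kb) {T μ b f κ : ℝ} (hT : 0 < T) (hμ : 0 < μ) (hκ : 0 < 1 + κ)
    (hd : ∀ k ≤ Kb, T / (1 + κ) ≤ T - μ * k)
    (hmin : ∀ k ≤ Kb, tailSum σ s / (T - μ * s) ≤ tailSum σ k / (T - μ * k)) (hb0 : 0 ≤ b)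
    (hb : ∀ j : Fin N, K ≤ j → σ j ^ 2 ≤ b) (hf : f ≤ tailSum σ K) (hbf : b * T < μ * f) :
    s ≤ K ∧ (∀ j : Fin N, (j : ℕ) < s → μ * f / T ≤ σ j ^ 2) ∧
      ∀ j : Fin N, s ≤ (j : ℕ) → σ j ^ 2 ≤ b + μ * ((1 + κ) * (N * b)) / T := by
  have hdpos : ∀ k ≤ Kb, 0 < T - μ * k := fun k hk => lt_of_lt_of_le (by positivity) (hd k hk)
  have hmin' : ∀ k ≤ Kb, tailSum σ s * (T - μ * k) ≤ tailSum σ k * (T - μ * s) := fun k hk =>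
    (div_le_div_iff₀ (hdpos s hs) (hdpos k hk)).1 (hmin k hk)
  have hds := hdpos s hs
  have hdT : T - μ * s ≤ T := by
    have : 0 ≤ μ * s := by positivity
    linarith
  -- Going from `K` to `K + r` removes at most `r b` from the tail. Minimality at `K + r` would then
  -- force `μ tailSum σ K ≤ b T`, against `hbf`.
  have hsK : s ≤ K := by
    by_contra hcon
    push Not at hcon
    obtain ⟨m, rfl⟩ := Nat.exists_eq_add_of_lt hcon
    rw [add_assoc] at *
    set r := m + 1 with hr
    have hr0 : (0 : ℝ) < r := by positivity
    have h1 := hmin' K hK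
    have h2 := tailSum_le_add σ hb r (hs.trans hKb)
    push_cast [show ((K + r : ℕ) : ℝ) = K + r by push_cast; ring] at *
    set F := tailSum σ (K + r)
    have h3 : F * μ * r ≤ r * b * (T - μ * (K + r)) := by
      have := mul_le_mul_of_nonneg_right h2 hds.le
      nlinarith
    have h4 : F * μ ≤ b * (T - μ * (K + r)) := by
      refine le_of_mul_le_mul_right ?_ hr0
      linarith
    have h5 : μ * tailSum σ K ≤ b * T := by
      have h6 := mul_le_mul_of_nonneg_left h2 hμ.le
      have h7 : 0 ≤ b * (μ * K) := by positivity
      nlinarith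
    have h8 := mul_le_mul_of_nonneg_left hf hμ.le
    linarith
  refine ⟨hsK, fun j hj => ?_, fun j hj => ?_⟩
  -- Comparison with `s - 1`: the last retained value, at the zero-based index `t`, must justify its
  -- penalty.
  · obtain ⟨t, rfl⟩ : ∃ t, s = t + 1 := ⟨s - 1, by omega⟩
    have htN : t < N := by omega
    have h1 := hmin' t (by omega)
    have h2 := tailSum_succ σ htN
    have h3 : σ ⟨t, htN⟩ ^ 2 ≤ σ j ^ 2 :=
      pow_le_pow_left₀ (hσ0 _) (hσ (Fin.le_def.2 (by simp; omega))) 2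
    have h4 := hf.trans (tailSum_anti σ hsK)
    rw [h2] at h1
    push_cast at *
    set F := tailSum σ (t + 1)
    have h5 : μ * F ≤ σ ⟨t, htN⟩ ^ 2 * (T - μ * (t + 1)) := by nlinarith
    have h6 : σ ⟨t, htN⟩ ^ 2 * (T - μ * (t + 1)) ≤ σ j ^ 2 * T :=
      mul_le_mul h3 hdT hds.le (sq_nonneg _)
    rw [div_le_iff₀ hT]
    exact ((mul_le_mul_of_nonneg_left h4 hμ.le).trans h5).trans h6
  · have hN0 : 0 ≤ μ * ((1 + κ) * (N * b)) / T := by positivity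
    -- For `s = K` the bound `b` applies directly. Otherwise comparison with `s + 1` bounds the
    -- first discarded value by `μ` times the minimal ratio, which is at most the ratio at `K`.
    rcases hsK.eq_or_lt with rfl | hlt
    · linarith [hb j hj]
    · have hsN : s < N := by omega
      have h1 := hmin' (s + 1) (by omega)
      have h2 := tailSum_succ σ hsN
      have h3 : σ j ^ 2 ≤ σ ⟨s, hsN⟩ ^ 2 :=
        pow_le_pow_left₀ (hσ0 _) (hσ (Fin.le_def.2 hj)) 2
      have h4 : σ ⟨s, hsN⟩ ^ 2 * (T - μ * s) ≤ μ * tailSum σ s := by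
        push_cast at h1
        nlinarith
      have h5 : σ ⟨s, hsN⟩ ^ 2 ≤ μ * (tailSum σ s / (T - μ * s)) := by
        rw [← mul_div_assoc, le_div_iff₀ hds]
        exact h4
      have h6 : tailSum σ s / (T - μ * s) ≤ (1 + κ) * (N * b) / T := by
        refine (hmin K hK).trans ?_
        rw [div_le_div_iff₀ (hdpos K hK) hT]
        have h7 := hd K hK
        rw [div_le_iff₀ hκ] at h7
        have h8 := tailSum_le σ hb0 hb
        have h9 : 0 ≤ N * b := by positivity
        calc tailSum σ K * T ≤ (N * b) * ((T - μ * K) * (1 + κ)) :=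
              mul_le_mul h8 h7 hT.le h9
          _ = _ := by ring
      have h7 := mul_le_mul_of_nonneg_left h6 hμ.le
      rw [mul_div_assoc]
      linarith

end Selection

/-! ### The fitted coefficients -/

theorem IsMoorePenrose.unique {m k : Type*} [Fintype m] [Fintype k] {M : Matrix m k ℝ}
    {N N' : Matrix k m ℝ} (h : IsMoorePenrose M N) (h' : IsMoorePenrose M N') : N = N' := by
  have e1 : M * N = M * N' := by
    calc M * N = (M * N)ᵀ := h.symm_left.symm
      _ = (M * N' * (M * N))ᵀ := by rw [← Matrix.mul_assoc, h'.mul_mul_left]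
      _ = M * N * (M * N') := by rw [Matrix.transpose_mul, h.symm_left, h'.symm_left]
      _ = M * N' := by rw [← Matrix.mul_assoc, h.mul_mul_left]
  have e2 : N * M = N' * M := by
    calc N * M = (N * M)ᵀ := h.symm_right.symm
      _ = (N * M * (N' * M))ᵀ := by
        rw [Matrix.mul_assoc N, ← Matrix.mul_assoc M, h'.mul_mul_left]
      _ = N' * M * (N * M) := by rw [Matrix.transpose_mul, h.symm_right, h'.symm_right]
      _ = N' * M := by rw [Matrix.mul_assoc, ← Matrix.mul_assoc M, h.mul_mul_left]
  calc N = N * M * N := h.mul_mul_right.symm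
    _ = N' * (M * N) := by rw [e2, Matrix.mul_assoc]
    _ = N' := by rw [e1, ← Matrix.mul_assoc, h'.mul_mul_right]

/-- Zero columns are allowed: `0⁻¹ = 0` is what the pseudo-inverse requires there. -/
theorem pinv_eq_of_orthogonal_columns {m k : Type*} [Fintype m] [Fintype k] [DecidableEq k]
    (M : Matrix m k ℝ) (d : k → ℝ) (hG : Mᵀ * M = Matrix.diagonal d) :
    pinv M = Matrix.diagonal (fun j => (d j)⁻¹) * Mᵀ := by
  refine (isMoorePenrose_pinv M).unique ⟨?_, ?_, ?_, ?_⟩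
  · rw [Matrix.mul_assoc, Matrix.mul_assoc, hG, Matrix.diagonal_mul_diagonal]
    ext i j
    rw [Matrix.mul_diagonal]
    by_cases hj : d j = 0
    · have h1 : ∑ i, M i j * M i j = 0 := by
        have := congrFun (congrFun hG j) j
        rw [Matrix.diagonal_apply_eq, hj, Matrix.mul_apply] at this
        exact this
      have h2 := (Finset.sum_eq_zero_iff_of_nonneg fun i _ => mul_self_nonneg (M i j)).1 h1 i
        (Finset.mem_univ i)
      rw [mul_self_eq_zero.1 h2, zero_mul]
    · rw [inv_mul_cancel₀ hj, mul_one]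
  · rw [Matrix.mul_assoc _ Mᵀ, hG, Matrix.diagonal_mul_diagonal, ← Matrix.mul_assoc,
      Matrix.diagonal_mul_diagonal]
    congr 2
    funext j
    by_cases hj : d j = 0
    · simp [hj]
    · field_simp
  · rw [Matrix.transpose_mul, Matrix.transpose_mul, Matrix.transpose_transpose,
      Matrix.diagonal_transpose, Matrix.mul_assoc]
  · rw [Matrix.mul_assoc, hG, Matrix.diagonal_mul_diagonal, Matrix.diagonal_transpose]

/-- The coefficient vector in terms of the data and the right singular vectors only. -/
def coeffVec {n p r : ℕ} (x : Matrix (Fin n) (Fin p) ℝ) (v : Matrix (Fin p) (Fin r) ℝ)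
    (k : ℕ) (y : Fin n → ℝ) : Fin p → ℝ :=
  ∑ j : Fin r, (if (j : ℕ) < k then
    ((x *ᵥ v.col j) ⬝ᵥ (x *ᵥ v.col j))⁻¹ * ((x *ᵥ v.col j) ⬝ᵥ y) else 0) • v.col j

/-- The columns of `x U_k` are `σ_j u_j`, hence orthogonal, and the pseudo-inverse is explicit even
if some `σ_j` vanish. -/
theorem IsSVD.coeff_topVectors {n p : ℕ} {x : Matrix (Fin n) (Fin p) ℝ} {σ : Fin (min n p) → ℝ}
    {u : Matrix (Fin n) (Fin (min n p)) ℝ} {v : Matrix (Fin p) (Fin (min n p)) ℝ}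
    (h : IsSVD x σ u v) (k : ℕ) (y : Fin n → ℝ) :
    coeff (topVectors v k) x y = coeffVec x v k y := by
  set B := topVectors v k with hB
  set d : {j : Fin (min n p) // (j : ℕ) < k} → ℝ :=
    fun j => (x *ᵥ v.col j.1) ⬝ᵥ (x *ᵥ v.col j.1) with hd
  have hcol : ∀ j : {j : Fin (min n p) // (j : ℕ) < k}, (x * B)ᵀ j = x *ᵥ v.col j.1 := by
    intro j
    funext i
    rfl
  have hG : (x * B)ᵀ * (x * B) = Matrix.diagonal d := by
    ext i j
    have e : ((x * B)ᵀ * (x * B)) i j = (x *ᵥ v.col i.1) ⬝ᵥ (x *ᵥ v.col j.1) := by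
      rw [← hcol, ← hcol]
      rfl
    rw [e, Matrix.diagonal_apply]
    split_ifs with hij
    · rw [hij]
    · rw [h.mulVec_col, h.mulVec_col, smul_dotProduct, dotProduct_smul,
        col_dotProduct_col h.left_orthonormal, if_neg (fun hh => hij (Subtype.ext hh))]
      simp
  rw [coeff, pinv_eq_of_orthogonal_columns _ d hG, coeffVec]
  funext l
  rw [Finset.sum_apply]
  have e : ∀ j : Fin (min n p), ((if (j : ℕ) < k then
      ((x *ᵥ v.col j) ⬝ᵥ (x *ᵥ v.col j))⁻¹ * ((x *ᵥ v.col j) ⬝ᵥ y) else 0) • v.col j) l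
      = if (j : ℕ) < k then ((x *ᵥ v.col j) ⬝ᵥ (x *ᵥ v.col j))⁻¹ * ((x *ᵥ v.col j) ⬝ᵥ y)
        * v l j else 0 := by
    intro j
    split_ifs <;> simp
  simp_rw [e]
  rw [← sum_subtype_lt k fun j => ((x *ᵥ v.col j) ⬝ᵥ (x *ᵥ v.col j))⁻¹ * ((x *ᵥ v.col j) ⬝ᵥ y)
    * v l j]
  rw [Matrix.mulVec, dotProduct]
  refine Finset.sum_congr rfl fun j _ => ?_
  rw [← Matrix.mulVec_mulVec, Matrix.mulVec_diagonal, mul_comm]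
  rfl

/-- In the singular bases everything is diagonal. For a retained index, `α` has coordinate `⟨v_j, b⟩
- σ_j⁻¹⟨u_j, w⟩ + σ_j⁻¹⟨u_j, ε⟩`, and `x (b - α)` has `⟨u_j, w⟩ - ⟨u_j, ε⟩`. For a discarded one
these are `0` and `σ_j ⟨v_j, b⟩`. So `lo` matters only for the size of `α` and `hi` only for the
fit; Bessel sums the coordinates. -/
theorem IsSVD.coeffVec_bounds {n p : ℕ} {x : Matrix (Fin n) (Fin p) ℝ} {σ : Fin (min n p) → ℝ}
    {u : Matrix (Fin n) (Fin (min n p)) ℝ} {v : Matrix (Fin p) (Fin (min n p)) ℝ}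
    (h : IsSVD x σ u v) {s : ℕ} {lo hi : ℝ} (hlo0 : 0 < lo)
    (hlo : ∀ j : Fin (min n p), (j : ℕ) < s → lo ≤ σ j ^ 2) (hhi0 : 0 ≤ hi)
    (hhi : ∀ j : Fin (min n p), s ≤ (j : ℕ) → σ j ^ 2 ≤ hi) (b : Fin p → ℝ) (w ε : Fin n → ℝ) {E : ℝ}
    (hE : ∑ j : Fin (min n p), (if (j : ℕ) < s then (u.col j ⬝ᵥ ε) ^ 2 else 0) ≤ E)
    {α : Fin p → ℝ} (hα : α = coeffVec x v s (x *ᵥ b - w + ε)) :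
    α ⬝ᵥ α ≤ 3 * (b ⬝ᵥ b + lo⁻¹ * (w ⬝ᵥ w) + lo⁻¹ * E) ∧
      (x *ᵥ (b - α)) ⬝ᵥ (x *ᵥ (b - α)) ≤ hi * (b ⬝ᵥ b) + 2 * (w ⬝ᵥ w) + 2 * E := by
  set Y := x *ᵥ b - w + ε with hY
  set c : Fin (min n p) → ℝ := fun j => if (j : ℕ) < s then (σ j)⁻¹ * (u.col j ⬝ᵥ Y) else 0 with hc
  have hσne : ∀ j : Fin (min n p), (j : ℕ) < s → σ j ≠ 0 := by
    intro j hj h0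
    have := hlo j hj
    rw [h0] at this
    norm_num at this
    linarith
  have hαc : α = ∑ j, c j • v.col j := by
    rw [hα, coeffVec]
    refine Finset.sum_congr rfl fun j _ => ?_
    congr 1
    simp only [hc]
    split_ifs with hj
    · have := hσne j hj
      rw [h.mulVec_col, smul_dotProduct, smul_dotProduct, dotProduct_smul,
        col_dotProduct_col h.left_orthonormal, if_pos rfl]
      simp only [smul_eq_mul]
      field_simp
    · rfl
  have hux : ∀ j, u.col j ⬝ᵥ (x *ᵥ b) = σ j * (v.col j ⬝ᵥ b) := by
    intro j
    rw [h.mulVec, dotProduct_sum, Finset.sum_eq_single j]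
    · rw [dotProduct_smul, col_dotProduct_col h.left_orthonormal, if_pos rfl]
      simp
    · intro i _ hij
      rw [dotProduct_smul, col_dotProduct_col h.left_orthonormal, if_neg hij.symm]
      simp
    · simp
  have huY : ∀ j, u.col j ⬝ᵥ Y = σ j * (v.col j ⬝ᵥ b) - u.col j ⬝ᵥ w + u.col j ⬝ᵥ ε := by
    intro j
    rw [hY, dotProduct_add, dotProduct_sub, hux]
  have hvα : ∀ j, v.col j ⬝ᵥ α = c j := by
    intro j
    rw [hαc, dotProduct_sum, Finset.sum_eq_single j]
    · rw [dotProduct_smul, col_dotProduct_col h.right_orthonormal, if_pos rfl]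
      simp
    · intro i _ hij
      rw [dotProduct_smul, col_dotProduct_col h.right_orthonormal, if_neg hij.symm]
      simp
    · simp
  have hbv := sum_col_dotProduct_sq_le h.right_orthonormal b
  have hwu := sum_col_dotProduct_sq_le h.left_orthonormal w
  refine ⟨?_, ?_⟩
  · have h1 : α ⬝ᵥ α = ∑ j, c j ^ 2 := by
      rw [hαc]
      exact sum_smul_col_sq h.right_orthonormal c
    have h2 : ∀ j, c j ^ 2 ≤ 3 * ((v.col j ⬝ᵥ b) ^ 2 + lo⁻¹ * (u.col j ⬝ᵥ w) ^ 2
        + lo⁻¹ * (if (j : ℕ) < s then (u.col j ⬝ᵥ ε) ^ 2 else 0)) := by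
      intro j
      by_cases hj : (j : ℕ) < s
      · have hne := hσne j hj
        have hinv : ((σ j)⁻¹) ^ 2 ≤ lo⁻¹ := by
          rw [inv_pow]
          exact inv_anti₀ hlo0 (hlo j hj)
        have e : c j = v.col j ⬝ᵥ b - (σ j)⁻¹ * (u.col j ⬝ᵥ w) + (σ j)⁻¹ * (u.col j ⬝ᵥ ε) := by
          simp only [hc, if_pos hj, huY]
          field_simp
        rw [e, if_pos hj]
        set A1 := v.col j ⬝ᵥ b
        set A2 := (σ j)⁻¹ * (u.col j ⬝ᵥ w) with hA2
        set A3 := (σ j)⁻¹ * (u.col j ⬝ᵥ ε) with hA3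
        have g1 : A2 ^ 2 ≤ lo⁻¹ * (u.col j ⬝ᵥ w) ^ 2 := by
          rw [hA2, mul_pow]
          gcongr
        have g2 : A3 ^ 2 ≤ lo⁻¹ * (u.col j ⬝ᵥ ε) ^ 2 := by
          rw [hA3, mul_pow]
          gcongr
        nlinarith [sq_nonneg (A1 + A2), sq_nonneg (A1 - A3), sq_nonneg (A2 + A3)]
      · simp only [hc, if_neg hj]
        norm_num
        positivity
    rw [h1]
    refine (Finset.sum_le_sum fun j _ => h2 j).trans ?_
    rw [← Finset.mul_sum, Finset.sum_add_distrib, Finset.sum_add_distrib, ← Finset.mul_sum,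
      ← Finset.mul_sum]
    gcongr
  · have h1 : x *ᵥ (b - α) = ∑ j : Fin (min n p), (if (j : ℕ) < s then u.col j ⬝ᵥ w - u.col j ⬝ᵥ ε
        else σ j * (v.col j ⬝ᵥ b)) • u.col j := by
      rw [h.mulVec]
      refine Finset.sum_congr rfl fun j _ => ?_
      congr 1
      rw [dotProduct_sub, hvα]
      simp only [hc]
      split_ifs with hj
      · have hne := hσne j hj
        rw [huY]
        field_simp
        ring
      · ring
    rw [h1, sum_smul_col_sq h.left_orthonormal]
    have h2 : ∀ j : Fin (min n p), (if (j : ℕ) < s then u.col j ⬝ᵥ w - u.col j ⬝ᵥ ε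
        else σ j * (v.col j ⬝ᵥ b)) ^ 2 ≤ hi * (v.col j ⬝ᵥ b) ^ 2 + 2 * (u.col j ⬝ᵥ w) ^ 2
        + 2 * (if (j : ℕ) < s then (u.col j ⬝ᵥ ε) ^ 2 else 0) := by
      intro j
      split_ifs with hj
      · have : 0 ≤ hi * (v.col j ⬝ᵥ b) ^ 2 := by positivity
        nlinarith [sq_nonneg (u.col j ⬝ᵥ w + u.col j ⬝ᵥ ε)]
      · rw [mul_pow]
        have := mul_le_mul_of_nonneg_right (hhi j (by omega)) (sq_nonneg (v.col j ⬝ᵥ b))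
        nlinarith [sq_nonneg (u.col j ⬝ᵥ w)]
    refine (Finset.sum_le_sum fun j _ => h2 j).trans ?_
    rw [Finset.sum_add_distrib, Finset.sum_add_distrib, ← Finset.mul_sum, ← Finset.mul_sum,
      ← Finset.mul_sum]
    gcongr

/-! ### The risk -/

/-- The cross term vanishes as soon as one factor is centred, so the lemma can be nested to treat
three independent summands. -/
theorem integral_add_sq_prod {E F : Type*} [MeasurableSpace E] [MeasurableSpace F]
    (μ : Measure E) (ν : Measure F) [IsProbabilityMeasure μ] [IsProbabilityMeasure ν]
    {f : E → ℝ} {g : F → ℝ} (hf : Integrable f μ) (hf2 : Integrable (fun x => f x ^ 2) μ)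
    (hg : Integrable g ν) (hg2 : Integrable (fun y => g y ^ 2) ν) (h0 : ∫ x, f x ∂μ = 0) :
    Integrable (fun z : E × F => (f z.1 + g z.2) ^ 2) (μ.prod ν) ∧
      ∫ z, (f z.1 + g z.2) ^ 2 ∂μ.prod ν = ∫ x, f x ^ 2 ∂μ + ∫ y, g y ^ 2 ∂ν := by
  have e : ∀ z : E × F, (f z.1 + g z.2) ^ 2
      = f z.1 ^ 2 * (fun _ : F => (1 : ℝ)) z.2 + 2 * (f z.1 * g z.2)
        + (fun _ : E => (1 : ℝ)) z.1 * g z.2 ^ 2 := by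
    intro z
    ring
  have i1 : Integrable (fun z : E × F => f z.1 ^ 2 * (fun _ : F => (1 : ℝ)) z.2) (μ.prod ν) :=
    hf2.mul_prod (integrable_const 1)
  have i2 : Integrable (fun z : E × F => 2 * (f z.1 * g z.2)) (μ.prod ν) :=
    (hf.mul_prod hg).const_mul 2
  have i3 : Integrable (fun z : E × F => (fun _ : E => (1 : ℝ)) z.1 * g z.2 ^ 2) (μ.prod ν) :=
    (integrable_const (1 : ℝ)).mul_prod hg2
  simp_rw [e]
  refine ⟨(i1.add i2).add i3, ?_⟩
  have i12 : Integrable (fun z : E × F => f z.1 ^ 2 * (fun _ : F => (1 : ℝ)) z.2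
    + 2 * (f z.1 * g z.2)) (μ.prod ν) := i1.add i2
  rw [integral_add i12 i3, integral_add i1 i2, integral_const_mul, integral_prod_mul, h0,
    integral_prod_mul (fun x => f x ^ 2) (fun _ => (1 : ℝ)),
    integral_prod_mul (fun _ => (1 : ℝ)) (fun y => g y ^ 2)]
  simp

theorem integrable_add_prod {E F : Type*} [MeasurableSpace E] [MeasurableSpace F]
    (μ : Measure E) (ν : Measure F) [IsProbabilityMeasure μ] [IsProbabilityMeasure ν]
    {f : E → ℝ} {g : F → ℝ} (hf : Integrable f μ) (hg : Integrable g ν) :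
    Integrable (fun z : E × F => f z.1 + g z.2) (μ.prod ν) := by
  have e : ∀ z : E × F, f z.1 + g z.2
      = f z.1 * (fun _ : F => (1 : ℝ)) z.2 + (fun _ : E => (1 : ℝ)) z.1 * g z.2 := by
    intro z
    ring
  simp_rw [e]
  exact (hf.mul_prod (integrable_const 1)).add ((integrable_const (1 : ℝ)).mul_prod hg)

theorem HasMoments.integrable_dotProduct {d : ℕ} {π : Measure (Fin d → ℝ)} [IsProbabilityMeasure π]
    {S : Matrix (Fin d) (Fin d) ℝ} (h : HasMoments π S) (v : Fin d → ℝ) :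
    Integrable (fun x : Fin d → ℝ => x ⬝ᵥ v) π :=
  integrable_finsetSum _ fun i _ => ((h.memLp i).integrable (by norm_num)).mul_const _

theorem HasMoments.integral_dotProduct {d : ℕ} {π : Measure (Fin d → ℝ)} [IsProbabilityMeasure π]
    {S : Matrix (Fin d) (Fin d) ℝ} (h : HasMoments π S) (v : Fin d → ℝ) :
    ∫ x, x ⬝ᵥ v ∂π = 0 := by
  simp only [dotProduct]
  rw [integral_finsetSum _ fun i _ => ((h.memLp i).integrable (by norm_num)).mul_const _]
  simp [integral_mul_const, h.mean]

/-- The prediction error is `⟨Z, β - Aᵀα⟩ - ⟨W, α⟩ + ε`, a sum of independent centred variables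
whose second moments add. -/
theorem IsFRM.risk_eq {p K : ℕ} {θ : Param p K} {πZ : Measure (Fin K → ℝ)}
    {πW : Measure (Fin p → ℝ)} {πε : Measure ℝ} {ν : Measure ((Fin p → ℝ) × ℝ)}
    (h : IsFRM θ πZ πW πε ν) (α : Fin p → ℝ) :
    risk ν α - θ.sigmaSq = (θ.β - θ.Aᵀ *ᵥ α) ⬝ᵥ (θ.SigmaZ *ᵥ (θ.β - θ.Aᵀ *ᵥ α))
      + α ⬝ᵥ (θ.SigmaW *ᵥ α) := by
  have := h.probZ
  have := h.probW
  have := h.probε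
  have hmap : Measurable (fun q : (Fin K → ℝ) × (Fin p → ℝ) × ℝ =>
      (θ.A *ᵥ q.1 + q.2.1, q.1 ⬝ᵥ θ.β + q.2.2)) := by
    refine Measurable.prodMk (measurable_pi_iff.2 fun i => ?_) ?_
    · simp only [Matrix.mulVec, dotProduct, Pi.add_apply]
      fun_prop
    · simp only [dotProduct]
      fun_prop
  have hmeas : Measurable fun q : (Fin p → ℝ) × ℝ => (q.2 - q.1 ⬝ᵥ α) ^ 2 := by
    simp only [dotProduct]
    fun_prop
  rw [risk, h.law, integral_map hmap.aemeasurable hmeas.aestronglyMeasurable]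
  have e : ∀ q : (Fin K → ℝ) × (Fin p → ℝ) × ℝ,
      (q.1 ⬝ᵥ θ.β + q.2.2 - (θ.A *ᵥ q.1 + q.2.1) ⬝ᵥ α) ^ 2
      = (q.1 ⬝ᵥ (θ.β - θ.Aᵀ *ᵥ α) + (q.2.1 ⬝ᵥ (-α) + q.2.2)) ^ 2 := by
    intro q
    congr 1
    rw [add_dotProduct, dotProduct_sub, dotProduct_neg, Matrix.mulVec_transpose,
      dotProduct_comm (θ.A *ᵥ q.1), Matrix.dotProduct_mulVec, dotProduct_comm (α ᵥ* θ.A)]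
    ring
  simp_rw [e]
  have hε1 : Integrable (fun e : ℝ => e) πε := h.memLpε.integrable (by norm_num)
  have hε2 : Integrable (fun e : ℝ => e ^ 2) πε := h.memLpε.integrable_sq
  have hin := integral_add_sq_prod πW πε (h.momentsW.integrable_dotProduct (-α))
    (h.momentsW.integrable_sq (-α)) hε1 hε2 (h.momentsW.integral_dotProduct (-α))
  have hout := integral_add_sq_prod πZ (πW.prod πε)
    (h.momentsZ.integrable_dotProduct (θ.β - θ.Aᵀ *ᵥ α))
    (h.momentsZ.integrable_sq _)
    (integrable_add_prod πW πε (h.momentsW.integrable_dotProduct (-α)) hε1) hin.1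
    (h.momentsZ.integral_dotProduct _)
  rw [hout.2, hin.2, h.momentsZ.integral_sq, h.momentsW.integral_sq, h.varε, Matrix.mulVec_neg,
    neg_dotProduct_neg]
  ring

/-- The minimum norm solution `b` of `Aᵀ b = β`. -/
theorem exists_preimage_of_rank {p K : ℕ} (A : Matrix (Fin p) (Fin K) ℝ) (hA : A.rank = K)
    (β : Fin K → ℝ) :
    ∃ b : Fin p → ℝ, Aᵀ *ᵥ b = β ∧ b ⬝ᵥ b = β ⬝ᵥ ((Aᵀ * A)⁻¹ *ᵥ β) := by
  have hG : IsUnit (Aᵀ * A) := by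
    have h1 : (Aᵀ * A).rank = K := by rw [Matrix.rank_transpose_mul_self, hA]
    rw [← Matrix.mulVec_surjective_iff_isUnit]
    have hr : (Aᵀ * A).mulVecLin.range = ⊤ :=
      Submodule.eq_top_of_finrank_eq (by simpa [Matrix.rank] using h1)
    exact LinearMap.range_eq_top.1 hr
  have hdet : IsUnit (Aᵀ * A).det := (Matrix.isUnit_iff_isUnit_det _).1 hG
  set y := (Aᵀ * A)⁻¹ *ᵥ β with hy
  have hAy : Aᵀ *ᵥ (A *ᵥ y) = β := by
    rw [Matrix.mulVec_mulVec, hy, Matrix.mulVec_mulVec, Matrix.mul_nonsing_inv _ hdet,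
      Matrix.one_mulVec]
  refine ⟨A *ᵥ y, hAy, ?_⟩
  rw [Matrix.dotProduct_mulVec, ← Matrix.mulVec_transpose, hAy]

-- Deterministic bounds on the good event

/-- The bound on `Z` turns the population error of `Aᵀ (b - α)` into the in-sample quantity `x (b -
α) - W (b - α)`. The lower threshold for retained values is the noise level `B` itself, so `B⁻¹ |W
b|² ≤ |b|²` and no spectral information on the signal is needed. -/
theorem excess_risk_le {n p K : ℕ} (hn : 0 < n) {x W : Matrix (Fin n) (Fin p) ℝ}
    {σ : Fin (min n p) → ℝ} {u : Matrix (Fin n) (Fin (min n p)) ℝ}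
    {v : Matrix (Fin p) (Fin (min n p)) ℝ} (h : IsSVD x σ u v)
    {A : Matrix (Fin p) (Fin K) ℝ} {Z : Matrix (Fin n) (Fin K) ℝ} {R : Matrix (Fin K) (Fin K) ℝ}
    (hx : x = Z * R * Aᵀ + W) {SigmaW : Matrix (Fin p) (Fin p) ℝ} {SigmaZ : Matrix (Fin K) (Fin K) ℝ}
    (hR : ∀ c, (R *ᵥ c) ⬝ᵥ (R *ᵥ c) = c ⬝ᵥ (SigmaZ *ᵥ c))
    (hZ : ∀ c : Fin K → ℝ, n / 32 * (c ⬝ᵥ c) ≤ (Z *ᵥ c) ⬝ᵥ (Z *ᵥ c)) {B : ℝ} (hB : 0 < B)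
    (hW : ∀ y, (W *ᵥ y) ⬝ᵥ (W *ᵥ y) ≤ B * (y ⬝ᵥ y)) {β : Fin K → ℝ} {b : Fin p → ℝ}
    (hb : Aᵀ *ᵥ b = β) {ε : Fin n → ℝ} {s : ℕ} {h₀ : ℝ} (hh₀ : 0 ≤ h₀)
    (hlo : ∀ j : Fin (min n p), (j : ℕ) < s → B ≤ σ j ^ 2)
    (hhi : ∀ j : Fin (min n p), s ≤ (j : ℕ) → σ j ^ 2 ≤ h₀ * B) {E : ℝ}
    (hE : ∑ j : Fin (min n p), (if (j : ℕ) < s then (u.col j ⬝ᵥ ε) ^ 2 else 0) ≤ E)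
    {α : Fin p → ℝ} (hα : α = coeffVec x v s ((Z * R) *ᵥ β + ε)) :
    (β - Aᵀ *ᵥ α) ⬝ᵥ (SigmaZ *ᵥ (β - Aᵀ *ᵥ α)) + α ⬝ᵥ (SigmaW *ᵥ α)
      ≤ 64 / n * ((h₀ + 16) * (B * (b ⬝ᵥ b)) + 8 * E)
        + opNorm SigmaW * (6 * (b ⬝ᵥ b) + 3 * (B⁻¹ * E)) := by
  have hn' : (0 : ℝ) < n := by exact_mod_cast hn
  have hY : (Z * R) *ᵥ β + ε = x *ᵥ b - W *ᵥ b + ε := by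
    rw [hx, Matrix.add_mulVec, add_sub_cancel_right, ← Matrix.mulVec_mulVec _ (Z * R), hb]
  rw [hY] at hα
  obtain ⟨h1, h2⟩ := h.coeffVec_bounds hB hlo (by positivity) hhi b (W *ᵥ b) ε hE hα
  have hbb := dotProduct_self_nonneg' b
  have hWb := hW b
  have hQ : α ⬝ᵥ α ≤ 6 * (b ⬝ᵥ b) + 3 * (B⁻¹ * E) := by
    have : B⁻¹ * ((W *ᵥ b) ⬝ᵥ (W *ᵥ b)) ≤ b ⬝ᵥ b := by
      rw [inv_mul_le_iff₀ hB]
      exact hWb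
    linarith
  have hX : (x *ᵥ (b - α)) ⬝ᵥ (x *ᵥ (b - α)) ≤ (h₀ + 2) * (B * (b ⬝ᵥ b)) + 2 * E := by
    linarith
  have hBE : B * (B⁻¹ * E) = E := by rw [mul_inv_cancel_left₀ hB.ne']
  -- From `|b - α|² ≤ 2 |b|² + 2 |α|²` and `hQ`: `14 = 2 + 2 · 6` and `6 = 2 · 3`.
  have hWα : (W *ᵥ (b - α)) ⬝ᵥ (W *ᵥ (b - α)) ≤ 14 * (B * (b ⬝ᵥ b)) + 6 * E := by
    have g1 := hW (b - α)
    have g2 := mul_le_mul_of_nonneg_left ((sub_dotProduct_self_le b α).trans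
      (add_le_add_right (mul_le_mul_of_nonneg_left hQ zero_le_two) _)) hB.le
    nlinarith
  have hβ : β - Aᵀ *ᵥ α = Aᵀ *ᵥ (b - α) := by rw [Matrix.mulVec_sub, hb]
  have hZc := hZ (R *ᵥ (Aᵀ *ᵥ (b - α)))
  have e : Z *ᵥ (R *ᵥ (Aᵀ *ᵥ (b - α))) = x *ᵥ (b - α) - W *ᵥ (b - α) := by
    rw [hx, Matrix.add_mulVec, add_sub_cancel_right]
    simp only [Matrix.mulVec_mulVec, Matrix.mul_assoc]
  rw [e, hR] at hZc
  have g := sub_dotProduct_self_le (x *ᵥ (b - α)) (W *ᵥ (b - α))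
  rw [hβ]
  refine add_le_add ?_ ?_
  · rw [div_mul_eq_mul_div, le_div_iff₀ hn']
    linarith
  · exact (quadratic_le_opNorm SigmaW α).trans
      (mul_le_mul_of_nonneg_left hQ (opNorm_nonneg _))

/-- The noise level `n ‖Σ‖ + tr Σ` and `(n + p) tr Σ / p` are of the same order. -/
theorem noise_level_le {n p : ℕ} (hn : 0 < n) (hp : 0 < p) {l t c' : ℝ} (hc' : 0 < c') (ht : 0 ≤ t)
    (hl : 0 ≤ l) (h : c' * (min n p : ℕ) * l ≤ t) :
    (n * l + t) * p ≤ (1 + 1 / c') * ((n + p) * t) := by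
  have hn' : (0 : ℝ) < n := by exact_mod_cast hn
  have hp' : (0 : ℝ) < p := by exact_mod_cast hp
  have h1 : (n : ℝ) * p ≤ (min n p : ℕ) * (n + p) := by
    rcases le_total n p with hnp | hnp
    · rw [min_eq_left hnp]
      nlinarith
    · rw [min_eq_right hnp]
      nlinarith
  have h2 : (n : ℝ) * l * p ≤ 1 / c' * ((n + p) * t) := by
    rw [div_mul_eq_mul_div, le_div_iff₀ hc']
    calc (n : ℝ) * l * p * c' = (n * p) * (l * c') := by ring
      _ ≤ ((min n p : ℕ) * (n + p)) * (l * c') := by gcongr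
      _ = (n + p) * (c' * (min n p : ℕ) * l) := by ring
      _ ≤ (n + p) * t * 1 := by nlinarith
      _ = 1 * ((n + p) * t) := by ring
  have h3 : t * p ≤ (n + p) * t := by nlinarith
  linarith

/-- The threshold on `c₀` and the effective rank condition together give `B p ≤ μ_n t / 8`, since
`48 · 8 < 400`. This one inequality keeps the rank correction to the residual energy small and
separates noise from penalty. -/
theorem selector_bounds {n p K s : ℕ} (hn : 0 < n) (hp : 0 < p) {x W : Matrix (Fin n) (Fin p) ℝ}
    {σ : Fin (min n p) → ℝ} {u : Matrix (Fin n) (Fin (min n p)) ℝ}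
    {v : Matrix (Fin p) (Fin (min n p)) ℝ} (h : IsSVD x σ u v)
    {A : Matrix (Fin p) (Fin K) ℝ} {Z : Matrix (Fin n) (Fin K) ℝ} (hx : x = Z * Aᵀ + W)
    {g κ c₀ c' l t B : ℝ} (hg : 0 < g) (hκ : 1 < κ) (hc' : 0 < c')
    (hc₀ : 400 * g * (1 + 1 / c') ≤ c₀) (ht : 0 < t) (hl : 0 ≤ l)
    (hre : c' * (min n p : ℕ) * l ≤ t) (hBdef : B = 48 * g * (n * l + t))
    (hW : ∀ y, (W *ᵥ y) ⬝ᵥ (W *ᵥ y) ≤ B * (y ⬝ᵥ y)) (hF : n * t / 2 ≤ frobSq W)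
    (hK : K ≤ Kbar κ c₀ n p) (hs : s ≤ Kbar κ c₀ n p)
    (hmin : ∀ k ≤ Kbar κ c₀ n p, vSq c₀ x σ u v s ≤ vSq c₀ x σ u v k) :
    s ≤ K ∧ (∀ j : Fin (min n p), (j : ℕ) < s → B ≤ σ j ^ 2) ∧
      ∀ j : Fin (min n p), s ≤ (j : ℕ) → σ j ^ 2 ≤ (1 + 2 * c₀ * (1 + κ)) * B := by
  have hn' : (0 : ℝ) < n := by exact_mod_cast hn
  have hp' : (0 : ℝ) < p := by exact_mod_cast hp
  have hC' : 0 < 1 + 1 / c' := by positivity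
  have hc₀0 : 0 < c₀ := lt_of_lt_of_le (by positivity) hc₀
  have hB : 0 < B := by rw [hBdef]; positivity
  set μ := muN c₀ n p with hμdef
  have hμ : 0 < μ := by rw [hμdef, muN]; positivity
  have hT : (0 : ℝ) < n * p := by positivity
  have hBp : B * p ≤ 48 * g * ((1 + 1 / c') * ((n + p) * t)) := by
    rw [hBdef, mul_assoc]
    exact mul_le_mul_of_nonneg_left (noise_level_le hn hp hc' ht.le hl hre) (by positivity)
  have hnpt : 0 < (n + p) * t := by positivity
  have hgc : 400 * (g * ((1 + 1 / c') * ((n + p) * t))) ≤ μ * t := by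
    have := mul_le_mul_of_nonneg_right hc₀ hnpt.le
    rw [hμdef, muN]
    linarith
  have hgpos : 0 < g * ((1 + 1 / c') * ((n + p) * t)) := by positivity
  have hkk : ∀ k ≤ Kbar κ c₀ n p, μ * k ≤ κ / (1 + κ) * (n * p) := by
    intro k hk
    have h1 : k ≤ ⌊κ / (1 + κ) * ((n : ℝ) * p / muN c₀ n p)⌋₊ := hk.trans (min_le_left _ _)
    have h2 : (k : ℝ) ≤ κ / (1 + κ) * ((n : ℝ) * p / μ) :=
      (Nat.le_floor_iff (by positivity)).1 h1
    calc μ * k ≤ μ * (κ / (1 + κ) * ((n : ℝ) * p / μ)) := by gcongr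
      _ = κ / (1 + κ) * (n * p) := by field_simp
  have hκ1 : κ / (1 + κ) ≤ 1 := by
    rw [div_le_one (by linarith)]
    linarith
  -- The floor in `Kbar` keeps every denominator of the criterion above the fraction `1 / (1 + κ)`
  -- of `np`.
  have hd : ∀ k ≤ Kbar κ c₀ n p, (n * p : ℝ) / (1 + κ) ≤ n * p - μ * k := by
    intro k hk
    have h1 := hkk k hk
    have h2 : (n * p : ℝ) / (1 + κ) = n * p - κ / (1 + κ) * (n * p) := by
      have : 1 + κ ≠ 0 := by linarith
      field_simp
      ring
    linarith
  -- With `μ K ≤ np` and `B p ≤ μ t / 8` the correction `2 K B` takes at most half of `n t / 2`.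
  have hF' : (n : ℝ) * t / 4 ≤ tailSum σ K := by
    have h1 := h.frobSq_sub_truncSVD_ge hx hB.le hW
    have h2 : μ * K ≤ n * p := (hkk K hK).trans (mul_le_of_le_one_left hT.le hκ1)
    have h3 : K * B * (μ * p) ≤ n * t / 8 * (μ * p) := by
      calc K * B * (μ * p) = (μ * K) * (B * p) := by ring
        _ ≤ (n * p) * (48 * (g * ((1 + 1 / c') * ((n + p) * t)))) := by
            refine mul_le_mul h2 (by linarith) (by positivity) hT.le
        _ ≤ (n * p) * (μ * t / 8) := by
            gcongr
            linarith
        _ = _ := by ring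
    have h4 : K * B ≤ n * t / 8 := le_of_mul_le_mul_right h3 (by positivity)
    change _ ≤ tailSum σ K at h1
    linarith
  have hbf : B * (n * p) < μ * (n * t / 4) := by
    have h1 : B * p < μ * t / 4 := by linarith
    calc B * (n * p) = n * (B * p) := by ring
      _ < n * (μ * t / 4) := by gcongr
      _ = _ := by ring
  have hmin' : ∀ k ≤ Kbar κ c₀ n p, tailSum σ s / (n * p - μ * s) ≤ tailSum σ k / (n * p - μ * k) := by
    intro k hk
    have := hmin k hk
    rw [vSq, vSq, h.frobSq_sub_truncSVD, h.frobSq_sub_truncSVD] at this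
    exact this
  obtain ⟨h1, h2, h3⟩ := selection_bounds h.nonneg h.antitone hK (min_le_right _ _) hs hT hμ
    (by linarith) hd hmin' hB.le (fun j hj => h.sq_le_of_rank_le hx hW j hj) hF' hbf
  refine ⟨h1, fun j hj => le_trans ?_ (h2 j hj), fun j hj => (h3 j hj).trans ?_⟩
  · rw [le_div_iff₀ hT]
    exact hbf.le
  · have hN : ((n : ℝ) + p) * (min n p : ℕ) ≤ 2 * (n * p) := by
      rcases le_total n p with hnp | hnp
      · have : (n : ℝ) ≤ p := by exact_mod_cast hnp
        rw [min_eq_left hnp]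
        nlinarith
      · have : (p : ℝ) ≤ n := by exact_mod_cast hnp
        rw [min_eq_right hnp]
        nlinarith
    have h4 : μ * ((1 + κ) * ((min n p : ℕ) * B)) / (n * p) ≤ 2 * c₀ * (1 + κ) * B := by
      rw [div_le_iff₀ hT]
      have hpos : 0 ≤ c₀ * (1 + κ) * B := by
        have : 0 < 1 + κ := by linarith
        positivity
      calc μ * ((1 + κ) * ((min n p : ℕ) * B))
          = (c₀ * (1 + κ) * B) * (((n : ℝ) + p) * (min n p : ℕ)) := by
            rw [hμdef, muN]
            ring
        _ ≤ (c₀ * (1 + κ) * B) * (2 * (n * p)) := by gcongr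
        _ = _ := by ring
    linarith

/-! ### The law of the sample -/

/-- Regroups a sample of triples into three independent samples, so that conditioning on factors and
design noise becomes Fubini. -/
theorem pi_map_prod_eq {E F G H : Type*} [MeasurableSpace E] [MeasurableSpace F]
    [MeasurableSpace G] [MeasurableSpace H] (μ₁ : Measure E) (μ₂ : Measure F) (μ₃ : Measure G)
    [IsProbabilityMeasure μ₁] [IsProbabilityMeasure μ₂] [IsProbabilityMeasure μ₃]
    {f : E × F × G → H} (hf : Measurable f) (n : ℕ) :
    (Measure.pi fun _ : Fin n => (μ₁.prod (μ₂.prod μ₃)).map f)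
      = ((Measure.pi fun _ : Fin n => μ₁).prod
          ((Measure.pi fun _ : Fin n => μ₂).prod (Measure.pi fun _ : Fin n => μ₃))).map
          (fun ω i => f (ω.1 i, ω.2.1 i, ω.2.2 i)) := by
  have : IsProbabilityMeasure ((μ₁.prod (μ₂.prod μ₃)).map f) :=
    Measure.isProbabilityMeasure_map hf.aemeasurable
  rw [← Measure.pi_map_pi (μ := fun _ : Fin n => μ₁.prod (μ₂.prod μ₃)) (f := fun _ => f)
    (fun _ => hf.aemeasurable)]
  have h1 := measurePreserving_arrowProdEquivProdArrow E (F × G) (Fin n)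
    (fun _ => μ₁) (fun _ => μ₂.prod μ₃)
  have h2 := measurePreserving_arrowProdEquivProdArrow F G (Fin n) (fun _ => μ₂) (fun _ => μ₃)
  have h3 := ((MeasurePreserving.id (Measure.pi fun _ : Fin n => μ₁)).prod h2).comp h1
  rw [← h3.map_eq, Measure.map_map (by fun_prop) h3.measurable]
  rfl

theorem measure_prod_le_of_forall {E F : Type*} [MeasurableSpace E] [MeasurableSpace F]
    (μ : Measure E) (ν : Measure F) [IsProbabilityMeasure μ] [SFinite ν] {S : Set (E × F)}
    (hS : MeasurableSet S) {c : ℝ≥0∞} (h : ∀ a, ν (Prod.mk a ⁻¹' S) ≤ c) : μ.prod ν S ≤ c := by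
  rw [Measure.prod_apply hS]
  exact (lintegral_mono h).trans (by simp)

/-! ### The regression noise -/

/-- The energy of `e` along the first `k` left singular vectors, in terms of the right ones. -/
def noiseEnergy {n p r : ℕ} (x : Matrix (Fin n) (Fin p) ℝ) (v : Matrix (Fin p) (Fin r) ℝ) (k : ℕ)
    (e : Fin n → ℝ) : ℝ :=
  ∑ j : Fin r, if (j : ℕ) < k then
    ((x *ᵥ v.col j) ⬝ᵥ (x *ᵥ v.col j))⁻¹ * ((x *ᵥ v.col j) ⬝ᵥ e) ^ 2 else 0

theorem measurable_mulVec_col {Ω : Type*} [MeasurableSpace Ω] {n p r : ℕ}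
    {x : Ω → Fin n → Fin p → ℝ} (hx : Measurable x) {v : Ω → Matrix (Fin p) (Fin r) ℝ}
    (hv : ∀ i j, Measurable fun ω => v ω i j) (j : Fin r) :
    Measurable fun ω => Matrix.of (x ω) *ᵥ (v ω).col j := by
  refine measurable_pi_iff.2 fun i => ?_
  simp only [Matrix.mulVec, dotProduct, Matrix.of_apply, Matrix.col_apply]
  refine Finset.measurable_sum _ fun l _ => Measurable.mul ?_ (hv l j)
  exact (measurable_pi_apply l).comp ((measurable_pi_apply i).comp hx)

theorem measurable_noiseEnergy {Ω : Type*} [MeasurableSpace Ω] {n p r : ℕ}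
    {x : Ω → Fin n → Fin p → ℝ} (hx : Measurable x) {v : Ω → Matrix (Fin p) (Fin r) ℝ}
    (hv : ∀ i j, Measurable fun ω => v ω i j) {k : Ω → ℕ} (hk : Measurable k)
    {e : Ω → Fin n → ℝ} (he : Measurable e) :
    Measurable fun ω => noiseEnergy (Matrix.of (x ω)) (v ω) (k ω) (e ω) := by
  refine Finset.measurable_sum _ fun j _ => Measurable.ite
    (measurableSet_lt measurable_const hk) ?_ measurable_const
  have hm := measurable_mulVec_col hx hv j
  exact (measurable_dotProduct hm hm).inv.mul ((measurable_dotProduct hm he).pow_const 2)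

theorem measurable_coeffVec {Ω : Type*} [MeasurableSpace Ω] {n p r : ℕ}
    {x : Ω → Fin n → Fin p → ℝ} (hx : Measurable x) {v : Ω → Matrix (Fin p) (Fin r) ℝ}
    (hv : ∀ i j, Measurable fun ω => v ω i j) {k : Ω → ℕ} (hk : Measurable k)
    {y : Ω → Fin n → ℝ} (hy : Measurable y) :
    Measurable fun ω => coeffVec (Matrix.of (x ω)) (v ω) (k ω) (y ω) := by
  refine measurable_pi_iff.2 fun i => ?_
  simp only [coeffVec, Finset.sum_apply, Pi.smul_apply, smul_eq_mul, Matrix.col_apply]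
  refine Finset.measurable_sum _ fun j _ => Measurable.mul (Measurable.ite
    (measurableSet_lt measurable_const hk) ?_ measurable_const) (hv i j)
  have hm := measurable_mulVec_col hx hv j
  exact (measurable_dotProduct hm hm).inv.mul (measurable_dotProduct hm hy)

theorem vecSubG_pi {n : ℕ} {π : Measure ℝ} [IsProbabilityMeasure π] {g : ℝ}
    (hg : 0 ≤ g) (h : HasSubgaussianMGF (fun e : ℝ => e) (Real.toNNReal g) π) :
    VecSubG g (fun e : Fin n → ℝ => e) (Measure.pi fun _ => π) := by
  intro v
  have e : ∀ w : Fin n → ℝ, ENNReal.ofReal (Real.exp (w ⬝ᵥ v))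
      = ∏ i, ENNReal.ofReal (Real.exp (v i * w i)) := by
    intro w
    rw [← ENNReal.ofReal_prod_of_nonneg (fun _ _ => (Real.exp_pos _).le), ← Real.exp_sum,
      dotProduct]
    simp_rw [mul_comm]
  simp_rw [e]
  rw [lintegral_pi_prod (fun _ => π) (fun i x => ENNReal.ofReal (Real.exp (v i * x)))
    (fun i => by fun_prop)]
  have h1 : ∀ i, ∫⁻ x, ENNReal.ofReal (Real.exp (v i * x)) ∂π
      ≤ ENNReal.ofReal (Real.exp (g * (v i * v i) / 2)) := by
    intro i
    rw [← ofReal_integral_eq_lintegral_ofReal (h.integrable_exp_mul (v i))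
      (ae_of_all _ fun _ => (Real.exp_pos _).le)]
    refine ENNReal.ofReal_le_ofReal ((h.mgf_le (v i)).trans ?_)
    rw [Real.coe_toNNReal _ hg, pow_two]
  refine (Finset.prod_le_prod' fun i _ => h1 i).trans (le_of_eq ?_)
  rw [← ENNReal.ofReal_prod_of_nonneg (fun _ _ => (Real.exp_pos _).le), ← Real.exp_sum, dotProduct,
    Finset.mul_sum, Finset.sum_div]

/-- A vanishing `σ j` makes the left term zero through `0⁻¹ = 0`, so in general only an inequality
holds. It suffices for the tail bound; equality is recovered on the good event, where retained
values are positive. -/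
theorem IsSVD.noiseEnergy_le {n p : ℕ} {x : Matrix (Fin n) (Fin p) ℝ} {σ : Fin (min n p) → ℝ}
    {u : Matrix (Fin n) (Fin (min n p)) ℝ} {v : Matrix (Fin p) (Fin (min n p)) ℝ}
    (h : IsSVD x σ u v) (k : ℕ) (e : Fin n → ℝ) :
    noiseEnergy x v k e
      ≤ ∑ j : Fin (min n p), if (j : ℕ) < k then (u.col j ⬝ᵥ e) ^ 2 else 0 := by
  refine Finset.sum_le_sum fun j _ => ?_
  split_ifs
  · rw [h.mulVec_col, smul_dotProduct, smul_dotProduct, dotProduct_smul,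
      col_dotProduct_col h.left_orthonormal, if_pos rfl]
    simp only [smul_eq_mul, mul_one, mul_pow]
    by_cases h0 : σ j = 0
    · simp [h0]
      positivity
    · refine le_of_eq ?_
      field_simp
  · exact le_rfl

theorem IsSVD.sum_col_sq_eq_noiseEnergy {n p : ℕ} {x : Matrix (Fin n) (Fin p) ℝ}
    {σ : Fin (min n p) → ℝ}
    {u : Matrix (Fin n) (Fin (min n p)) ℝ} {v : Matrix (Fin p) (Fin (min n p)) ℝ}
    (h : IsSVD x σ u v) {k : ℕ} (hk : ∀ j : Fin (min n p), (j : ℕ) < k → σ j ≠ 0) (e : Fin n → ℝ) :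
    (∑ j : Fin (min n p), if (j : ℕ) < k then (u.col j ⬝ᵥ e) ^ 2 else 0) = noiseEnergy x v k e := by
  refine Finset.sum_congr rfl fun j _ => ?_
  split_ifs with hj
  · have := hk j hj
    rw [h.mulVec_col, smul_dotProduct, smul_dotProduct, dotProduct_smul,
      col_dotProduct_col h.left_orthonormal, if_pos rfl]
    simp only [smul_eq_mul, mul_one, mul_pow]
    field_simp
  · rfl

/-- For a fixed design the left singular vectors are deterministic and orthonormal, so this is a
quadratic form of rank at most `K` in the noise. -/
theorem measure_pi_noiseEnergy_le {n p : ℕ} {x : Matrix (Fin n) (Fin p) ℝ}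
    {σ : Fin (min n p) → ℝ}
    {u : Matrix (Fin n) (Fin (min n p)) ℝ} {v : Matrix (Fin p) (Fin (min n p)) ℝ}
    (h : IsSVD x σ u v) {π : Measure ℝ} [IsProbabilityMeasure π] {g : ℝ}
    (hg : 0 ≤ g) (hπ : HasSubgaussianMGF (fun e : ℝ => e) (Real.toNNReal g) π) {k K : ℕ}
    (hkK : k ≤ K) (τ : ℝ) :
    (Measure.pi fun _ : Fin n => π) {e | 4 * g * (K + τ) < noiseEnergy x v k e}
      ≤ ENNReal.ofReal (Real.exp (-τ)) := by
  -- The general tail bound needs a positive proxy. Proxy zero means that the noise vanishes almost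
  -- surely.
  rcases hg.eq_or_lt with rfl | hg0
  · rw [Real.toNNReal_zero] at hπ
    have h0 : ∀ᵐ e ∂(Measure.pi fun _ : Fin n => π), ∀ i, e i = 0 := by
      rw [ae_all_iff]
      intro i
      have := (Measure.quasiMeasurePreserving_eval (fun _ : Fin n => π) i).ae
        hπ.ae_eq_zero_of_hasSubgaussianMGF_zero
      exact this
    have : (Measure.pi fun _ : Fin n => π) {e | 4 * 0 * (K + τ) < noiseEnergy x v k e} = 0 := by
      refine measure_mono_null (fun e he => ?_) (ae_iff.1 h0)
      intro hz
      have hz' : e = 0 := funext hz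
      have he' : 4 * 0 * (K + τ) < noiseEnergy x v k e := he
      rw [hz'] at he'
      simp [noiseEnergy] at he'
    rw [this]
    exact zero_le
  · set b : Fin (min n p) → Fin n → ℝ := fun j => if (j : ℕ) < k then u.col j else 0 with hb
    have hcc := col_dotProduct_col h.left_orthonormal
    have hbb : ∀ j, b j ⬝ᵥ b j = if (j : ℕ) < k then 1 else 0 := by
      intro j
      simp only [hb]
      split_ifs
      · rw [hcc, if_pos rfl]
      · simp
    have hsum : ∑ j, b j ⬝ᵥ b j ≤ K := by
      simp_rw [hbb]
      rw [← sum_subtype_lt k fun _ => 1]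
      simp only [Finset.sum_const, nsmul_eq_mul, mul_one, Finset.card_univ]
      have hcard : Fintype.card {j : Fin (min n p) // (j : ℕ) < k} ≤ k := by
        simpa using Fintype.card_le_of_injective
          (fun j : {j : Fin (min n p) // (j : ℕ) < k} => (⟨j.1.1, j.2⟩ : Fin k))
          (fun i j hij => Subtype.ext (Fin.ext (by simpa using hij)))
      exact_mod_cast hcard.trans hkK
    have hT := (vecSubG_pi (n := n) hg hπ).measure_sum_sq_ge_le measurable_id hg0 b
      (fun i j hij => by
        simp only [hb]
        split_ifs <;> simp [hcc, hij]) one_pos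
      (fun j => by
        rw [hbb]
        split_ifs <;> norm_num) τ
    refine (measure_mono fun e he => ?_).trans hT
    have he' : 4 * g * (K + τ) < noiseEnergy x v k e := he
    change 2 * g * ∑ i, b i ⬝ᵥ b i + 4 * g * 1 * τ ≤ ∑ i, (e ⬝ᵥ b i) ^ 2
    have h1 : ∑ i, (e ⬝ᵥ b i) ^ 2
        = ∑ j : Fin (min n p), if (j : ℕ) < k then (u.col j ⬝ᵥ e) ^ 2 else 0 := by
      refine Finset.sum_congr rfl fun j _ => ?_
      simp only [hb]
      split_ifs
      · rw [dotProduct_comm]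
      · simp
    have h2 := h.noiseEnergy_le k e
    have h3 : 2 * g * ∑ i, b i ⬝ᵥ b i ≤ 2 * g * K := by gcongr
    have h4 : 0 ≤ g * K := by positivity
    rw [h1]
    linarith

/-! ### The risk bound with high probability -/

/-- The constant of the risk bound. -/
def riskConst (γw γε c₀ κ cδ : ℝ) : ℝ :=
  (64 * 48 * γw ^ 2 * (1 + 2 * c₀ * (1 + κ) + 16) + 6) / cδ
    + 4 * γε ^ 2 * (512 + 1 / (16 * γw ^ 2))

/-- `B / n` is `l + t / n` up to a constant, and `l / B ≤ 1 / (48 γw² n)`, so the noise energy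
entering through `Σ_W` is also of order `E / n`. -/
theorem riskConst_bound {n : ℕ} (hn : 0 < n) {γw γε c₀ κ cδ l t bb q : ℝ} (hγw : 0 < γw)
    (hγε : 0 < γε) (hc₀ : 0 < c₀) (hκ : 1 < κ) (hcδ : 0 < cδ) (hl : 0 ≤ l) (ht : 0 < t)
    (hbb : 0 ≤ bb) (hq : 0 ≤ q) {B E : ℝ} (hB : B = 48 * γw ^ 2 * (n * l + t))
    (hE : E = 4 * γε ^ 2 * (n * q)) :
    64 / n * ((1 + 2 * c₀ * (1 + κ) + 16) * (B * bb) + 8 * E) + l * (6 * bb + 3 * (B⁻¹ * E))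
      ≤ riskConst γw γε c₀ κ cδ * (q + cδ * (l + t / n) * bb) := by
  have hn' : (0 : ℝ) < n := by exact_mod_cast hn
  have hB0 : 0 < B := by rw [hB]; positivity
  set h₀ := 1 + 2 * c₀ * (1 + κ) + 16 with hh₀
  have hh₀0 : 0 < h₀ := by
    have : 0 < 1 + κ := by linarith
    positivity
  set δ := l + t / n with hδ
  have hδ0 : 0 ≤ δ := by positivity
  have hlδ : l ≤ δ := by
    have : 0 ≤ t / n := by positivity
    linarith
  have e1 : B = 48 * γw ^ 2 * (n * δ) := by
    rw [hB, hδ]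
    field_simp
  have e2 : 64 / n * (h₀ * (B * bb) + 8 * E)
      = 64 * 48 * γw ^ 2 * h₀ * (δ * bb) + 512 * (4 * γε ^ 2 * q) := by
    rw [e1, hE]
    field_simp
    ring
  have e3 : l * (3 * (B⁻¹ * E)) ≤ 1 / (16 * γw ^ 2) * (4 * γε ^ 2 * q) := by
    have g1 : l * (48 * γw ^ 2 * n) ≤ B := by
      rw [e1]
      have := mul_le_mul_of_nonneg_left hlδ (by positivity : 0 ≤ 48 * γw ^ 2 * n)
      linarith
    have g2 : l * B⁻¹ ≤ 1 / (48 * γw ^ 2 * n) := by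
      rw [← div_eq_mul_inv, div_le_div_iff₀ hB0 (by positivity)]
      linarith
    have hE0 : 0 ≤ E := by rw [hE]; positivity
    calc l * (3 * (B⁻¹ * E)) = (l * B⁻¹) * (3 * E) := by ring
      _ ≤ 1 / (48 * γw ^ 2 * n) * (3 * E) := by gcongr
      _ = _ := by
        rw [hE]
        field_simp
        ring
  have e4 : l * (6 * bb) ≤ 6 * (δ * bb) := by
    have := mul_le_mul_of_nonneg_right hlδ hbb
    linarith
  set M₁ := 64 * 48 * γw ^ 2 * h₀ + 6 with hM₁
  set M₂ := 4 * γε ^ 2 * (512 + 1 / (16 * γw ^ 2)) with hM₂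
  have hM₁0 : 0 ≤ M₁ := by positivity
  have hM₂0 : 0 ≤ M₂ := by positivity
  -- A single constant serves both terms of the bound; the surplus cross terms are non-negative.
  have e5 : riskConst γw γε c₀ κ cδ * (q + cδ * δ * bb)
      = M₁ * (δ * bb) + M₂ * q + (M₁ / cδ * q + M₂ * (cδ * δ * bb)) := by
    have : riskConst γw γε c₀ κ cδ = M₁ / cδ + M₂ := rfl
    rw [this]
    field_simp
    ring
  have e6 : 0 ≤ M₁ / cδ * q + M₂ * (cδ * δ * bb) := by positivity
  rw [e5, e2, mul_add]
  have e7 : M₂ * q = 512 * (4 * γε ^ 2 * q) + 1 / (16 * γw ^ 2) * (4 * γε ^ 2 * q) := by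
    rw [hM₂]
    ring
  have e8 : M₁ * (δ * bb) = 64 * 48 * γw ^ 2 * h₀ * (δ * bb) + 6 * (δ * bb) := by
    rw [hM₁]
    ring
  linarith

/-- The design matrix, as a function of the whitened factors and the whitened noise. -/
def design {n p K : ℕ} (θ : Param p K) (z : Fin n → Fin K → ℝ) (w : Fin n → Fin p → ℝ) :
    Fin n → Fin p → ℝ :=
  fun i => θ.A *ᵥ (psdSqrt θ.SigmaZ *ᵥ z i) + psdSqrt θ.SigmaW *ᵥ w i

/-- The response, as a function of the whitened factors and the regression noise. -/
def response {n p K : ℕ} (θ : Param p K) (z : Fin n → Fin K → ℝ) (e : Fin n → ℝ) : Fin n → ℝ :=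
  fun i => (psdSqrt θ.SigmaZ *ᵥ z i) ⬝ᵥ θ.β + e i

theorem of_design {n p K : ℕ} (θ : Param p K) (z : Fin n → Fin K → ℝ) (w : Fin n → Fin p → ℝ) :
    Matrix.of (design θ z w)
      = Matrix.of z * psdSqrt θ.SigmaZ * θ.Aᵀ + Matrix.of w * psdSqrt θ.SigmaW := by
  funext i
  have h1 : (Matrix.of z * psdSqrt θ.SigmaZ * θ.Aᵀ) i
      = θ.A *ᵥ (psdSqrt θ.SigmaZ *ᵥ z i) := by
    rw [Matrix.mul_apply_eq_vecMul, Matrix.vecMul_transpose, Matrix.mul_apply_eq_vecMul,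
      ← Matrix.mulVec_transpose, psdSqrt_transpose]
    rfl
  have h2 : (Matrix.of w * psdSqrt θ.SigmaW) i = psdSqrt θ.SigmaW *ᵥ w i := by
    rw [Matrix.mul_apply_eq_vecMul, ← Matrix.mulVec_transpose, psdSqrt_transpose]
    rfl
  change design θ z w i = (Matrix.of z * psdSqrt θ.SigmaZ * θ.Aᵀ) i
    + (Matrix.of w * psdSqrt θ.SigmaW) i
  rw [h1, h2]
  rfl

theorem response_eq {n p K : ℕ} (θ : Param p K) (z : Fin n → Fin K → ℝ) (e : Fin n → ℝ) :
    response θ z e = (Matrix.of z * psdSqrt θ.SigmaZ) *ᵥ θ.β + e := by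
  funext i
  have h2 : (Matrix.of z * psdSqrt θ.SigmaZ) i = psdSqrt θ.SigmaZ *ᵥ z i := by
    rw [Matrix.mul_apply_eq_vecMul, ← Matrix.mulVec_transpose, psdSqrt_transpose]
    rfl
  change _ = (Matrix.of z * psdSqrt θ.SigmaZ) i ⬝ᵥ θ.β + e i
  rw [h2]
  rfl

theorem measurable_mulVec {Ω : Type*} [MeasurableSpace Ω] {m d : ℕ} (A : Matrix (Fin m) (Fin d) ℝ)
    {f : Ω → Fin d → ℝ} (hf : Measurable f) : Measurable fun ω => A *ᵥ f ω :=
  measurable_pi_iff.2 fun _ => measurable_dotProduct measurable_const hf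

theorem measurable_design {n p K : ℕ} (θ : Param p K) :
    Measurable fun ω : (Fin n → Fin K → ℝ) × (Fin n → Fin p → ℝ) × (Fin n → ℝ) =>
      design θ ω.1 ω.2.1 := by
  refine measurable_pi_iff.2 fun i => ?_
  exact (measurable_mulVec _ (measurable_mulVec _
    ((measurable_pi_apply i).comp measurable_fst))).add
    (measurable_mulVec _ ((measurable_pi_apply i).comp (measurable_fst.comp measurable_snd)))

/-- The excess risk `𝔼 (Y_* - X_*ᵀ α)² - σ²` in the factor regression model. -/
def excessRisk {p K : ℕ} (θ : Param p K) (α : Fin p → ℝ) : ℝ :=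
  (θ.β - θ.Aᵀ *ᵥ α) ⬝ᵥ (θ.SigmaZ *ᵥ (θ.β - θ.Aᵀ *ᵥ α)) + α ⬝ᵥ (θ.SigmaW *ᵥ α)

/-- The summands on the right are the failure probabilities of the four events: norm of the design
noise, its Frobenius norm, smallest singular value of the factors, regression noise energy. -/
theorem measure_excessRisk_gt_le {n p K : ℕ} (hn : 0 < n) (hp : 0 < p) {θ : Param p K}
    {γε γz γw c' c₀ κ cδ : ℝ} (hγε : 0 < γε) (hγz : 0 < γz) (hγw : 0 < γw) (hc' : 0 < c')
    (hc₀ : 400 * γw ^ 2 * (1 + 1 / c') ≤ c₀) (hκ : 1 < κ) (hcδ : 0 < cδ)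
    {ρZ : Measure (Fin K → ℝ)} {ρW : Measure (Fin p → ℝ)} {πε : Measure ℝ}
    [IsProbabilityMeasure ρZ] [IsProbabilityMeasure ρW] [IsProbabilityMeasure πε]
    (hmomZ : HasMoments ρZ 1) (hsubZ : IsSubGaussianVec γz ρZ) (hmomW : HasMoments ρW 1)
    (hsubW : IsSubGaussianVec γw ρW)
    (hε : HasSubgaussianMGF (fun e : ℝ => e) (Real.toNNReal (θ.sigmaSq * γε ^ 2)) πε)
    (hσ : 0 ≤ θ.sigmaSq) (hSZ : θ.SigmaZ.PosSemidef) (hSW : θ.SigmaW.PosSemidef)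
    (hA : θ.A.rank = K) (hK : K ≤ Kbar κ c₀ n p)
    (hre : c' * (min n p : ℕ) ≤ effRank θ.SigmaW)
    {svals : (Fin n → Fin p → ℝ) → Fin (min n p) → ℝ}
    {lvecs : (Fin n → Fin p → ℝ) → Matrix (Fin n) (Fin (min n p)) ℝ}
    {rvecs : (Fin n → Fin p → ℝ) → Matrix (Fin p) (Fin (min n p)) ℝ}
    {s : (Fin n → Fin p → ℝ) → ℕ} (hsel : IsSelector κ c₀ svals lvecs rvecs s)
    {k : ℕ} (hk1 : 1 ≤ k) (hk : 56 * γz ^ 2 * (1 / 4) ^ k ≤ 1 / 32) :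
    ((Measure.pi fun _ : Fin n => ρZ).prod
        ((Measure.pi fun _ : Fin n => ρW).prod (Measure.pi fun _ : Fin n => πε)))
      {ω | riskConst γw γε c₀ κ cδ * (((K : ℝ) + Real.log n) * (θ.sigmaSq / n)
          + deltaW cδ n θ * (θ.β ⬝ᵥ ((θ.Aᵀ * θ.A)⁻¹ *ᵥ θ.β)))
        < excessRisk θ (coeffVec (Matrix.of (design θ ω.1 ω.2.1)) (rvecs (design θ ω.1 ω.2.1))
          (s (design θ ω.1 ω.2.1)) (response θ ω.1 ω.2.2))}
      ≤ ENNReal.ofReal (Real.exp (-n))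
        + ENNReal.ofReal (Real.exp (-(n / (8 * (80 * (γw ^ 2) ^ 2)))))
        + (ENNReal.ofReal (Real.exp (-n))
          + (5 ^ K) ^ k * ENNReal.ofReal (Real.exp (-(n / (8 * (80 * (γz ^ 2) ^ 2))))))
        + ENNReal.ofReal (Real.exp (-Real.log n)) := by
  have hn' : (0 : ℝ) < n := by exact_mod_cast hn
  have hn1 : (1 : ℝ) ≤ n := by exact_mod_cast hn
  have hmin0 : (0 : ℝ) < (min n p : ℕ) := by exact_mod_cast lt_min hn hp
  have hgw : 0 < γw ^ 2 := by positivity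
  have hgz : 0 < γz ^ 2 := by positivity
  have hc₀0 : 0 < c₀ := lt_of_lt_of_le (by positivity) hc₀
  have hlog : 0 ≤ Real.log n := Real.log_nonneg hn1
  set l := opNorm θ.SigmaW with hl
  set t := θ.SigmaW.trace with ht
  -- A zero `Σ_W` would have effective rank `0 / 0 = 0`, which the effective rank hypothesis
  -- excludes.
  have hl0 : 0 < l := by
    refine lt_of_le_of_ne (opNorm_nonneg _) fun h0 => ?_
    have h1 : effRank θ.SigmaW = 0 := by rw [effRank, ← hl, ← h0, div_zero]
    rw [h1] at hre
    have := mul_pos hc' hmin0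
    linarith
  have hre' : c' * (min n p : ℕ) * l ≤ t := by
    rw [effRank, le_div_iff₀ hl0] at hre
    exact hre
  have ht0 : 0 < t := lt_of_lt_of_le (by positivity) hre'
  obtain ⟨e, lam, he, hlam0, hlaml, hlamt, hlamR⟩ := exists_spectral hSW
  set B := 48 * γw ^ 2 * (n * l + t) with hB
  have hB0 : 0 < B := by positivity
  set g := θ.sigmaSq * γε ^ 2 with hg
  have hg0 : 0 ≤ g := by positivity
  let S₁ : Set (Fin n → Fin p → ℝ) := {w | ¬ ∀ x : Fin p → ℝ,
      ((Matrix.of w * psdSqrt θ.SigmaW) *ᵥ x) ⬝ᵥ ((Matrix.of w * psdSqrt θ.SigmaW) *ᵥ x)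
        ≤ 4 * (2 * γw ^ 2 * ∑ j, lam j + 12 * γw ^ 2 * l * n) * (x ⬝ᵥ x)}
  let S₂ : Set (Fin n → Fin p → ℝ) :=
    {w | ∑ i, ∑ j, lam j * (w i ⬝ᵥ e j) ^ 2 ≤ n * (∑ j, lam j) / 2}
  let S₃ : Set (Fin n → Fin K → ℝ) := {z | ¬ ∀ x : Fin K → ℝ,
      n / 32 * (x ⬝ᵥ x) ≤ (Matrix.of z *ᵥ x) ⬝ᵥ (Matrix.of z *ᵥ x)}
  -- Capping `s` at `K` makes the event controllable for every design; `s ≤ K` is known only on the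
  -- other good events. The energy is written with the right vectors, for which measurability is
  -- assumed.
  let S₄ : Set ((Fin n → Fin K → ℝ) × (Fin n → Fin p → ℝ) × (Fin n → ℝ)) :=
    {ω | 4 * g * (K + Real.log n) < noiseEnergy (Matrix.of (design θ ω.1 ω.2.1))
      (rvecs (design θ ω.1 ω.2.1)) (min (s (design θ ω.1 ω.2.1)) K) ω.2.2}
  have hsub : {ω : (Fin n → Fin K → ℝ) × (Fin n → Fin p → ℝ) × (Fin n → ℝ) |
        riskConst γw γε c₀ κ cδ * (((K : ℝ) + Real.log n) * (θ.sigmaSq / n)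
          + deltaW cδ n θ * (θ.β ⬝ᵥ ((θ.Aᵀ * θ.A)⁻¹ *ᵥ θ.β)))
        < excessRisk θ (coeffVec (Matrix.of (design θ ω.1 ω.2.1)) (rvecs (design θ ω.1 ω.2.1))
          (s (design θ ω.1 ω.2.1)) (response θ ω.1 ω.2.2))}
      ⊆ ((Set.univ ×ˢ (S₁ ×ˢ Set.univ)) ∪ (Set.univ ×ˢ (S₂ ×ˢ Set.univ)))
        ∪ (S₃ ×ˢ Set.univ) ∪ S₄ := by
    rintro ⟨z, w, ε⟩ hω
    by_contra hcon
    simp only [Set.mem_union, Set.mem_prod, Set.mem_univ, true_and, and_true, not_or] at hcon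
    obtain ⟨⟨⟨c1, c2⟩, c3⟩, c4⟩ := hcon
    have c1 := not_not.1 c1
    have c3 := not_not.1 c3
    have c2 : n * (∑ j, lam j) / 2 < ∑ i, ∑ j, lam j * (w i ⬝ᵥ e j) ^ 2 := not_le.1 c2
    have c4 : noiseEnergy (Matrix.of (design θ z w)) (rvecs (design θ z w))
        (min (s (design θ z w)) K) ε ≤ 4 * g * (K + Real.log n) := not_lt.1 c4
    refine absurd (show (_ : ℝ) < _ from hω) (not_lt.2 ?_)
    change excessRisk θ (coeffVec (Matrix.of (design θ z w)) (rvecs (design θ z w))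
      (s (design θ z w)) (response θ z ε)) ≤ _
    set x := design θ z w with hxdef
    set W := Matrix.of w * psdSqrt θ.SigmaW with hWdef
    have hsvd := hsel.isSVD x
    have hx : Matrix.of x = Matrix.of z * psdSqrt θ.SigmaZ * θ.Aᵀ + W := of_design θ z w
    have hW : ∀ y, (W *ᵥ y) ⬝ᵥ (W *ᵥ y) ≤ B * (y ⬝ᵥ y) := by
      intro y
      refine (c1 y).trans (mul_le_mul_of_nonneg_right ?_ (dotProduct_self_nonneg' y))
      rw [hlamt, hB]
      have : 0 < γw ^ 2 * t := by positivity
      linarith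
    have hF : n * t / 2 ≤ frobSq W := by
      rw [hlamt] at c2
      refine c2.le.trans (le_of_eq ?_)
      rw [frobSq_eq_sum_row]
      refine Finset.sum_congr rfl fun i _ => ?_
      rw [← hlamR, hWdef, Matrix.mul_apply_eq_vecMul]
      rfl
    obtain ⟨g1, g2, g3⟩ := selector_bounds hn hp hsvd hx hgw hκ hc' hc₀ ht0 hl0.le hre' hB hW hF hK
      (hsel.le_Kbar x) (hsel.isMin x)
    rw [min_eq_left g1] at c4
    have hne : ∀ j : Fin (min n p), (j : ℕ) < s x → svals x j ≠ 0 := by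
      intro j hj h0
      have := g2 j hj
      rw [h0] at this
      norm_num at this
      linarith
    rw [← hsvd.sum_col_sq_eq_noiseEnergy hne] at c4
    obtain ⟨b, hb, hbb⟩ := exists_preimage_of_rank θ.A hA θ.β
    have hmain := excess_risk_le (SigmaW := θ.SigmaW) hn hsvd hx (mulVec_psdSqrt_sq hSZ) c3 hB0 hW
      hb (by
        have : 0 < 1 + κ := by linarith
        positivity) g2 g3 c4 (congrArg _ (response_eq θ z ε))
    refine hmain.trans ?_
    rw [← hbb]
    refine riskConst_bound hn hγw hγε hc₀0 hκ hcδ hl0.le ht0 (dotProduct_self_nonneg' b)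
      (by positivity) hB ?_
    rw [hg]
    field_simp
  refine (measure_mono hsub).trans ((measure_union_le _ _).trans (add_le_add
    ((measure_union_le _ _).trans (add_le_add ((measure_union_le _ _).trans (add_le_add ?_ ?_)) ?_))
    ?_))
  · rw [Measure.prod_prod, Measure.prod_prod, measure_univ, measure_univ, one_mul, mul_one]
    exact measure_pi_opNorm_le hgw (VecSubG.of_isSubGaussianVec hsubW) e he lam hlam0 hl0 hlaml _
      hlamR
  · rw [Measure.prod_prod, Measure.prod_prod, measure_univ, measure_univ, one_mul, mul_one]
    exact measure_pi_quadratic_le hgw hmomW (VecSubG.of_isSubGaussianVec hsubW) e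
      (fun j => by rw [he, if_pos rfl]) lam hlam0 (by rw [hlamt]; exact ht0) n
  · rw [Measure.prod_prod, measure_univ, mul_one]
    exact measure_pi_smallest_singular_le (hK.trans ((min_le_right _ _).trans (min_le_left _ _))) hn
      hgz hmomZ (VecSubG.of_isSubGaussianVec hsubZ) hk1 hk
  · have hS₄ : MeasurableSet S₄ := by
      refine measurableSet_lt measurable_const (measurable_noiseEnergy (measurable_design θ)
        (fun i j => (hsel.measurable_rvecs i j).comp (measurable_design θ)) ?_
        (measurable_snd.comp measurable_snd))
      exact (hsel.measurable_s.comp (measurable_design θ)).min measurable_const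
    -- Given `z` and `w`, the design, its singular vectors and `s` are fixed and only the regression
    -- noise is random.
    refine measure_prod_le_of_forall _ _ hS₄ fun z => ?_
    have hS₄z : MeasurableSet (Prod.mk z ⁻¹' S₄) := measurable_prodMk_left hS₄
    refine measure_prod_le_of_forall _ _ hS₄z fun w => ?_
    change (Measure.pi fun _ : Fin n => πε) {ε | 4 * g * (K + Real.log n)
      < noiseEnergy (Matrix.of (design θ z w)) (rvecs (design θ z w))
        (min (s (design θ z w)) K) ε} ≤ _
    exact measure_pi_noiseEnergy_le (hsel.isSVD (design θ z w)) hg0 hε (min_le_right _ _) _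

theorem riskConst_pos {γw γε c₀ κ cδ : ℝ} (hγw : 0 < γw) (hγε : 0 < γε) (hc₀ : 0 < c₀) (hκ : 1 < κ)
    (hcδ : 0 < cδ) : 0 < riskConst γw γε c₀ κ cδ := by
  have : 0 < 1 + κ := by linarith
  unfold riskConst
  positivity

theorem exp_neg_div_le {x a : ℝ} (hx : 0 < x) (ha : 0 < a) : Real.exp (-(x / a)) ≤ a / x := by
  have h : x / a ≤ Real.exp (x / a) := by linarith [Real.add_one_le_exp (x / a)]
  rw [Real.exp_neg, inv_le_comm₀ (Real.exp_pos _) (by positivity), inv_div]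
  exact h

/-- The failure probabilities add up to at most `L / n`. -/
theorem failure_probability_le {n K k : ℕ} (hn : 0 < n) {a a' C : ℝ} (ha : 0 < a) (ha' : 0 < a')
    (hC : 0 < C) (hk : 1 ≤ k) (hKC : (K : ℝ) * Real.log n ≤ C * n)
    (hbig : Real.exp (4 * a * C * k) < n) :
    ENNReal.ofReal (Real.exp (-n)) + ENNReal.ofReal (Real.exp (-(n / a')))
        + (ENNReal.ofReal (Real.exp (-n)) + (5 ^ K) ^ k * ENNReal.ofReal (Real.exp (-(n / a))))
        + ENNReal.ofReal (Real.exp (-Real.log n))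
      ≤ ENNReal.ofReal ((3 + a' + 2 * a) / n) := by
  have hn' : (0 : ℝ) < n := by exact_mod_cast hn
  have hk0 : (0 : ℝ) < k := by exact_mod_cast hk
  have h1 : Real.exp (-n) ≤ 1 / n := by simpa using exp_neg_div_le hn' one_pos
  have h2 := exp_neg_div_le hn' ha'
  have h3 : ((5 : ℝ) ^ K) ^ k * Real.exp (-(n / a)) ≤ 2 * a / n := by
    have hlog : 4 * a * C * k < Real.log n := (Real.lt_log_iff_exp_lt hn').2 hbig
    -- Since `log n` exceeds `4 a C k`, the net size `5^{Kk} ≤ exp (2Kk)` consumes at most half of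
    -- the exponent `n / a`.
    have hKk : 4 * a * K * k ≤ n := by
      have g1 : (K : ℝ) * (4 * a * C * k) ≤ C * n :=
        (mul_le_mul_of_nonneg_left hlog.le (by positivity)).trans hKC
      refine le_of_mul_le_mul_left ?_ hC
      linarith
    have h5 : (5 : ℝ) ≤ Real.exp 2 := by
      have := Real.quadratic_le_exp_of_nonneg (x := 2) (by norm_num)
      linarith
    calc ((5 : ℝ) ^ K) ^ k * Real.exp (-(n / a))
        ≤ (Real.exp 2 ^ K) ^ k * Real.exp (-(n / a)) := by gcongr
      _ = Real.exp (k * (K * 2) + -(n / a)) := by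
          rw [← Real.exp_nat_mul, ← Real.exp_nat_mul, ← Real.exp_add]
      _ ≤ Real.exp (-(n / (2 * a))) := by
          refine Real.exp_le_exp.2 ?_
          have e1 : (n : ℝ) / a = n / (2 * a) + n / (2 * a) := by field_simp; norm_num
          have e2 : (k : ℝ) * (K * 2) ≤ n / (2 * a) := by
            rw [le_div_iff₀ (by positivity)]
            linarith
          linarith
      _ ≤ 2 * a / n := exp_neg_div_le hn' (by positivity)
  have h4 : Real.exp (-Real.log n) = 1 / n := by
    rw [Real.exp_neg, Real.exp_log hn', one_div]
  have h5 : ((5 : ℝ≥0∞) ^ K) ^ k = ENNReal.ofReal ((5 ^ K) ^ k) := by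
    rw [ENNReal.ofReal_pow (by positivity), ENNReal.ofReal_pow (by norm_num)]
    norm_num
  rw [h5, ← ENNReal.ofReal_mul (by positivity), ← ENNReal.ofReal_add (by positivity) (by positivity),
    ← ENNReal.ofReal_add (by positivity) (by positivity),
    ← ENNReal.ofReal_add (by positivity) (by positivity),
    ← ENNReal.ofReal_add (by positivity) (by positivity)]
  refine ENNReal.ofReal_le_ofReal ?_
  have e : (3 + a' + 2 * a) / n = 1 / n + a' / n + (1 / n + 2 * a / n) + 1 / n := by ring
  rw [e, h4]
  gcongr

/-- The law of an observation as the image of the law of the whitened variables. -/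
theorem IsFRM.law_whitened {p K : ℕ} {θ : Param p K} {πZ : Measure (Fin K → ℝ)}
    {πW : Measure (Fin p → ℝ)} {πε : Measure ℝ} {ν : Measure ((Fin p → ℝ) × ℝ)}
    (h : IsFRM θ πZ πW πε ν) {ρZ : Measure (Fin K → ℝ)} {ρW : Measure (Fin p → ℝ)}
    [IsProbabilityMeasure ρZ] [IsProbabilityMeasure ρW]
    (hZ : πZ = ρZ.map fun x => psdSqrt θ.SigmaZ *ᵥ x)
    (hW : πW = ρW.map fun x => psdSqrt θ.SigmaW *ᵥ x) :
    ν = (ρZ.prod (ρW.prod πε)).map fun q => (θ.A *ᵥ (psdSqrt θ.SigmaZ *ᵥ q.1)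
      + psdSqrt θ.SigmaW *ᵥ q.2.1, (psdSqrt θ.SigmaZ *ᵥ q.1) ⬝ᵥ θ.β + q.2.2) := by
  have := h.probε
  have m1 : Measurable fun x : Fin K → ℝ => psdSqrt θ.SigmaZ *ᵥ x :=
    measurable_mulVec _ measurable_id
  have m2 : Measurable fun x : Fin p → ℝ => psdSqrt θ.SigmaW *ᵥ x :=
    measurable_mulVec _ measurable_id
  have m3 : Measurable fun q : (Fin K → ℝ) × (Fin p → ℝ) × ℝ =>
      (θ.A *ᵥ q.1 + q.2.1, q.1 ⬝ᵥ θ.β + q.2.2) :=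
    ((measurable_mulVec _ measurable_fst).add (measurable_fst.comp measurable_snd)).prodMk
      ((measurable_dotProduct measurable_fst measurable_const).add
        (measurable_snd.comp measurable_snd))
  have hε : πε = πε.map id := Measure.map_id.symm
  rw [h.law, hZ, hW, hε, Measure.map_prod_map _ _ m2 measurable_id,
    Measure.map_prod_map _ _ m1 (m2.prodMap measurable_id),
    Measure.map_map m3 (m1.prodMap (m2.prodMap measurable_id)), Measure.map_id]
  rfl

theorem measurable_excessRisk {p K : ℕ} (θ : Param p K) : Measurable (excessRisk θ) := by
  have m1 : Measurable fun α : Fin p → ℝ => θ.β - θ.Aᵀ *ᵥ α :=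
    measurable_const.sub (measurable_mulVec _ measurable_id)
  exact (measurable_dotProduct m1 (measurable_mulVec _ m1)).add
    (measurable_dotProduct measurable_id (measurable_mulVec _ measurable_id))

end PCR

end

-- Constants and transfer to the given probability space

theorem corollary4 :
    ∀ γw : ℝ, 0 < γw → ∀ c' : ℝ, 0 < c' →
    -- the constant of the tuning sequence has to be large, in terms of `γw` and `c'` only
    ∃ c₀min : ℝ, 0 < c₀min ∧ ∀ c₀ : ℝ, c₀min ≤ c₀ →
    ∀ γε γz : ℝ, 0 < γε → 0 < γz →
    ∀ κ C c cδ : ℝ, 1 < κ → 0 < C → 0 < c → 0 < cδ →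
    -- the constants of the risk bound and of the probability depend on the above only
    ∃ M L : ℝ, 0 < M ∧ 0 < L ∧
    ∀ (n p K : ℕ), 0 < n → 0 < p →
    ∀ (θ : PCR.Param p K) (ν : Measure ((Fin p → ℝ) × ℝ)),
      PCR.FollowsSGFRM γε γz γw θ ν →
      (K : ℝ) * Real.log n ≤ C * n →
      Real.log p ≤ c * n →
      K ≤ PCR.Kbar κ c₀ n p →
      c' * (min n p : ℕ) ≤ PCR.effRank θ.SigmaW →
    ∀ (svals : (Fin n → Fin p → ℝ) → Fin (min n p) → ℝ)
      (lvecs : (Fin n → Fin p → ℝ) → Matrix (Fin n) (Fin (min n p)) ℝ)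
      (rvecs : (Fin n → Fin p → ℝ) → Matrix (Fin p) (Fin (min n p)) ℝ)
      (s : (Fin n → Fin p → ℝ) → ℕ),
      PCR.IsSelector κ c₀ svals lvecs rvecs s →
    ∀ (Ω : Type*) [MeasurableSpace Ω] (P : Measure Ω) [IsProbabilityMeasure P]
      (X : Fin n → Ω → Fin p → ℝ) (Y : Fin n → Ω → ℝ),
      -- the data: `n` independent copies of `(X, Y)`
      (∀ i, HasLaw (fun ω => (X i ω, Y i ω)) ν P) →
      iIndepFun (fun i ω => (X i ω, Y i ω)) P →
      1 - L / n ≤ P.real {ω |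
        PCR.risk ν
            (PCR.coeff (PCR.topVectors (rvecs fun i => X i ω) (s fun i => X i ω))
              (Matrix.of fun i => X i ω) (fun i => Y i ω))
          - θ.sigmaSq ≤
        M * (((K : ℝ) + Real.log n) * (θ.sigmaSq / n)
          + PCR.deltaW cδ n θ * (θ.β ⬝ᵥ ((θ.Aᵀ * θ.A)⁻¹ *ᵥ θ.β)))} := by
  intro γw hγw c' hc'
  refine ⟨400 * γw ^ 2 * (1 + 1 / c'), by positivity, ?_⟩
  intro c₀ hc₀ γε γz hγε hγz κ C c cδ hκ hC _ hcδ
  have hc₀0 : 0 < c₀ := lt_of_lt_of_le (by positivity) hc₀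
  -- The fineness `2^{-k}` of the net for the factors depends on `γz` only, so `M` and `L` stay
  -- uniform in `n`, `p`, `K` and `θ`.
  obtain ⟨k, hk1, hk⟩ : ∃ k : ℕ, 1 ≤ k ∧ 56 * γz ^ 2 * (1 / 4) ^ k ≤ 1 / 32 := by
    obtain ⟨m, hm⟩ := exists_pow_lt_of_lt_one (by positivity : 0 < 1 / 32 / (56 * γz ^ 2))
      (by norm_num : (1 / 4 : ℝ) < 1)
    refine ⟨m + 1, by omega, ?_⟩
    rw [lt_div_iff₀ (by positivity)] at hm
    have : (0 : ℝ) < 56 * γz ^ 2 * (1 / 4) ^ m := by positivity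
    rw [pow_succ (1 / 4 : ℝ) m]
    linarith
  set a := 8 * (80 * (γz ^ 2) ^ 2) with ha
  set a' := 8 * (80 * (γw ^ 2) ^ 2) with ha'
  have ha0 : 0 < a := by positivity
  have ha'0 : 0 < a' := by positivity
  set L := 3 + a' + 2 * a + Real.exp (4 * a * C * k) with hL
  have hL0 : 0 < L := by positivity
  refine ⟨PCR.riskConst γw γε c₀ κ cδ, L, PCR.riskConst_pos hγw hγε hc₀0 hκ hcδ, hL0, ?_⟩
  intro n p K hn hp θ ν hν hKC _ hK hre svals lvecs rvecs s hsel Ω _ P _ X Y hlaw hindep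
  have hn' : (0 : ℝ) < n := by exact_mod_cast hn
  -- The exponential in `L` makes the claim trivial for the small `n` that `failure_probability_le`
  -- does not cover.
  rcases le_or_gt (n : ℝ) (Real.exp (4 * a * C * k)) with hsmall | hbig
  · have h1 : 1 ≤ L / n := by
      rw [one_le_div hn']
      linarith
    have h2 := measureReal_nonneg (μ := P) (s := {ω | PCR.risk ν
            (PCR.coeff (PCR.topVectors (rvecs fun i => X i ω) (s fun i => X i ω))
              (Matrix.of fun i => X i ω) (fun i => Y i ω))
          - θ.sigmaSq ≤
        PCR.riskConst γw γε c₀ κ cδ * (((K : ℝ) + Real.log n) * (θ.sigmaSq / n)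
          + PCR.deltaW cδ n θ * (θ.β ⬝ᵥ ((θ.Aᵀ * θ.A)⁻¹ *ᵥ θ.β)))})
    linarith
  obtain ⟨πZ, πW, πε, hfrm, hsubε, ⟨ρZ, hρZ, hmomZ, hsubZ, hπZ⟩, ⟨ρW, hρW, hmomW, hsubW, hπW⟩⟩ := hν
  have := hfrm.probε
  have hσ : 0 ≤ θ.sigmaSq := by
    rw [← hfrm.varε]
    exact integral_nonneg fun e => sq_nonneg e
  set bound := PCR.riskConst γw γε c₀ κ cδ * (((K : ℝ) + Real.log n) * (θ.sigmaSq / n)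
          + PCR.deltaW cδ n θ * (θ.β ⬝ᵥ ((θ.Aᵀ * θ.A)⁻¹ *ᵥ θ.β))) with hbound
  let data : Ω → Fin n → (Fin p → ℝ) × ℝ := fun ω i => (X i ω, Y i ω)
  have hdata : AEMeasurable data P := aemeasurable_pi_iff.2 fun i => (hlaw i).aemeasurable
  -- The event is posed on the space of data, where `coeffVec` makes it measurable; the data
  -- themselves are only almost everywhere measurable on `Ω`.
  let bad : Set (Fin n → (Fin p → ℝ) × ℝ) := {d | bound < PCR.excessRisk θ
    (PCR.coeffVec (Matrix.of fun i => (d i).1) (rvecs fun i => (d i).1) (s fun i => (d i).1)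
      fun i => (d i).2)}
  have hbad : MeasurableSet bad := by
    have hx : Measurable fun (d : Fin n → (Fin p → ℝ) × ℝ) i => (d i).1 := by fun_prop
    have hy : Measurable fun (d : Fin n → (Fin p → ℝ) × ℝ) i => (d i).2 := by fun_prop
    exact measurableSet_lt measurable_const ((PCR.measurable_excessRisk θ).comp
      (PCR.measurable_coeffVec hx (fun i j => (hsel.measurable_rvecs i j).comp hx)
        (hsel.measurable_s.comp hx) hy))
  have hbadP : P (data ⁻¹' bad) ≤ ENNReal.ofReal ((3 + a' + 2 * a) / n) := by
    rw [← Measure.map_apply_of_aemeasurable hdata hbad,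
      (iIndepFun_iff_map_fun_eq_pi_map fun i => (hlaw i).aemeasurable).1 hindep]
    simp_rw [fun i => (hlaw i).map_eq]
    have hF : Measurable fun q : (Fin K → ℝ) × (Fin p → ℝ) × ℝ =>
        (θ.A *ᵥ (PCR.psdSqrt θ.SigmaZ *ᵥ q.1) + PCR.psdSqrt θ.SigmaW *ᵥ q.2.1,
          (PCR.psdSqrt θ.SigmaZ *ᵥ q.1) ⬝ᵥ θ.β + q.2.2) := by
      have m1 : Measurable fun q : (Fin K → ℝ) × (Fin p → ℝ) × ℝ =>
          PCR.psdSqrt θ.SigmaZ *ᵥ q.1 := PCR.measurable_mulVec _ measurable_fst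
      exact ((PCR.measurable_mulVec _ m1).add
        (PCR.measurable_mulVec _ (measurable_fst.comp measurable_snd))).prodMk
        ((PCR.measurable_dotProduct m1 measurable_const).add
          (measurable_snd.comp measurable_snd))
    have hΦ : Measurable fun (ω : (Fin n → Fin K → ℝ) × (Fin n → Fin p → ℝ) × (Fin n → ℝ))
        (i : Fin n) => (θ.A *ᵥ (PCR.psdSqrt θ.SigmaZ *ᵥ ω.1 i)
          + PCR.psdSqrt θ.SigmaW *ᵥ ω.2.1 i,
          (PCR.psdSqrt θ.SigmaZ *ᵥ ω.1 i) ⬝ᵥ θ.β + ω.2.2 i) := by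
      refine measurable_pi_iff.2 fun i => hF.comp (g := fun q => _)
        (f := fun ω : (Fin n → Fin K → ℝ) × (Fin n → Fin p → ℝ) × (Fin n → ℝ) =>
          (ω.1 i, ω.2.1 i, ω.2.2 i)) (by fun_prop)
    rw [hfrm.law_whitened hπZ hπW, PCR.pi_map_prod_eq ρZ ρW πε hF n, Measure.map_apply hΦ hbad]
    exact (PCR.measure_excessRisk_gt_le hn hp hγε hγz hγw hc' hc₀ hκ hcδ hmomZ hsubZ hmomW hsubW
      hsubε hσ hfrm.momentsZ.posSemidef hfrm.momentsW.posSemidef hfrm.rankA hK hre hsel hk1 hk).trans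
      (PCR.failure_probability_le hn ha0 ha'0 hC hk1 hKC hbig)
  have hcompl : {ω | PCR.risk ν
            (PCR.coeff (PCR.topVectors (rvecs fun i => X i ω) (s fun i => X i ω))
              (Matrix.of fun i => X i ω) (fun i => Y i ω))
          - θ.sigmaSq ≤ bound} = (data ⁻¹' bad)ᶜ := by
    ext ω
    have e : PCR.risk ν
            (PCR.coeff (PCR.topVectors (rvecs fun i => X i ω) (s fun i => X i ω))
              (Matrix.of fun i => X i ω) (fun i => Y i ω)) - θ.sigmaSq
        = PCR.excessRisk θ (PCR.coeffVec (Matrix.of fun i => X i ω) (rvecs fun i => X i ω)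
          (s fun i => X i ω) (fun i => Y i ω)) := by
      rw [hfrm.risk_eq, (hsel.isSVD fun i => X i ω).coeff_topVectors]
      rfl
    rw [Set.mem_ofPred_eq, e, Set.mem_compl_iff, Set.mem_preimage, Set.mem_ofPred_eq, not_lt]
  rw [hcompl]
  -- Subadditivity gives the needed half of the complement rule without measurability of the
  -- preimage.
  have h1 : (1 : ℝ) ≤ P.real (data ⁻¹' bad) + P.real (data ⁻¹' bad)ᶜ := by
    have := measureReal_union_le (μ := P) (data ⁻¹' bad) (data ⁻¹' bad)ᶜ
    rwa [Set.union_compl_self, probReal_univ] at this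
  have h2 : P.real (data ⁻¹' bad) ≤ (3 + a' + 2 * a) / n :=
    ENNReal.toReal_le_of_le_ofReal (by positivity) hbadP
  have h3 : (3 + a' + 2 * a) / n ≤ L / n := by
    gcongr
    linarith [Real.exp_pos (4 * a * C * k)]
  linarith
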